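/- Let $(W,\mathcal S)$ be a finite Coxeter system with Coxeter length $\ell$, let $B^+$ be its positive Artin monoid (the monoid generated by $\mathcal S$ subject to the braid relations only), and view $W$ inside $B^+$ by sending each element of $W$ to the class of any of its reduced words. Let $w_\circ$ be the longest element of $W$. For $m\ge 0$ let $W^{(m)}=\{w\in B^+ : w \text{ left-divides } w_\circ^m\}$ be the set of elements of the $m$-weak order. The Garside factors $w^{(1)},w^{(2)},\dots\in W$ of $w\in B^+$ are defined by $w_1=w$, $w^{(i)}=\gcd(w_i,w_\circ)$ (greatest common left divisor) and $w_i=w^{(i)}w_{i+1}$; thus $w^{(i)}=1$ once $w_i=1$. For a subset $J\subseteq\mathcal S$, let $W_J$ be the parabolic subgroup generated by $J$, and let $c=s_1s_2\cdots s_n$ be a Coxeter element of $W_J$, given by a word $\mathbf c$ in which each element of $J$ occurs exactly once. For $w\in W_J$ (or, when $J=\mathcal S$, for $w\in B^+$), the $c$-sorting word of $w$ is the lexicographically first subword (in terms of positions) of $\mathbf c^\infty=\mathbf c\,\mathbf c\,\mathbf c\cdots$ that is a reduced expression for $w$. The element $w$ is $c$-sortable if this subword uses, in the successive copies of $\mathbf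 c$, a decreasing sequence of subsets of the positions in $\mathbf c$. The root order $\leq_c$ on the reflections of $W_J$ is the order $t_1<t_1t_2t_1<t_1t_2t_3t_2t_1<\cdots$, where $t_1t_2t_3\cdots$ is the $c$-sorting word of the longest element of $W_J$. For $w\in W_J$ with right descent set $\mathrm{des}_R(w)=\{s\in \mathcal S:\ell(ws)<\ell(w)\}=\{s_{i_1},\dots,s_{i_k}\}\subseteq J$, numbered so that $ws_{i_1}w^{-1}<_c\cdots<_c ws_{i_k}w^{-1}$, the restriction of $c$ with respect to $w$ is the Coxeter element $c|_w=s_{i_1}\cdots s_{i_k}$ of $W_{\mathrm{des}_R(w)}$, given by this word. Let $c$ be a Coxeter element of $W$, given by a word as above. An element $w\in W^{(m)}$ with Garside factors $w^{(1)},\dots,w^{(m)}$ is called factorwise $c$-sortable if $w^{(i)}$ lies in $W_{\mathrm{des}_R(w^{(i-1)})}$ and is $c^{(i)}$-sortable there for all $1\le i\le m$, where $w^{(0)}=w_\circ$ (so that $W_{\mathrm{des}_R(w^{(0)})}=W$), $c^{(1)}=c$, and $c^{(i)}=c^{(i-1)}|_{w^{(i-1)}}$ for $2\le i\le m$. Then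 an element $w\in W^{(m)}$ is $c$-sortable if and only if it is factorwise $c$-sortable. -/

import Mathlib

/-- The braid relations of a Coxeter matrix: for all indices `i`, `j`, the alternating word
`⋯ i j` of length `M i j` is identified with the alternating word `⋯ j i` of the same length.
(For `i = j`, and for an entry `M i j = 0`, which encodes `∞`, the relation is void.) -/
def CoxeterMatrix.BraidRel {B : Type*} (M : CoxeterMatrix B) (a b : FreeMonoid B) : Prop :=
  ∃ i j : B, a = FreeMonoid.ofList (CoxeterSystem.braidWord M i j) ∧
    b = FreeMonoid.ofList (CoxeterSystem.braidWord M j i)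

/-- The positive Artin monoid `B⁺` : words in the simple generators modulo the braid relations. -/
abbrev CoxeterMatrix.ArtinMonoid {B : Type*} (M : CoxeterMatrix B) : Type _ :=
  PresentedMonoid M.BraidRel

/-- The element of the positive Artin monoid represented by a word. -/
def CoxeterMatrix.artinProd {B : Type*} (M : CoxeterMatrix B) (ω : List B) : M.ArtinMonoid :=
  (ω.map (PresentedMonoid.of M.BraidRel)).prod

namespace CoxeterSystem

/-- The copy in the positive Artin monoid of an element `w` of the Coxeter group: the element
represented by a reduced word for `w`. (All reduced words for `w` are related by braid moves, so
the choice of the reduced word does not matter.) -/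
noncomputable def toArtin {B : Type*} {M : CoxeterMatrix B} {W : Type*} [Group W]
    (cs : CoxeterSystem M W) (w : W) : M.ArtinMonoid :=
  M.artinProd (Classical.choose (cs.exists_isReduced w))

/-- The standard parabolic subgroup `W_J`. -/
def parabolic {B : Type*} {M : CoxeterMatrix B} {W : Type*} [Group W]
    (cs : CoxeterSystem M W) (J : Set B) : Subgroup W :=
  Subgroup.closure (cs.simple '' J)

theorem exists_longest {B : Type*} {M : CoxeterMatrix B} {W : Type*} [Group W] [Finite W]
    (cs : CoxeterSystem M W) (J : Set B) :
    ∃ w ∈ cs.parabolic J, ∀ u ∈ cs.parabolic J, cs.length u ≤ cs.length w :=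
  Set.exists_max_image (cs.parabolic J : Set W) cs.length (Set.toFinite _)
    ⟨1, (cs.parabolic J).one_mem⟩

/-- The longest element of the standard parabolic subgroup `W_J` of a finite Coxeter group.
(The length function of `W_J` is the restriction of the length function of `W`.) -/
noncomputable def longest {B : Type*} {M : CoxeterMatrix B} {W : Type*} [Group W] [Finite W]
    (cs : CoxeterSystem M W) (J : Set B) : W :=
  Classical.choose (cs.exists_longest J)

/-- The fundamental element `w₀` of the positive Artin monoid. -/
noncomputable def fundamental {B : Type*} {M : CoxeterMatrix B} {W : Type*} [Group W] [Finite W]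
    (cs : CoxeterSystem M W) : M.ArtinMonoid :=
  cs.toArtin (cs.longest Set.univ)

/-- The elements of the (right) `m`-weak order: the interval `[1, w₀ ^ m]` for left divisibility
in the positive Artin monoid. (`a ∣ b` means that `b = a * x` for some `x`; lengths add up
automatically, because the braid relations preserve the length of words.) -/
def mWeak {B : Type*} {M : CoxeterMatrix B} {W : Type*} [Group W] [Finite W]
    (cs : CoxeterSystem M W) (m : ℕ) : Set M.ArtinMonoid :=
  {w | w ∣ cs.fundamental ^ m}

/-- `v 0, v 1, v 2, …` are the Garside factors of `w`, continued by `1` after the last factor: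
starting from `r 0 = w`, the factor `v k` is the greatest common left divisor of `r k` and `w₀`,
and `r (k + 1)` is what remains of `r k` after removing `v k` on the left. -/
def IsGarsideFactorization {B : Type*} {M : CoxeterMatrix B} {W : Type*} [Group W] [Finite W]
    (cs : CoxeterSystem M W) (w : M.ArtinMonoid) (v : ℕ → W) : Prop :=
  ∃ r : ℕ → M.ArtinMonoid, r 0 = w ∧ ∀ k,
    r k = cs.toArtin (v k) * r (k + 1) ∧
    cs.toArtin (v k) ∣ cs.fundamental ∧
    ∀ d : M.ArtinMonoid, d ∣ r k → d ∣ cs.fundamental → d ∣ cs.toArtin (v k)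

/-- `c` is a reduced word for a (standard) Coxeter element: each simple reflection occurs
exactly once. -/
def IsCoxeterWord {B : Type*} (c : List B) : Prop :=
  c.Nodup ∧ ∀ i : B, i ∈ c

/-- The positions in the infinite word `c c c ⋯`, from left to right: `(k, j)` is the position `j`
in the `k`-th copy of `c` (copies are counted from `0`). -/
abbrev Position {B : Type*} (c : List B) : Type :=
  ℕ ×ₗ Fin c.length

/-- The subword of `c c c ⋯` on a list of positions. -/
def subword {B : Type*} (c : List B) (p : List (Position c)) : List B :=
  p.map fun x => c.get (ofLex x).2

/-- `p` is the list of positions of the lexicographically first subword of `c c c ⋯` that belongs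
to the set `E` of words. -/
def IsFirstSubword {B : Type*} (c : List B) (E : Set (List B)) (p : List (Position c)) : Prop :=
  p.Pairwise (· < ·) ∧ subword c p ∈ E ∧
    ∀ q : List (Position c), q.Pairwise (· < ·) → subword c q ∈ E → p ≤ q

/-- The positions used in each copy of `c` are also used in the copy before it. -/
def IsDecreasing {B : Type*} (c : List B) (p : List (Position c)) : Prop :=
  ∀ (k : ℕ) (j : Fin c.length), toLex (k + 1, j) ∈ p → toLex (k, j) ∈ p

/-- The reduced words for an element `w` of the Coxeter group. -/
def reducedWords {B : Type*} {M : CoxeterMatrix B} {W : Type*} [Group W]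
    (cs : CoxeterSystem M W) (w : W) : Set (List B) :=
  {ω | cs.IsReduced ω ∧ cs.wordProd ω = w}

/-- The words for an element `w` of the positive Artin monoid. They all have the same length, so
each of them is reduced. -/
def artinWords {B : Type*} (M : CoxeterMatrix B) (w : M.ArtinMonoid) : Set (List B) :=
  {ω | M.artinProd ω = w}

/-- An element `w` of the positive Artin monoid is `c`-sortable: its `c`-sorting word defines a
decreasing sequence of sets of positions in `c`. -/
def IsSortable {B : Type*} {M : CoxeterMatrix B} (c : List B) (w : M.ArtinMonoid) : Prop :=
  ∃ p : List (Position c), IsFirstSubword c (artinWords M w) p ∧ IsDecreasing c p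

/-- For a word `c` without repetitions in the set `J` of its letters, `w` is an element of the
standard parabolic subgroup `W_J`, and it is `c`-sortable there. (The reduced words for `w` in
`W_J` are the reduced words for `w` in `W`.) -/
def IsParabolicSortable {B : Type*} {M : CoxeterMatrix B} {W : Type*} [Group W]
    (cs : CoxeterSystem M W) (c : List B) (w : W) : Prop :=
  w ∈ cs.parabolic {i | i ∈ c} ∧
    ∃ p : List (Position c), IsFirstSubword c (cs.reducedWords w) p ∧ IsDecreasing c p

/-- For a word `c` without repetitions in the set `J` of its letters, and `w ∈ W_J`, the word `c'`
is the restriction of `c` with respect to `w`: it lists each right descent `s` of `w` once, in the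
order in which the reflections `w s w⁻¹` occur in the root order, i.e. in the reflection sequence
`s₁, s₁ s₂ s₁, …` of the `c`-sorting word `s₁ s₂ ⋯` of the longest element of `W_J`. -/
def IsRestriction {B : Type*} {M : CoxeterMatrix B} {W : Type*} [Group W] [Finite W]
    (cs : CoxeterSystem M W) (c : List B) (w : W) (c' : List B) : Prop :=
  c'.Nodup ∧ (∀ i : B, i ∈ c' ↔ cs.IsRightDescent w i) ∧
    ∃ p : List (Position c),
      IsFirstSubword c (cs.reducedWords (cs.longest {i | i ∈ c})) p ∧
      (c'.map fun i => w * cs.simple i * w⁻¹).Sublist (cs.leftInvSeq (subword c p))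

/-- An element `w` of the `m`-weak order is factorwise `c`-sortable. Here `v i` is the
`(i + 1)`-st Garside factor of `w` and `C i` is the Coxeter word for which it has to be sortable;
the letters of `C 0` are all simple reflections, and those of `C (i + 1)` are the right descents
of `v i`. -/
def IsFactorwiseSortable {B : Type*} {M : CoxeterMatrix B} {W : Type*} [Group W] [Finite W]
    (cs : CoxeterSystem M W) (m : ℕ) (c : List B) (w : M.ArtinMonoid) : Prop :=
  ∃ (v : ℕ → W) (C : ℕ → List B), cs.IsGarsideFactorization w v ∧
    C 0 = c ∧ (∀ i, i + 1 < m → cs.IsRestriction (C i) (v i) (C (i + 1))) ∧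
    ∀ i, i < m → cs.IsParabolicSortable (C i) (v i)

end CoxeterSystem

/-! Write `c = s c'` with first letter `s`. Sortability obeys a recursion. If `w = s w'`, then `w`
is sortable for `c` exactly when `w'` is sortable for the rotated word `c' s`. If `s` does not
divide `w`, the letter is dropped and `c'` is used instead. `isSortable_iff` identifies this
recursion with the definition by positions. The theorem follows by iterating one statement,
`isArtinSortable_iff_head_rest`: an element is sortable for `c` if and only if its first Garside
factor is sortable for `c` and the remainder is sortable for the restriction of `c`. In the `m`-weak
order nothing remains after `m` rounds (`rest_iterate_eq_one`).

This peeling statement is proved by induction along the recursion. Let `w = s w'` and let `v` be the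
first Garside factor of `w'`. Then the first factor of `w` is `s y`, where `y` is the longest prefix
of `v` with `s y` reduced. If `y = v`, the remainder does not change, and the restricted word loses
at most one letter, which commutes to the front and is skipped there. If `y ≠ v`, there is an `i`
with `y s_i = s y`; the remainder begins with `s_i`, and `i` commutes to the front of the restricted
word and is taken. Sortability on either side then forces `v = s y`, and rotating `c` rotates the
restricted word. Commuting adjacent letters is harmless by `isArtinSortable_swap_iff`.

The root order is controlled by the skew-symmetric form `ω_c` of Reading and Speyer. It is invariant
when `c` is rotated and roots are reflected in `s` (`omega_rotate`), and an initial simple root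
pairs nonnegatively with every positive root. Hence in the inversion sequence of a sorting word, an
earlier and a later root are orthogonal or pair positively (`IsSorting.pairwise`). Since longest
elements are sortable (`exists_isSorting_longest`), restrictions can be described by `ω_c` alone. In
the case `y ≠ v`, `IsSorting.exists_remove_inversion` and `IsSorting.exists_cover_list` pass between
the sortability of `y` and of `s y`.

The foundations rest on the geometric representation: a root is positive or negative
(`geom_inv_root_nonneg`). This gives Matsumoto's theorem, hence the copy of `W` in the monoid, and a
diamond argument gives longest prefixes. They define an action of the monoid on pairs of a simple
element and a remainder, from which the first Garside factor and left cancellation are read off. -/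

noncomputable section

/-! ### The geometric representation. -/

namespace CoxeterMatrix

variable {B : Type*} (M : CoxeterMatrix B)

/-- The entries of the Gram matrix (scaled so that simple roots have square length `2`) of the
geometric representation. -/
def gram (i j : B) : ℝ := -2 * Real.cos (Real.pi / M i j)

theorem gram_self (i : B) : M.gram i i = 2 := by simp [gram]

theorem gram_comm (i j : B) : M.gram i j = M.gram j i := by simp [gram, M.symmetric i j]

theorem gram_nonpos {i j : B} (h : i ≠ j) : M.gram i j ≤ 0 := by
  have h1 := M.off_diagonal i j h
  have : 0 ≤ Real.cos (Real.pi / M i j) := by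
    rcases Nat.eq_zero_or_pos (M i j) with h0 | h0
    · simp [h0]
    · have h2 : (2 : ℝ) ≤ M i j := by exact_mod_cast (by omega : 2 ≤ M i j)
      apply Real.cos_nonneg_of_neg_pi_div_two_le_of_le
      · have := Real.pi_pos
        have : 0 ≤ Real.pi / M i j := by positivity
        linarith
      · exact div_le_div_of_nonneg_left Real.pi_pos.le (by norm_num) h2
  simp only [gram]; linarith

/-- The bilinear form of the geometric representation. -/
def form : (B →₀ ℝ) →ₗ[ℝ] (B →₀ ℝ) →ₗ[ℝ] ℝ :=
  Finsupp.linearCombination ℝ fun i => Finsupp.linearCombination ℝ (M.gram i)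

/-- The simple roots. -/
def root (i : B) : B →₀ ℝ := Finsupp.single i 1

variable {M}

theorem root_apply_self (i : B) : root i i = 1 := by simp [root]

theorem root_apply_ne {i j : B} (h : i ≠ j) : root i j = 0 := by simp [root, h]

theorem root_nonneg (i : B) : 0 ≤ root i := by
  intro j; by_cases h : i = j
  · subst h; simp [root]
  · simp [root_apply_ne h]

variable (M)

theorem form_root_root (i j : B) : M.form (root i) (root j) = M.gram i j := by
  simp [form, root]

theorem form_root_self (i : B) : M.form (root i) (root i) = 2 := by
  rw [form_root_root, gram_self]

theorem form_comm (x y : B →₀ ℝ) : M.form x y = M.form y x := by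
  have : M.form = M.form.flip := by
    ext i j
    simpa [root] using (show M.form (root i) (root j) = M.form (root j) (root i) by
      rw [form_root_root, form_root_root, M.gram_comm])
  conv_lhs => rw [this]
  rfl

/-- The simple reflections of the geometric representation. -/
def geomReflection (i : B) : (B →₀ ℝ) ≃ₗ[ℝ] (B →₀ ℝ) :=
  Module.reflection (M.form_root_self i)

theorem geomReflection_apply (i : B) (x : B →₀ ℝ) :
    M.geomReflection i x = x - M.form (root i) x • root i := Module.reflection_apply _ _

-- Powers of a product of two reflections are given by Chebyshev polynomials `S_n` at `2 cos 2θ`,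
-- with `θ = π / m`, and `S_n(2 cos 2θ) sin 2θ = sin (2(n + 1)θ)`. The terms that differ from the
-- identity contain the factor `S_{k-1} = 0` if `m = 2k`, and `S_k + S_{k-1} = 0` if `m = 2k + 1`.
open Polynomial.Chebyshev in
theorem isLiftable_geomReflection : M.IsLiftable M.geomReflection := by
  intro i j
  ext1 z
  by_cases hij : i = j
  · subst hij
    simp only [diagonal, pow_one, LinearEquiv.mul_apply]
    exact Module.involutive_reflection _ z
  -- This case is separate because `sin 2θ = 0` cannot be cancelled there.
  by_cases h2 : M i j = 2
  · have h0 : M.gram i j = 0 := by simp [gram, h2]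
    have h0' : M.gram j i = 0 := by rw [gram_comm, h0]
    simp only [h2, pow_two, geomReflection_apply, map_sub, map_smul, form_root_root, gram_self, h0,
      h0', LinearEquiv.mul_apply, LinearEquiv.coe_one, id_eq]
    module
  have h1 := M.off_diagonal i j hij
  rcases Nat.eq_zero_or_pos (M i j) with hm0 | hm0
  · simp [hm0]
  set m := M i j with hm
  set θ := Real.pi / m with hθ
  have hmR : (3 : ℝ) ≤ m := by exact_mod_cast (by omega : 3 ≤ m)
  have hθm : m * θ = Real.pi := by rw [hθ]; field_simp
  have hsin : Real.sin (2 * θ) ≠ 0 := by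
    apply ne_of_gt
    have hp := Real.pi_pos
    apply Real.sin_pos_of_pos_of_lt_pi
    · positivity
    · nlinarith [show 0 < θ by positivity]
  have ht : (2 * Real.cos (2 * θ)) =
      M.form (root i) (root j) * M.form (root j) (root i) - 2 := by
    rw [form_root_root, form_root_root, M.gram_comm j i, gram, ← hm, ← hθ, Real.cos_two_mul]; ring
  have hS (n : ℤ) : (S ℝ n).eval (2 * Real.cos (2 * θ)) * Real.sin (2 * θ) =
      Real.sin ((n + 1) * (2 * θ)) := by
    rw [← U_real_cos, ← S_comp_two_mul_X]; simp
  have := Module.reflection_mul_reflection_pow_apply (M.form_root_self i) (M.form_root_self j) m z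
    (2 * Real.cos (2 * θ)) ht
  simp only [geomReflection]
  rw [this]
  rcases Nat.even_or_odd' m with ⟨k, hk | hk⟩
  · have e1 : ((m : ℤ) - 2) / 2 = k - 1 := by omega
    have e2 : ((m : ℤ) - 1) / 2 = k - 1 := by omega
    have h0 : (S ℝ ((k : ℤ) - 1)).eval (2 * Real.cos (2 * θ)) = 0 := by
      have := hS ((k : ℤ) - 1)
      have e : (((k : ℤ) - 1 : ℤ) + 1 : ℝ) * (2 * θ) = Real.pi := by
        rw [← hθm, hk]; push_cast; ring
      rw [e, Real.sin_pi] at this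
      exact (mul_eq_zero.1 this).resolve_right hsin
    simp [e1, e2, h0]
  · have e1 : ((m : ℤ) - 2) / 2 = k - 1 := by omega
    have e2 : ((m : ℤ) - 1) / 2 = k := by omega
    have e3 : ((m : ℤ) - 3) / 2 = k - 1 := by omega
    have e4 : (m : ℤ) / 2 = k := by omega
    have h0 : (S ℝ (k : ℤ)).eval (2 * Real.cos (2 * θ)) +
        (S ℝ ((k : ℤ) - 1)).eval (2 * Real.cos (2 * θ)) = 0 := by
      have h1 := hS k
      have h2 := hS ((k : ℤ) - 1)
      have e : Real.sin (((k : ℤ) + 1 : ℝ) * (2 * θ)) +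
          Real.sin ((((k : ℤ) - 1 : ℤ) + 1 : ℝ) * (2 * θ)) = 0 := by
        have e1 : ((k : ℤ) + 1 : ℝ) * (2 * θ) = Real.pi + θ := by
          rw [← hθm, hk]; push_cast; ring
        have e2 : (((k : ℤ) - 1 : ℤ) + 1 : ℝ) * (2 * θ) = Real.pi - θ := by
          rw [← hθm, hk]; push_cast; ring
        rw [e1, e2, Real.sin_pi_sub, add_comm Real.pi, Real.sin_add_pi]; ring
      rw [← h1, ← h2, ← add_mul] at e
      exact (mul_eq_zero.1 e).resolve_right hsin
    simp [e1, e2, e3, e4, h0]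

end CoxeterMatrix

namespace CoxeterSystem

open CoxeterMatrix

variable {B : Type*} {M : CoxeterMatrix B} {W : Type*} [Group W] (cs : CoxeterSystem M W)

/-- The geometric representation. -/
def geom : W →* ((B →₀ ℝ) ≃ₗ[ℝ] (B →₀ ℝ)) := cs.lift ⟨_, M.isLiftable_geomReflection⟩

theorem geom_simple (i : B) (x : B →₀ ℝ) :
    cs.geom (cs.simple i) x = x - M.form (root i) x • root i := by
  rw [geom, cs.lift_apply_simple M.isLiftable_geomReflection, geomReflection_apply]

theorem geom_mul (u v : W) (x : B →₀ ℝ) : cs.geom (u * v) x = cs.geom u (cs.geom v x) := by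
  rw [map_mul]; rfl

theorem geom_one (x : B →₀ ℝ) : cs.geom 1 x = x := by rw [map_one]; rfl

theorem geom_inv_geom (u : W) (x : B →₀ ℝ) : cs.geom u⁻¹ (cs.geom u x) = x := by
  rw [← geom_mul, inv_mul_cancel, geom_one]

theorem geom_geom_inv (u : W) (x : B →₀ ℝ) : cs.geom u (cs.geom u⁻¹ x) = x := by
  rw [← geom_mul, mul_inv_cancel, geom_one]

theorem geom_simple_geom_simple (i : B) (x : B →₀ ℝ) :
    cs.geom (cs.simple i) (cs.geom (cs.simple i) x) = x := by
  rw [← geom_mul, simple_mul_simple_self, geom_one]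

theorem geom_simple_root (i : B) : cs.geom (cs.simple i) (root i) = -root i := by
  rw [geom_simple, form_root_self, two_smul]; abel

theorem geom_simple_apply_ne {i j : B} (h : i ≠ j) (x : B →₀ ℝ) :
    cs.geom (cs.simple i) x j = x j := by
  simp [geom_simple, root_apply_ne h]

theorem form_geom (w : W) (x y : B →₀ ℝ) :
    M.form (cs.geom w x) (cs.geom w y) = M.form x y := by
  induction w using cs.simple_induction_left generalizing x y with
  | one => simp
  | mul_simple_left w i ih =>
    rw [geom_mul, geom_mul, ← ih x y]
    simp only [geom_simple, map_sub, LinearMap.sub_apply, map_smul, LinearMap.smul_apply,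
      smul_eq_mul, form_root_self, M.form_comm (cs.geom w x) (root i)]
    ring

theorem form_geom_root (w : W) (i : B) :
    M.form (cs.geom w (root i)) (cs.geom w (root i)) = 2 := by
  rw [form_geom, form_root_self]

end CoxeterSystem

/-! ### Rank two computations and the positivity of roots. -/

namespace CoxeterSystem

open CoxeterMatrix

variable {B : Type*} {M : CoxeterMatrix B} {W : Type*} [Group W] (cs : CoxeterSystem M W)

/-- The sequence is `sin (nθ) / sin θ` with `θ = π / m`, and `n` itself in the infinite case. It
supplies the coordinates of the roots in a rank two parabolic. -/
theorem exists_dihedral_seq {i j : B} (h : i ≠ j) : ∃ u : ℕ → ℝ, u 0 = 0 ∧ u 1 = 1 ∧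
    (∀ n, u (n + 2) = -M.gram i j * u (n + 1) - u n) ∧ ∀ n, n ≤ M i j ∨ M i j = 0 → 0 ≤ u n := by
  have h1 := M.off_diagonal i j h
  rcases Nat.eq_zero_or_pos (M i j) with h0 | h0
  · refine ⟨fun n => n, by simp, by simp, fun n => ?_, fun n _ => by positivity⟩
    simp [gram, h0]; ring
  · set θ := Real.pi / M i j with hθ
    have hm : (2 : ℝ) ≤ M i j := by exact_mod_cast (by omega : 2 ≤ M i j)
    have hpi := Real.pi_pos
    have hθm : M i j * θ = Real.pi := by rw [hθ]; field_simp
    have hθ0 : 0 < θ := by positivity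
    have hs : 0 < Real.sin θ := Real.sin_pos_of_pos_of_lt_pi hθ0 (by nlinarith)
    refine ⟨fun n => Real.sin (n * θ) / Real.sin θ, by simp, ?_, fun n => ?_, fun n hn => ?_⟩
    · simp [hs.ne']
    · rw [gram, ← hθ]
      push_cast
      have e1 : Real.sin ((n + 2) * θ) = Real.sin ((n + 1) * θ + θ) := by ring_nf
      have e2 : Real.sin (n * θ) = Real.sin ((n + 1) * θ - θ) := by ring_nf
      rw [e1, e2, Real.sin_add, Real.sin_sub]
      field_simp; ring
    · apply div_nonneg _ hs.le
      apply Real.sin_nonneg_of_nonneg_of_le_pi (by positivity)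
      rw [← hθm]
      have : (n : ℝ) ≤ M i j := by exact_mod_cast hn.resolve_right h0.ne'
      gcongr

theorem geom_alternatingWord_inv {i j : B} {u : ℕ → ℝ} (h0 : u 0 = 0) (h1 : u 1 = 1)
    (hu : ∀ n, u (n + 2) = -M.gram i j * u (n + 1) - u n) (k : ℕ) :
    cs.geom (cs.wordProd (alternatingWord i j k))⁻¹ (root (if Even k then j else i)) =
      u (k + 1) • root j + u k • root i := by
  induction k generalizing i j with
  | zero => simp [alternatingWord, h0, h1]
  | succ k ih =>
    have e : (if Even (k + 1) then j else i) = (if Even k then i else j) := by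
      simp only [Nat.even_add_one]; split_ifs <;> rfl
    rw [alternatingWord_succ, wordProd_concat, mul_inv_rev, inv_simple, geom_mul, e,
      ih (by simpa [M.gram_comm j i] using hu), hu]
    simp only [geom_simple, map_add, map_smul, form_root_root, gram_self, M.gram_comm j i]
    module

theorem geom_alternatingWord_inv_nonneg {i j : B} (h : i ≠ j) {v : W}
    (hi : 0 ≤ cs.geom v⁻¹ (root i)) (hj : 0 ≤ cs.geom v⁻¹ (root j)) {k : ℕ}
    (hk : k < M i j ∨ M i j = 0) :
    0 ≤ cs.geom (cs.wordProd (alternatingWord i j k) * v)⁻¹ (root (if Even k then j else i)) := by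
  obtain ⟨u, h0, h1, hu, hp⟩ := exists_dihedral_seq (M := M) h
  rw [mul_inv_rev, geom_mul, cs.geom_alternatingWord_inv h0 h1 hu, map_add, map_smul, map_smul]
  have e1 : 0 ≤ u (k + 1) := hp _ (hk.imp_left (by omega))
  have e2 : 0 ≤ u k := hp _ (hk.imp_left (by omega))
  exact add_nonneg (smul_nonneg e1 hj) (smul_nonneg e2 hi)

/-- Among all length-additive factorizations with an alternating word on the left, take one with `v`
shortest: a remaining descent `i` or `j` of `v` could be moved into the alternating word. -/
theorem exists_dihedral_decomposition (w : W) {i j : B} : ∃ a b k v,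
    ((a = i ∧ b = j) ∨ (a = j ∧ b = i)) ∧ w = cs.wordProd (alternatingWord a b k) * v ∧
    cs.length w = k + cs.length v ∧ ¬ cs.IsLeftDescent v i ∧ ¬ cs.IsLeftDescent v j := by
  classical
  have hex : ∃ n, ∃ a b k v, ((a = i ∧ b = j) ∨ (a = j ∧ b = i)) ∧
      w = cs.wordProd (alternatingWord a b k) * v ∧
      cs.length w = k + cs.length v ∧ n = cs.length v :=
    ⟨_, i, j, 0, w, Or.inl ⟨rfl, rfl⟩, by simp [alternatingWord], by simp, rfl⟩
  obtain ⟨a, b, k, v, hab, hw, hl, hn⟩ := Nat.find_spec hex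
  have hmin := fun m => Nat.find_min hex (m := m)
  rw [hn] at hmin
  have ha : ¬ cs.IsLeftDescent v a := by
    intro h
    rw [isLeftDescent_iff] at h
    refine hmin (cs.length (cs.simple a * v)) (by omega)
      ⟨b, a, k + 1, cs.simple a * v, ?_, ?_, by omega, rfl⟩
    · tauto
    · rw [alternatingWord_succ, wordProd_concat, mul_assoc, simple_mul_simple_cancel_left, hw]
  have hb : ¬ cs.IsLeftDescent v b := by
    intro h
    rw [isLeftDescent_iff] at h
    cases k with
    | zero =>
      refine hmin (cs.length (cs.simple b * v)) (by omega)
        ⟨a, b, 1, cs.simple b * v, hab, ?_, by omega, rfl⟩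
      simpa [alternatingWord] using hw
    | succ k =>
      rw [alternatingWord_succ, wordProd_concat, mul_assoc] at hw
      have h1 := cs.length_mul_le (cs.wordProd (alternatingWord b a k)) (cs.simple b * v)
      have h2 := cs.length_wordProd_le (alternatingWord b a k)
      rw [length_alternatingWord] at h2
      rw [← hw] at h1
      omega
  refine ⟨a, b, k, v, hab, hw, hl, ?_, ?_⟩ <;> rcases hab with ⟨rfl, rfl⟩ | ⟨rfl, rfl⟩ <;> assumption

/-- Induction on length: with a left descent `t`, split off the part of `w` in the dihedral group of
`s` and `t`. The rest keeps both simple roots nonnegative by induction, and the dihedral part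
expresses the root in question with nonnegative coefficients. -/
theorem geom_inv_root_nonneg {w : W} {s : B} (h : ¬ cs.IsLeftDescent w s) :
    0 ≤ cs.geom w⁻¹ (root s) := by
  induction hn : cs.length w using Nat.strong_induction_on generalizing w s with
  | _ n ih =>
    by_cases hw1 : w = 1
    · subst hw1; simpa using root_nonneg s
    obtain ⟨t, ht⟩ := cs.exists_leftDescent_of_ne_one hw1
    have hst : s ≠ t := by rintro rfl; exact h ht
    obtain ⟨a, b, k, v, hab, hw, hl, hs', ht'⟩ := cs.exists_dihedral_decomposition w (i := s) (j := t)
    have hk : k ≠ 0 := by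
      rintro rfl
      have : w = v := by simpa [alternatingWord] using hw
      exact ht' (this ▸ ht)
    have hs0 := ih _ (by omega) hs' rfl
    have ht0 := ih _ (by omega) ht' rfl
    have hab' : a ≠ b := by rcases hab with ⟨rfl, rfl⟩ | ⟨rfl, rfl⟩; exacts [hst, hst.symm]
    have ha0 : 0 ≤ cs.geom v⁻¹ (root a) := by
      rcases hab with ⟨rfl, rfl⟩ | ⟨rfl, rfl⟩ <;> assumption
    have hb0 : 0 ≤ cs.geom v⁻¹ (root b) := by
      rcases hab with ⟨rfl, rfl⟩ | ⟨rfl, rfl⟩ <;> assumption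
    -- The first letter of the alternating word is a left descent of `w`, so `s` is the other
    -- letter, the one that would extend the word to the left.
    have hse : s = if Even k then b else a := by
      by_contra hne
      obtain ⟨k, rfl⟩ := Nat.exists_eq_succ_of_ne_zero hk
      have hse : s = if Even k then b else a := by
        simp only [Nat.succ_eq_add_one, Nat.even_add_one] at hne
        rcases hab with ⟨rfl, rfl⟩ | ⟨rfl, rfl⟩ <;> split_ifs at hne ⊢ <;> simp_all
      apply h
      have e : cs.simple s * w = cs.wordProd (alternatingWord a b k) * v := by
        rw [hw, Nat.succ_eq_add_one, alternatingWord_succ', wordProd_cons, ← hse, mul_assoc,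
          simple_mul_simple_cancel_left]
      rw [IsLeftDescent, e]
      have h1 := cs.length_mul_le (cs.wordProd (alternatingWord a b k)) v
      have h2 := cs.length_wordProd_le (alternatingWord a b k)
      rw [length_alternatingWord] at h2
      omega
    have hkM : k < M a b ∨ M a b = 0 := by
      by_contra! hcon
      apply cs.not_isReduced_alternatingWord a b hcon.2 (m := k + 1) (by omega)
      rw [not_isLeftDescent_iff] at h
      have h1 := cs.length_mul_le (cs.wordProd (alternatingWord a b (k + 1))) v
      have e : cs.simple s * w = cs.wordProd (alternatingWord a b (k + 1)) * v := by
        rw [hw, alternatingWord_succ', wordProd_cons, ← hse, mul_assoc]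
      rw [← e] at h1
      have h2 := cs.length_wordProd_le (alternatingWord a b (k + 1))
      rw [length_alternatingWord] at h2
      rw [IsReduced, length_alternatingWord]
      omega
    rw [hw, hse]
    exact cs.geom_alternatingWord_inv_nonneg hab' ha0 hb0 hkM

theorem geom_inv_root_nonpos {w : W} {s : B} (h : cs.IsLeftDescent w s) :
    cs.geom w⁻¹ (root s) ≤ 0 := by
  have := cs.geom_inv_root_nonneg (cs.isLeftDescent_iff_not_isLeftDescent_mul.1 h)
  rw [mul_inv_rev, inv_simple, geom_mul, geom_simple_root, map_neg] at this
  exact neg_nonneg.1 this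

theorem geom_root_ne_zero (w : W) (s : B) : cs.geom w (root s) ≠ 0 := by
  intro h
  have := cs.form_geom_root w s
  simp [h] at this

theorem isLeftDescent_iff_geom {w : W} {s : B} :
    cs.IsLeftDescent w s ↔ cs.geom w⁻¹ (root s) ≤ 0 := by
  refine ⟨cs.geom_inv_root_nonpos, fun h => by_contra fun h' => ?_⟩
  exact cs.geom_root_ne_zero _ _ (le_antisymm h (cs.geom_inv_root_nonneg h'))

theorem not_isLeftDescent_iff_geom {w : W} {s : B} :
    ¬ cs.IsLeftDescent w s ↔ 0 ≤ cs.geom w⁻¹ (root s) := by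
  refine ⟨cs.geom_inv_root_nonneg, fun h h' => ?_⟩
  exact cs.geom_root_ne_zero _ _ (le_antisymm (cs.geom_inv_root_nonpos h') h)

theorem isRightDescent_iff_geom {w : W} {s : B} :
    cs.IsRightDescent w s ↔ cs.geom w (root s) ≤ 0 := by
  rw [← isLeftDescent_inv_iff, isLeftDescent_iff_geom, inv_inv]

theorem not_isRightDescent_iff_geom {w : W} {s : B} :
    ¬ cs.IsRightDescent w s ↔ 0 ≤ cs.geom w (root s) := by
  rw [← isLeftDescent_inv_iff, not_isLeftDescent_iff_geom, inv_inv]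

theorem geom_root_nonneg_or_nonpos (w : W) (s : B) :
    0 ≤ cs.geom w (root s) ∨ cs.geom w (root s) ≤ 0 := by
  rw [← isRightDescent_iff_geom, ← not_isRightDescent_iff_geom]; tauto

theorem geom_injective {u v : W} (h : ∀ s, cs.geom u (root s) = cs.geom v (root s)) : u = v := by
  rw [← inv_mul_eq_one]
  by_contra hne
  obtain ⟨s, hs⟩ := cs.exists_rightDescent_of_ne_one hne
  rw [isRightDescent_iff_geom, geom_mul, ← h, geom_inv_geom] at hs
  have := hs s
  rw [root_apply_self] at this
  norm_num at this

theorem length_alternatingWord_mul {v : W} {i j : B} (h : i ≠ j) (hi : ¬ cs.IsLeftDescent v i)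
    (hj : ¬ cs.IsLeftDescent v j) {k : ℕ} (hk : k ≤ M i j ∨ M i j = 0) :
    cs.length (cs.wordProd (alternatingWord i j k) * v) = k + cs.length v := by
  induction k with
  | zero => simp [alternatingWord]
  | succ k ih =>
    have := cs.geom_alternatingWord_inv_nonneg h (cs.geom_inv_root_nonneg hi)
      (cs.geom_inv_root_nonneg hj) (k := k) (hk.imp_left (by omega))
    rw [← not_isLeftDescent_iff_geom, not_isLeftDescent_iff] at this
    rw [alternatingWord_succ', wordProd_cons, mul_assoc, this, ih (hk.imp_left (by omega))]
    omega

theorem exists_eq_braidWord_mul {w : W} {i j : B} (h : i ≠ j) (hi : cs.IsLeftDescent w i)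
    (hj : cs.IsLeftDescent w j) : ∃ v, w = cs.wordProd (braidWord M i j) * v ∧
      cs.length w = M i j + cs.length v ∧ M i j ≠ 0 := by
  obtain ⟨a, b, k, v, hab, hw, hl, hi', hj'⟩ := cs.exists_dihedral_decomposition w (i := i) (j := j)
  have hM : M a b = M i j := by
    rcases hab with ⟨rfl, rfl⟩ | ⟨rfl, rfl⟩; exacts [rfl, M.symmetric _ _]
  have hab' : a ≠ b := by rcases hab with ⟨rfl, rfl⟩ | ⟨rfl, rfl⟩; exacts [h, h.symm]
  have hk1 : ¬ (k < M a b ∨ M a b = 0) := by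
    intro hk
    have ha0 : 0 ≤ cs.geom v⁻¹ (root a) := by
      rcases hab with ⟨rfl, rfl⟩ | ⟨rfl, rfl⟩ <;> apply cs.geom_inv_root_nonneg <;> assumption
    have hb0 : 0 ≤ cs.geom v⁻¹ (root b) := by
      rcases hab with ⟨rfl, rfl⟩ | ⟨rfl, rfl⟩ <;> apply cs.geom_inv_root_nonneg <;> assumption
    have := cs.geom_alternatingWord_inv_nonneg hab' ha0 hb0 hk
    rw [← hw, ← not_isLeftDescent_iff_geom] at this
    apply this
    rcases hab with ⟨rfl, rfl⟩ | ⟨rfl, rfl⟩ <;> split_ifs <;> assumption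
  push Not at hk1
  have hk2 : k = M a b := by
    by_contra hne
    apply cs.not_isReduced_alternatingWord a b hk1.2 (m := k) (by omega)
    have h1 := cs.length_mul_le (cs.wordProd (alternatingWord a b k)) v
    have h2 := cs.length_wordProd_le (alternatingWord a b k)
    rw [← hw] at h1
    rw [length_alternatingWord] at h2
    rw [IsReduced, length_alternatingWord]
    omega
  refine ⟨v, ?_, by omega, by omega⟩
  rw [hw, hk2]
  rcases hab with ⟨rfl, rfl⟩ | ⟨rfl, rfl⟩
  · rfl
  · rw [cs.wordProd_braidWord_eq]

end CoxeterSystem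

/-! ### Words and lengths in the positive Artin monoid. -/

namespace CoxeterMatrix

variable {B : Type*} (M : CoxeterMatrix B)

theorem artinProd_nil : M.artinProd [] = 1 := rfl

theorem artinProd_cons (i : B) (ω : List B) :
    M.artinProd (i :: ω) = PresentedMonoid.of M.BraidRel i * M.artinProd ω := by
  simp [artinProd]

theorem artinProd_append (ω ω' : List B) :
    M.artinProd (ω ++ ω') = M.artinProd ω * M.artinProd ω' := by
  simp [artinProd]

theorem mk_ofList (ω : List B) :
    PresentedMonoid.mk M.BraidRel (FreeMonoid.ofList ω) = M.artinProd ω := by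
  induction ω with
  | nil => rfl
  | cons i ω ih => rw [artinProd_cons, ← ih]; rfl

theorem artinProd_surjective (b : M.ArtinMonoid) : ∃ ω, M.artinProd ω = b := by
  obtain ⟨a, rfl⟩ := PresentedMonoid.surjective_mk b
  exact ⟨FreeMonoid.toList a, (M.mk_ofList _).symm⟩

theorem artinProd_braidWord (i j : B) :
    M.artinProd (CoxeterSystem.braidWord M i j) = M.artinProd (CoxeterSystem.braidWord M j i) := by
  rw [← mk_ofList, ← mk_ofList]
  exact PresentedMonoid.mk_eq_mk_of_rel ⟨i, j, rfl, rfl⟩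

/-- The universal property of the positive Artin monoid, in terms of words. -/
def artinLift {G : Type*} [Monoid G] (f : B → G)
    (h : ∀ i j, ((CoxeterSystem.braidWord M i j).map f).prod =
      ((CoxeterSystem.braidWord M j i).map f).prod) : M.ArtinMonoid →* G :=
  PresentedMonoid.lift f <| by
    rintro _ _ ⟨i, j, rfl, rfl⟩
    simpa [FreeMonoid.lift_apply] using h i j

theorem artinLift_artinProd {G : Type*} [Monoid G] (f : B → G)
    (h : ∀ i j, ((CoxeterSystem.braidWord M i j).map f).prod =
      ((CoxeterSystem.braidWord M j i).map f).prod) (ω : List B) :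
    M.artinLift f h (M.artinProd ω) = (ω.map f).prod := by
  induction ω with
  | nil => simp [artinProd_nil]
  | cons i ω ih =>
    rw [artinProd_cons, map_mul, ih, List.map_cons, List.prod_cons]; rfl

/-- The length of an element of the positive Artin monoid. -/
def artinLength : M.ArtinMonoid →* Multiplicative ℕ :=
  M.artinLift (fun _ => Multiplicative.ofAdd 1) fun i j => by simp [M.symmetric i j]

theorem artinLength_artinProd (ω : List B) :
    M.artinLength (M.artinProd ω) = Multiplicative.ofAdd ω.length := by
  rw [artinLength, artinLift_artinProd]
  simp [← ofAdd_nsmul]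

theorem length_eq_of_artinProd_eq {ω ω' : List B} (h : M.artinProd ω = M.artinProd ω') :
    ω.length = ω'.length := by
  have := congrArg M.artinLength h
  simpa [artinLength_artinProd] using this

end CoxeterMatrix

/-! ### Matsumoto's theorem and the embedding of the Coxeter group. -/

namespace CoxeterSystem

open CoxeterMatrix

section

variable {B : Type*}

theorem reverse_alternatingWord (i j : B) (m : ℕ) : (alternatingWord i j m).reverse =
    if Even m then alternatingWord j i m else alternatingWord i j m := by
  induction m generalizing i j with
  | zero => simp [alternatingWord]
  | succ m ih =>
    rw [alternatingWord_succ, List.concat_eq_append, List.reverse_append, ih]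
    simp only [Nat.even_add_one, List.reverse_singleton, List.singleton_append]
    by_cases h : Even m
    · have := alternatingWord_succ' i j m
      rw [alternatingWord_succ, if_pos h] at this
      simpa [h] using this.symm
    · simp [h, alternatingWord_succ' j i m]

end

variable {B : Type*} {M : CoxeterMatrix B} {W : Type*} [Group W] (cs : CoxeterSystem M W)

theorem wordProd_braidWord_inv (i j : B) :
    (cs.wordProd (braidWord M i j))⁻¹ = cs.wordProd (braidWord M i j) := by
  rw [← wordProd_reverse, braidWord, reverse_alternatingWord]
  split_ifs
  · have := cs.wordProd_braidWord_eq j i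
    unfold braidWord at this
    rwa [M.symmetric j i] at this
  · rfl

theorem isReduced_braidWord {i j : B} (h : i ≠ j) : cs.IsReduced (braidWord M i j) := by
  have := cs.length_alternatingWord_mul (v := 1) h (cs.not_isLeftDescent_one i)
    (cs.not_isLeftDescent_one j) (k := M i j) (by simp)
  rw [IsReduced, length_alternatingWord]
  simpa using this

theorem length_mul_braidWord {v : W} {i j : B} (h : i ≠ j) (hi : ¬ cs.IsRightDescent v i)
    (hj : ¬ cs.IsRightDescent v j) :
    cs.length (v * cs.wordProd (braidWord M i j)) = cs.length v + M i j := by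
  rw [← isLeftDescent_inv_iff] at hi hj
  have := cs.length_alternatingWord_mul h hi hj (k := M i j) (by simp)
  rw [← wordProd_braidWord_inv, ← mul_inv_rev, length_inv, length_inv] at this
  omega

theorem isReduced_cons {i : B} {ω : List B} : cs.IsReduced (i :: ω) ↔
    cs.IsReduced ω ∧ ¬ cs.IsLeftDescent (cs.wordProd ω) i := by
  rw [not_isLeftDescent_iff, IsReduced, IsReduced, wordProd_cons, List.length_cons]
  have h1 := cs.length_simple_mul (cs.wordProd ω) i
  have h2 := cs.length_wordProd_le ω
  omega

/-- Matsumoto's theorem: reduced words for the same element are related by braid moves. -/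
theorem artinProd_eq_of_isReduced {ω ω' : List B} (h : cs.IsReduced ω) (h' : cs.IsReduced ω')
    (he : cs.wordProd ω = cs.wordProd ω') : M.artinProd ω = M.artinProd ω' := by
  induction hn : ω.length generalizing ω ω' with
  | zero =>
    have hl : ω'.length = 0 := by rw [← h'.eq, ← he, h.eq, hn]
    rw [List.length_eq_zero_iff] at hn hl
    rw [hn, hl]
  | succ n ih =>
    have hl : ω'.length = n + 1 := by rw [← h'.eq, ← he, h.eq, hn]
    have key : ∀ (i : B) (ω₁ ω₂ : List B), ω₁.length = n → cs.IsReduced (i :: ω₁) →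
        cs.IsReduced (i :: ω₂) → cs.wordProd (i :: ω₁) = cs.wordProd (i :: ω₂) →
        M.artinProd (i :: ω₁) = M.artinProd (i :: ω₂) := by
      intro i ω₁ ω₂ hn h₁ h₂ he
      rw [wordProd_cons, wordProd_cons] at he
      rw [artinProd_cons, artinProd_cons,
        ih (cs.isReduced_cons.1 h₁).1 (cs.isReduced_cons.1 h₂).1 (mul_left_cancel he) hn]
    obtain _ | ⟨i, ω⟩ := ω
    · simp at hn
    obtain _ | ⟨j, ω'⟩ := ω'
    · simp at hl
    by_cases hij : i = j
    · subst hij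
      exact key i ω ω' (by simpa using hn) h h' he
    have hi : cs.IsLeftDescent (cs.wordProd (i :: ω)) i := by
      rw [isLeftDescent_iff_not_isLeftDescent_mul, wordProd_cons, simple_mul_simple_cancel_left]
      exact (cs.isReduced_cons.1 h).2
    have hj : cs.IsLeftDescent (cs.wordProd (i :: ω)) j := by
      rw [he, isLeftDescent_iff_not_isLeftDescent_mul, wordProd_cons, simple_mul_simple_cancel_left]
      exact (cs.isReduced_cons.1 h').2
    -- Both first letters are left descents, so the full braid element of `i` and `j` is a prefix.
    -- Its two words link the given words, and induction applies behind each common first letter.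
    obtain ⟨v, hv, hlv, hM⟩ := cs.exists_eq_braidWord_mul hij hi hj
    obtain ⟨τ, hτ, rfl⟩ := cs.exists_isReduced v
    obtain ⟨m, hm⟩ := Nat.exists_eq_succ_of_ne_zero hM
    -- words for `w` that begin with a given one of the two descents
    have hred : ∀ a b : B, M a b = M i j → cs.wordProd (braidWord M a b) = cs.wordProd (braidWord M i j) →
        cs.IsReduced (braidWord M a b ++ τ) := by
      intro a b hab hw
      rw [IsReduced, wordProd_append, hw, ← hv, hlv, List.length_append, length_alternatingWord, hab,
        hτ.eq]
    have h1 := hred i j rfl rfl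
    have h2 := hred j i (M.symmetric j i) (cs.wordProd_braidWord_eq j i)
    have hb : M.artinProd (braidWord M i j ++ τ) = M.artinProd (braidWord M j i ++ τ) := by
      rw [artinProd_append, artinProd_append, M.artinProd_braidWord]
    have e1 : cs.wordProd (braidWord M i j ++ τ) = cs.wordProd (i :: ω) := by
      rw [wordProd_append, hv]
    have e2 : cs.wordProd (braidWord M j i ++ τ) = cs.wordProd (i :: ω) := by
      rw [wordProd_append, hv, cs.wordProd_braidWord_eq]
    have s1 : braidWord M i j = (if Even m then j else i) :: alternatingWord i j m := by
      rw [braidWord, hm, Nat.succ_eq_add_one, alternatingWord_succ']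
    have s2 : braidWord M j i = (if Even m then i else j) :: alternatingWord j i m := by
      rw [braidWord, M.symmetric j i, hm, Nat.succ_eq_add_one, alternatingWord_succ']
    have l1 : (alternatingWord i j m ++ τ).length = n := by
      have := h1.eq
      rw [e1, h.eq, hn, s1] at this; simp at this ⊢; omega
    have l2 : (alternatingWord j i m ++ τ).length = n := by
      have := h2.eq
      rw [e2, h.eq, hn, s2] at this; simp at this ⊢; omega
    rw [s1, s2] at hb
    rw [s1] at h1 e1
    rw [s2] at h2 e2
    split_ifs at hb h1 h2 e1 e2
    · rw [← key i _ _ l2 h2 h e2, ← key j _ _ l1 h1 h' (e1.trans he)]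
      exact hb.symm
    · rw [← key i _ _ l1 h1 h e1, ← key j _ _ l2 h2 h' (e2.trans he)]
      exact hb

theorem toArtin_wordProd {ω : List B} (h : cs.IsReduced ω) :
    cs.toArtin (cs.wordProd ω) = M.artinProd ω := by
  obtain ⟨h1, h2⟩ := Classical.choose_spec (cs.exists_isReduced (cs.wordProd ω))
  exact cs.artinProd_eq_of_isReduced h1 h h2.symm

theorem toArtin_mul {u v : W} (h : cs.length (u * v) = cs.length u + cs.length v) :
    cs.toArtin (u * v) = cs.toArtin u * cs.toArtin v := by
  obtain ⟨ω, h1, rfl⟩ := cs.exists_isReduced u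
  obtain ⟨ω', h2, rfl⟩ := cs.exists_isReduced v
  rw [← wordProd_append] at h ⊢
  rw [toArtin_wordProd, artinProd_append, cs.toArtin_wordProd h1, cs.toArtin_wordProd h2]
  rw [IsReduced, h, h1.eq, h2.eq, List.length_append]

theorem toArtin_one : cs.toArtin 1 = 1 := by
  rw [← cs.wordProd_nil, toArtin_wordProd _ (by simp [IsReduced]), artinProd_nil]

theorem toArtin_simple (i : B) : cs.toArtin (cs.simple i) = PresentedMonoid.of M.BraidRel i := by
  rw [← cs.wordProd_singleton, toArtin_wordProd _ (by simp [IsReduced]), artinProd_cons,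
    artinProd_nil, mul_one]

theorem toArtin_simple_mul {w : W} {i : B} (h : ¬ cs.IsLeftDescent w i) :
    cs.toArtin (cs.simple i * w) = PresentedMonoid.of M.BraidRel i * cs.toArtin w := by
  rw [not_isLeftDescent_iff] at h
  rw [toArtin_mul, toArtin_simple]
  rw [h, length_simple, add_comm]

/-- The projection of the positive Artin monoid to the Coxeter group. -/
def artinProj : M.ArtinMonoid →* W :=
  M.artinLift cs.simple fun i j => cs.wordProd_braidWord_eq i j

theorem artinProj_artinProd (ω : List B) : cs.artinProj (M.artinProd ω) = cs.wordProd ω :=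
  M.artinLift_artinProd _ _ _

theorem artinProj_toArtin (w : W) : cs.artinProj (cs.toArtin w) = w := by
  obtain ⟨ω, h1, rfl⟩ := cs.exists_isReduced w
  rw [cs.toArtin_wordProd h1, artinProj_artinProd]

theorem artinLength_toArtin (w : W) :
    M.artinLength (cs.toArtin w) = Multiplicative.ofAdd (cs.length w) := by
  obtain ⟨ω, h1, rfl⟩ := cs.exists_isReduced w
  rw [cs.toArtin_wordProd h1, artinLength_artinProd, h1.eq]

theorem toArtin_injective {u v : W} (h : cs.toArtin u = cs.toArtin v) : u = v := by
  rw [← cs.artinProj_toArtin u, h, artinProj_toArtin]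

theorem artinWords_toArtin (w : W) : artinWords M (cs.toArtin w) = cs.reducedWords w := by
  ext ω
  constructor
  · intro (h : M.artinProd ω = _)
    have h1 : cs.wordProd ω = w := by rw [← artinProj_artinProd, h, artinProj_toArtin]
    refine ⟨?_, h1⟩
    have := congrArg M.artinLength h
    rw [artinLength_artinProd, artinLength_toArtin] at this
    rw [IsReduced, h1]
    exact (Multiplicative.ofAdd.injective this).symm
  · rintro ⟨h1, rfl⟩
    exact (cs.toArtin_wordProd h1).symm

end CoxeterSystem

/-! ### Weak order, longest prefixes and the action that computes Garside factors. -/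

namespace CoxeterSystem

open CoxeterMatrix

variable {B : Type*} {M : CoxeterMatrix B} {W : Type*} [Group W] (cs : CoxeterSystem M W)

/-- The (right) weak order: `u` is a prefix of `v`. -/
def IsPrefix (u v : W) : Prop := cs.length v = cs.length u + cs.length (u⁻¹ * v)

theorem isPrefix_mul {u v : W} (h : cs.length (u * v) = cs.length u + cs.length v) :
    cs.IsPrefix u (u * v) := by
  rw [IsPrefix, inv_mul_cancel_left, h]

theorem length_inv_mul_le (u v w : W) :
    cs.length (u⁻¹ * w) ≤ cs.length (u⁻¹ * v) + cs.length (v⁻¹ * w) := by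
  have := cs.length_mul_le (u⁻¹ * v) (v⁻¹ * w)
  rwa [mul_assoc, mul_inv_cancel_left] at this

theorem length_le_add_length_inv_mul (u v : W) :
    cs.length v ≤ cs.length u + cs.length (u⁻¹ * v) := by
  have := cs.length_mul_le u (u⁻¹ * v)
  rwa [mul_inv_cancel_left] at this

theorem one_isPrefix (v : W) : cs.IsPrefix 1 v := by simp [IsPrefix]

theorem isPrefix_refl (v : W) : cs.IsPrefix v v := by simp [IsPrefix]

variable {cs}

theorem IsPrefix.trans {u v w : W} (h : cs.IsPrefix u v) (h' : cs.IsPrefix v w) :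
    cs.IsPrefix u w := by
  have h1 := cs.length_inv_mul_le u v w
  have h2 := cs.length_le_add_length_inv_mul u w
  unfold IsPrefix at *; omega

/-- If `u ≤ v ≤ w`, the lengths in `u⁻¹ w = (u⁻¹ v) (v⁻¹ w)` add up. -/
theorem IsPrefix.length_inv_mul {u v w : W} (h : cs.IsPrefix u v) (h' : cs.IsPrefix v w) :
    cs.length (u⁻¹ * w) = cs.length (u⁻¹ * v) + cs.length (v⁻¹ * w) := by
  have h1 := h.trans h'
  unfold IsPrefix at *; omega

theorem IsPrefix.length_le {u v : W} (h : cs.IsPrefix u v) : cs.length u ≤ cs.length v := by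
  unfold IsPrefix at *; omega

theorem IsPrefix.eq_of_length_le {u v : W} (h : cs.IsPrefix u v)
    (hl : cs.length v ≤ cs.length u) : u = v := by
  have : cs.length (u⁻¹ * v) = 0 := by unfold IsPrefix at *; omega
  rw [length_eq_zero_iff, inv_mul_eq_one] at this
  exact this

theorem IsPrefix.antisymm {u v : W} (h : cs.IsPrefix u v) (h' : cs.IsPrefix v u) : u = v :=
  h.eq_of_length_le h'.length_le

theorem IsPrefix.toArtin {u v : W} (h : cs.IsPrefix u v) :
    cs.toArtin v = cs.toArtin u * cs.toArtin (u⁻¹ * v) := by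
  rw [← toArtin_mul, mul_inv_cancel_left]
  rwa [mul_inv_cancel_left]

/-- `u v` is reduced whenever `u w` is reduced and `v` is a prefix of `w`. -/
theorem IsPrefix.length_mul {u v w : W} (h : cs.IsPrefix v w)
    (hw : cs.length (u * w) = cs.length u + cs.length w) :
    cs.length (u * v) = cs.length u + cs.length v := by
  have h1 := cs.length_mul_le u v
  have h2 := cs.length_mul_le (u * v) (v⁻¹ * w)
  rw [mul_assoc, mul_inv_cancel_left] at h2
  unfold IsPrefix at h; omega

theorem IsPrefix.mul_left {u v w : W} (h : cs.IsPrefix v w)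
    (hw : cs.length (u * w) = cs.length u + cs.length w) : cs.IsPrefix (u * v) (u * w) := by
  have h1 := h.length_mul hw
  unfold IsPrefix at *
  rw [mul_inv_rev, mul_assoc, inv_mul_cancel_left]; omega

theorem IsPrefix.of_mul_left {u v w : W} (h : cs.IsPrefix (u * v) (u * w))
    (hv : cs.length (u * v) = cs.length u + cs.length v)
    (hw : cs.length (u * w) = cs.length u + cs.length w) : cs.IsPrefix v w := by
  unfold IsPrefix at *
  rw [mul_inv_rev, mul_assoc, inv_mul_cancel_left] at h; omega

variable (cs)

theorem isPrefix_simple_iff {w : W} {i : B} :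
    cs.IsPrefix (cs.simple i) w ↔ cs.IsLeftDescent w i := by
  rw [IsPrefix, inv_simple, length_simple, isLeftDescent_iff]; omega

theorem isPrefix_mul_simple {w : W} {i : B} (h : ¬ cs.IsRightDescent w i) :
    cs.IsPrefix w (w * cs.simple i) := by
  apply isPrefix_mul
  rw [not_isRightDescent_iff] at h
  rw [h, length_simple]

theorem mul_simple_isPrefix {w : W} {i : B} (h : cs.IsRightDescent w i) :
    cs.IsPrefix (w * cs.simple i) w := by
  rw [isRightDescent_iff] at h
  rw [IsPrefix, mul_inv_rev, inv_simple, inv_mul_cancel_right, length_simple, h]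

theorem exists_mul_simple_isPrefix {u v : W} (h : cs.IsPrefix u v) (hne : u ≠ v) :
    ∃ i, ¬ cs.IsRightDescent u i ∧ cs.IsPrefix (u * cs.simple i) v := by
  have hne' : u⁻¹ * v ≠ 1 := by rwa [Ne, inv_mul_eq_one]
  obtain ⟨i, hi⟩ := cs.exists_leftDescent_of_ne_one hne'
  have hp : cs.IsPrefix (cs.simple i) (u⁻¹ * v) := cs.isPrefix_simple_iff.2 hi
  have hv : cs.length (u * (u⁻¹ * v)) = cs.length u + cs.length (u⁻¹ * v) := by
    rw [mul_inv_cancel_left]; exact h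
  refine ⟨i, ?_, ?_⟩
  · rw [not_isRightDescent_iff, hp.length_mul hv, length_simple]
  · simpa using hp.mul_left hv

theorem isLeftDescent_braidWord {i j : B} (h : i ≠ j) (hM : M i j ≠ 0) :
    cs.IsLeftDescent (cs.wordProd (braidWord M i j)) i ∧
      cs.IsLeftDescent (cs.wordProd (braidWord M i j)) j := by
  obtain ⟨m, hm⟩ := Nat.exists_eq_succ_of_ne_zero hM
  have key : ∀ a b : B, M a b = m + 1 → a ≠ b →
      cs.IsLeftDescent (cs.wordProd (braidWord M a b)) (if Even m then b else a) := by
    intro a b hab hne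
    have hr := cs.isReduced_braidWord hne
    unfold braidWord at hr ⊢
    rw [hab, alternatingWord_succ'] at hr ⊢
    rw [isLeftDescent_iff_not_isLeftDescent_mul, wordProd_cons, simple_mul_simple_cancel_left]
    exact (cs.isReduced_cons.1 hr).2
  have h1 := key i j hm h
  have h2 := key j i (by rw [M.symmetric, hm]) h.symm
  rw [cs.wordProd_braidWord_eq] at h2
  split_ifs at h1 h2
  exacts [⟨h2, h1⟩, ⟨h1, h2⟩]

/-- A diamond argument: if two maximal elements lie above `v` via different letters `i` and `j`, a
maximal element above `v` times the braid element of `i` and `j` lies above both `v s_i` and `v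
s_j`. Downward induction on the length of `v` identifies all three. -/
theorem exists_max_of_braid_closed (P : W → Prop) (N : ℕ) (h1 : P 1)
    (hN : ∀ v, P v → cs.length v ≤ N) (hpre : ∀ u v, cs.IsPrefix u v → P v → P u)
    (hbraid : ∀ v i j, i ≠ j → ¬ cs.IsRightDescent v i → ¬ cs.IsRightDescent v j →
      P (v * cs.simple i) →
      P (v * cs.simple j) → M i j ≠ 0 ∧ P (v * cs.wordProd (braidWord M i j))) :
    ∃ m, P m ∧ ∀ v, P v → cs.IsPrefix v m := by
  have hmax : ∀ n v, P v → N - cs.length v = n →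
      ∃ m, P m ∧ cs.IsPrefix v m ∧ ∀ i, P (m * cs.simple i) → cs.IsRightDescent m i := by
    intro n
    induction n using Nat.strong_induction_on with
    | _ n ih =>
      intro v hv hn
      by_cases h : ∀ i, P (v * cs.simple i) → cs.IsRightDescent v i
      · exact ⟨v, hv, cs.isPrefix_refl v, h⟩
      · push Not at h
        obtain ⟨i, hi, hd⟩ := h
        have h2 := hN _ hi
        have h3 := cs.isPrefix_mul_simple hd
        rw [not_isRightDescent_iff] at hd
        obtain ⟨m, hm, hp, hm'⟩ := ih _ (by omega) _ hi rfl
        exact ⟨m, hm, h3.trans hp, hm'⟩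
  have huniq : ∀ n v m m', N - cs.length v = n → P m → P m' → cs.IsPrefix v m →
      cs.IsPrefix v m' → (∀ i, P (m * cs.simple i) → cs.IsRightDescent m i) →
      (∀ i, P (m' * cs.simple i) → cs.IsRightDescent m' i) → m = m' := by
    intro n
    induction n using Nat.strong_induction_on with
    | _ n ih =>
      intro v m m' hn hm hm' hv hv' hmm hmm'
      by_cases e : v = m
      · by_contra hne
        subst e
        obtain ⟨i, hi, hp⟩ := cs.exists_mul_simple_isPrefix hv' hne
        exact hi (hmm i (hpre _ _ hp hm'))
      by_cases e' : v = m'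
      · subst e'
        obtain ⟨i, hi, hp⟩ := cs.exists_mul_simple_isPrefix hv e
        exact absurd (hmm' i (hpre _ _ hp hm)) hi
      obtain ⟨i, hi, hp⟩ := cs.exists_mul_simple_isPrefix hv e
      obtain ⟨j, hj, hp'⟩ := cs.exists_mul_simple_isPrefix hv' e'
      have hPi := hpre _ _ hp hm
      have hPj := hpre _ _ hp' hm'
      have hli := cs.not_isRightDescent_iff.1 hi
      have hlj := cs.not_isRightDescent_iff.1 hj
      have hNi := hN _ hPi
      have hNj := hN _ hPj
      by_cases hij : i = j
      · subst hij
        exact ih _ (by omega) _ m m' rfl hm hm' hp hp' hmm hmm'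
      have hl := cs.length_mul_braidWord hij hi hj
      obtain ⟨hM, hPb⟩ := hbraid v i j hij hi hj hPi hPj
      obtain ⟨x, hx, hpx, hxx⟩ := hmax _ _ hPb rfl
      have hred : cs.length (v * cs.wordProd (braidWord M i j)) =
          cs.length v + cs.length (cs.wordProd (braidWord M i j)) := by
        rw [hl, (cs.isReduced_braidWord hij).eq, length_alternatingWord]
      have hpi : cs.IsPrefix (v * cs.simple i) x :=
        ((cs.isPrefix_simple_iff.2 (cs.isLeftDescent_braidWord hij hM).1).mul_left hred).trans hpx
      have hpj : cs.IsPrefix (v * cs.simple j) x :=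
        ((cs.isPrefix_simple_iff.2 (cs.isLeftDescent_braidWord hij hM).2).mul_left hred).trans hpx
      rw [ih _ (by omega) _ m x rfl hm hx hp hpi hmm hxx]
      exact (ih _ (by omega) _ m' x rfl hm' hx hp' hpj hmm' hxx).symm
  obtain ⟨m, hm, -, hmm⟩ := hmax _ 1 h1 rfl
  refine ⟨m, hm, fun v hv => ?_⟩
  obtain ⟨m', hm', hv', hmm'⟩ := hmax _ v hv rfl
  rwa [huniq _ 1 m m' rfl hm hm' (cs.one_isPrefix m) (cs.one_isPrefix m') hmm hmm']

theorem isPrefix_mul_braidWord {v w : W} {i j : B} (h : i ≠ j) (hi : ¬ cs.IsRightDescent v i)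
    (hj : ¬ cs.IsRightDescent v j) (hpi : cs.IsPrefix (v * cs.simple i) w)
    (hpj : cs.IsPrefix (v * cs.simple j) w) :
    M i j ≠ 0 ∧ cs.IsPrefix (v * cs.wordProd (braidWord M i j)) w := by
  have hv : cs.IsPrefix v w := (cs.isPrefix_mul_simple hi).trans hpi
  have hd : ∀ k, ¬ cs.IsRightDescent v k → cs.IsPrefix (v * cs.simple k) w →
      cs.IsLeftDescent (v⁻¹ * w) k := by
    intro k hk hp
    rw [← isPrefix_simple_iff]
    refine IsPrefix.of_mul_left (u := v) ?_ ?_ ?_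
    · rwa [mul_inv_cancel_left]
    · rw [cs.not_isRightDescent_iff.1 hk, length_simple]
    · rw [mul_inv_cancel_left]; exact hv
  obtain ⟨x, hx, hlx, hM⟩ := cs.exists_eq_braidWord_mul h (hd i hi hpi) (hd j hj hpj)
  refine ⟨hM, ?_⟩
  have hp : cs.IsPrefix (cs.wordProd (braidWord M i j)) (v⁻¹ * w) := by
    rw [hx]; apply isPrefix_mul
    rw [← hx, hlx, (cs.isReduced_braidWord h).eq, length_alternatingWord]
  have := hp.mul_left (u := v) (by rw [mul_inv_cancel_left]; exact hv)
  rwa [mul_inv_cancel_left] at this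

theorem exists_max_prefix (u w : W) : ∃ x,
    (cs.IsPrefix x w ∧ cs.length (u * x) = cs.length u + cs.length x) ∧
    ∀ v, cs.IsPrefix v w ∧ cs.length (u * v) = cs.length u + cs.length v → cs.IsPrefix v x := by
  apply cs.exists_max_of_braid_closed _ (cs.length w)
  · exact ⟨cs.one_isPrefix w, by simp⟩
  · exact fun v hv => hv.1.length_le
  · exact fun v x h hx => ⟨h.trans hx.1, h.length_mul hx.2⟩
  · intro v i j hij hi hj hPi hPj
    obtain ⟨hM, hp⟩ := cs.isPrefix_mul_braidWord hij hi hj hPi.1 hPj.1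
    refine ⟨hM, hp, ?_⟩
    have hv := (cs.isPrefix_mul_simple hi).length_mul hPi.2
    have hd : ∀ k, ¬ cs.IsRightDescent v k →
        cs.length (u * (v * cs.simple k)) = cs.length u + cs.length (v * cs.simple k) →
        ¬ cs.IsRightDescent (u * v) k := by
      intro k hk hl
      rw [not_isRightDescent_iff] at hk ⊢
      rw [mul_assoc, hl, hk, hv, add_assoc]
    rw [← mul_assoc, cs.length_mul_braidWord hij (hd i hi hPi.2) (hd j hj hPj.2), hv,
      cs.length_mul_braidWord hij hi hj, add_assoc]

/-- The longest prefix `x` of `w` for which the product `u x` is reduced. -/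
def maxPrefix (u w : W) : W := Classical.choose (cs.exists_max_prefix u w)

theorem maxPrefix_isPrefix (u w : W) : cs.IsPrefix (cs.maxPrefix u w) w :=
  (Classical.choose_spec (cs.exists_max_prefix u w)).1.1

theorem length_mul_maxPrefix (u w : W) :
    cs.length (u * cs.maxPrefix u w) = cs.length u + cs.length (cs.maxPrefix u w) :=
  (Classical.choose_spec (cs.exists_max_prefix u w)).1.2

theorem isPrefix_maxPrefix {u w v : W} (h : cs.IsPrefix v w)
    (hl : cs.length (u * v) = cs.length u + cs.length v) : cs.IsPrefix v (cs.maxPrefix u w) :=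
  (Classical.choose_spec (cs.exists_max_prefix u w)).2 v ⟨h, hl⟩

theorem maxPrefix_one (w : W) : cs.maxPrefix 1 w = w :=
  (cs.maxPrefix_isPrefix 1 w).antisymm (cs.isPrefix_maxPrefix (cs.isPrefix_refl w) (by simp))

/-- Absorbing letters into `u v` gives the same result as absorbing them first into `v` and then
into `u`. This is what makes `normalAct` respect reduced products, hence braid relations. -/
theorem maxPrefix_mul {u v w : W} (h : cs.length (u * v) = cs.length u + cs.length v) :
    cs.maxPrefix u (v * cs.maxPrefix v w) = v * cs.maxPrefix (u * v) w := by
  have hx := cs.maxPrefix_isPrefix (u * v) w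
  have hxl := cs.length_mul_maxPrefix (u * v) w
  set x := cs.maxPrefix (u * v) w
  have hvx : cs.length (v * x) = cs.length v + cs.length x := by
    have h1 := cs.length_mul_le v x
    have h2 := cs.length_mul_le u (v * x)
    rw [← mul_assoc] at h2; omega
  have huvx : cs.length (u * (v * x)) = cs.length u + cs.length (v * x) := by
    rw [← mul_assoc]; omega
  have hle : cs.IsPrefix (v * x) (cs.maxPrefix u (v * cs.maxPrefix v w)) :=
    cs.isPrefix_maxPrefix ((cs.isPrefix_maxPrefix hx hvx).mul_left (cs.length_mul_maxPrefix v w)) huvx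
  refine (hle.antisymm ?_).symm
  have hy := cs.maxPrefix_isPrefix u (v * cs.maxPrefix v w)
  have hyl := cs.length_mul_maxPrefix u (v * cs.maxPrefix v w)
  set y := cs.maxPrefix u (v * cs.maxPrefix v w)
  have hvy : cs.IsPrefix v y := (cs.isPrefix_mul hvx).trans hle
  clear_value y
  obtain ⟨z, rfl⟩ : ∃ z, y = v * z := ⟨v⁻¹ * y, by rw [mul_inv_cancel_left]⟩
  have hvz : cs.length (v * z) = cs.length v + cs.length z := by
    simpa [IsPrefix] using hvy
  have hz := hy.of_mul_left hvz (cs.length_mul_maxPrefix v w)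
  refine IsPrefix.mul_left ?_ hvx
  refine cs.isPrefix_maxPrefix (hz.trans (cs.maxPrefix_isPrefix v w)) ?_
  rw [mul_assoc]; omega

/-- The action of `W` by which the positive Artin monoid acts on pairs consisting of a simple
element and a remainder. -/
def normalAct (u : W) (p : W × M.ArtinMonoid) : W × M.ArtinMonoid :=
  (u * cs.maxPrefix u p.1, cs.toArtin ((cs.maxPrefix u p.1)⁻¹ * p.1) * p.2)

theorem normalAct_one (p : W × M.ArtinMonoid) : cs.normalAct 1 p = p := by
  simp [normalAct, maxPrefix_one, toArtin_one]

theorem normalAct_mul {u v : W} (h : cs.length (u * v) = cs.length u + cs.length v)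
    (p : W × M.ArtinMonoid) : cs.normalAct u (cs.normalAct v p) = cs.normalAct (u * v) p := by
  have hv := cs.maxPrefix_isPrefix v p.1
  have e := cs.maxPrefix_mul (w := p.1) h
  simp only [normalAct, e, mul_assoc u v, Prod.mk.injEq, true_and]
  rw [← mul_assoc, ← toArtin_mul]
  · congr 2; group
  · have h1 := cs.maxPrefix_isPrefix (u * v) p.1
    have h2 := cs.length_mul_maxPrefix (u * v) p.1
    have h3 : cs.IsPrefix (cs.maxPrefix (u * v) p.1) (cs.maxPrefix v p.1) := by
      refine cs.isPrefix_maxPrefix h1 ?_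
      have h1 := cs.length_mul_le v (cs.maxPrefix (u * v) p.1)
      have h2 := cs.length_mul_le u (v * cs.maxPrefix (u * v) p.1)
      rw [← mul_assoc] at h2; omega
    have := h3.length_inv_mul hv
    convert this using 2 <;> group

/-- `normalAct`, as an endomorphism. -/
def normalEnd (u : W) : Function.End (W × M.ArtinMonoid) := cs.normalAct u

theorem normalEnd_smul (u : W) (p : W × M.ArtinMonoid) :
    cs.normalEnd u • p = cs.normalAct u p := rfl

theorem functionEnd_ext {X : Type*} {f g : Function.End X} (h : ∀ p : X, f • p = g • p) : f = g :=
  funext h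

theorem normalEnd_wordProd {ω : List B} (h : cs.IsReduced ω) :
    (ω.map fun i => cs.normalEnd (cs.simple i)).prod = cs.normalEnd (cs.wordProd ω) := by
  induction ω with
  | nil =>
    refine functionEnd_ext fun p => ?_
    rw [wordProd_nil, normalEnd_smul, normalAct_one, List.map_nil, List.prod_nil, one_smul]
  | cons i ω ih =>
    have h' := cs.isReduced_cons.1 h
    rw [List.map_cons, List.prod_cons, ih h'.1, wordProd_cons]
    refine functionEnd_ext fun p => ?_
    rw [mul_smul]
    refine cs.normalAct_mul ?_ p
    rw [cs.not_isLeftDescent_iff.1 h'.2, length_simple, add_comm]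

/-- The action of the positive Artin monoid on pairs consisting of a simple element and a
remainder. -/
def artinAct : M.ArtinMonoid →* Function.End (W × M.ArtinMonoid) :=
  M.artinLift (fun i => cs.normalEnd (cs.simple i)) fun i j => by
    by_cases h : i = j
    · rw [h]
    · rw [cs.normalEnd_wordProd (cs.isReduced_braidWord h),
        cs.normalEnd_wordProd (cs.isReduced_braidWord (Ne.symm h)), wordProd_braidWord_eq]

theorem artinAct_toArtin (u : W) : cs.artinAct (cs.toArtin u) = cs.normalEnd u := by
  obtain ⟨ω, h1, rfl⟩ := cs.exists_isReduced u
  rw [cs.toArtin_wordProd h1, artinAct, artinLift_artinProd, cs.normalEnd_wordProd h1]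

theorem normalAct_eval (u : W) (p : W × M.ArtinMonoid) :
    cs.toArtin (cs.normalAct u p).1 * (cs.normalAct u p).2 =
      cs.toArtin u * (cs.toArtin p.1 * p.2) := by
  rw [normalAct, cs.toArtin_mul (cs.length_mul_maxPrefix u p.1),
    (cs.maxPrefix_isPrefix u p.1).toArtin]
  simp only [mul_assoc]

theorem artin_induction {P : M.ArtinMonoid → Prop} (b : M.ArtinMonoid) (one : P 1)
    (mul : ∀ i b, P b → P (PresentedMonoid.of M.BraidRel i * b)) : P b := by
  obtain ⟨ω, rfl⟩ := M.artinProd_surjective b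
  induction ω with
  | nil => exact one
  | cons i ω ih => rw [artinProd_cons]; exact mul i _ ih

theorem artinAct_of_mul (i : B) (b : M.ArtinMonoid) (p : W × M.ArtinMonoid) :
    cs.artinAct (PresentedMonoid.of M.BraidRel i * b) • p =
      cs.normalAct (cs.simple i) (cs.artinAct b • p) := by
  rw [map_mul, ← cs.toArtin_simple i, artinAct_toArtin, mul_smul, normalEnd_smul]

theorem artinAct_toArtin_mul (u : W) (b : M.ArtinMonoid) (p : W × M.ArtinMonoid) :
    cs.artinAct (cs.toArtin u * b) • p = cs.normalAct u (cs.artinAct b • p) := by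
  rw [map_mul, artinAct_toArtin, mul_smul, normalEnd_smul]

/-- The first Garside factor: the greatest simple left divisor. -/
def head (b : M.ArtinMonoid) : W := (cs.artinAct b • ((1, 1) : W × M.ArtinMonoid)).1

/-- What remains after removing the first Garside factor. -/
def rest (b : M.ArtinMonoid) : M.ArtinMonoid := (cs.artinAct b • ((1, 1) : W × M.ArtinMonoid)).2

theorem toArtin_head_mul_rest (b : M.ArtinMonoid) : cs.toArtin (cs.head b) * cs.rest b = b := by
  unfold head rest
  induction b using artin_induction with
  | one => rw [map_one, one_smul, toArtin_one, one_mul]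
  | mul i b ih => rw [artinAct_of_mul, normalAct_eval, ih, toArtin_simple]

theorem head_toArtin_mul (u : W) (b : M.ArtinMonoid) :
    cs.head (cs.toArtin u * b) = u * cs.maxPrefix u (cs.head b) := by
  rw [head, artinAct_toArtin_mul]; rfl

theorem rest_toArtin_mul (u : W) (b : M.ArtinMonoid) : cs.rest (cs.toArtin u * b) =
    cs.toArtin ((cs.maxPrefix u (cs.head b))⁻¹ * cs.head b) * cs.rest b := by
  rw [rest, artinAct_toArtin_mul]; rfl

theorem toArtin_dvd_iff {u : W} {b : M.ArtinMonoid} :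
    cs.toArtin u ∣ b ↔ cs.IsPrefix u (cs.head b) := by
  constructor
  · rintro ⟨x, rfl⟩
    rw [head_toArtin_mul]
    exact cs.isPrefix_mul (cs.length_mul_maxPrefix _ _)
  · intro h
    rw [← cs.toArtin_head_mul_rest b, h.toArtin, mul_assoc]
    exact dvd_mul_right _ _

/-- The action on pairs loses no information: `b` is recovered from `u` and the normal form of the
product. Left cancellation is an immediate consequence. -/
theorem eq_toArtin_mul_rest (u : W) (b : M.ArtinMonoid) :
    b = cs.toArtin (u⁻¹ * cs.head (cs.toArtin u * b)) * cs.rest (cs.toArtin u * b) := by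
  rw [head_toArtin_mul, rest_toArtin_mul, inv_mul_cancel_left, ← mul_assoc,
    ← (cs.maxPrefix_isPrefix u (cs.head b)).toArtin, toArtin_head_mul_rest]

theorem toArtin_mul_left_cancel {u : W} {b b' : M.ArtinMonoid}
    (h : cs.toArtin u * b = cs.toArtin u * b') : b = b' := by
  rw [cs.eq_toArtin_mul_rest u b, h, ← cs.eq_toArtin_mul_rest u b']

theorem of_mul_left_cancel (cs : CoxeterSystem M W) {i : B} {b b' : M.ArtinMonoid}
    (h : PresentedMonoid.of M.BraidRel i * b = PresentedMonoid.of M.BraidRel i * b') : b = b' := by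
  rw [← cs.toArtin_simple] at h
  exact cs.toArtin_mul_left_cancel h

theorem of_dvd_iff {i : B} {b : M.ArtinMonoid} :
    PresentedMonoid.of M.BraidRel i ∣ b ↔ cs.IsLeftDescent (cs.head b) i := by
  rw [← cs.toArtin_simple, toArtin_dvd_iff, isPrefix_simple_iff]

end CoxeterSystem

/-! ### Positive roots, inversions, supports and longest elements. -/

namespace CoxeterSystem

open CoxeterMatrix

variable {B : Type*} {M : CoxeterMatrix B} {W : Type*} [Group W] (cs : CoxeterSystem M W)

theorem sum_smul_root (x : B →₀ ℝ) : (x.sum fun i a => a • root i) = x := by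
  simp [root]

theorem map_nonneg_of_forall_root {N : Type*} [AddCommGroup N] [PartialOrder N]
    [IsOrderedAddMonoid N] [Module ℝ N] [PosSMulMono ℝ N] (f : (B →₀ ℝ) →ₗ[ℝ] N) {x : B →₀ ℝ}
    (hx : 0 ≤ x) (h : ∀ i, x i ≠ 0 → 0 ≤ f (root i)) : 0 ≤ f x := by
  rw [← sum_smul_root x, map_finsuppSum]
  refine Finset.sum_nonneg fun i hi => ?_
  change 0 ≤ f (x i • root i)
  rw [map_smul]
  exact smul_nonneg (hx i) (h i (Finsupp.mem_support_iff.1 hi))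

theorem geom_conj_simple (g : W) (j : B) (x : B →₀ ℝ) :
    cs.geom (g * cs.simple j * g⁻¹) x =
      x - M.form (cs.geom g (root j)) x • cs.geom g (root j) := by
  rw [geom_mul, geom_mul, geom_simple, map_sub, map_smul, geom_geom_inv, ← cs.form_geom g,
    geom_geom_inv]

theorem conj_simple_eq {g h : W} {i j : B}
    (e : cs.geom g (root i) = cs.geom h (root j) ∨ cs.geom g (root i) = -cs.geom h (root j)) :
    g * cs.simple i * g⁻¹ = h * cs.simple j * h⁻¹ := by
  apply cs.geom_injective
  intro s
  rw [geom_conj_simple, geom_conj_simple]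
  rcases e with e | e <;> simp [e]

theorem mul_simple_eq_simple_mul {g : W} {i j : B}
    (e : cs.geom g (root i) = root j ∨ cs.geom g (root i) = -root j) :
    g * cs.simple i = cs.simple j * g := by
  have := cs.conj_simple_eq (g := g) (h := 1) (i := i) (j := j) (by simpa using e)
  simp only [one_mul, inv_one, mul_one] at this
  rw [← this, inv_mul_cancel_right]

/-- The positive roots. -/
def IsPosRoot (τ : B →₀ ℝ) : Prop := (∃ g i, τ = cs.geom g (root i)) ∧ 0 ≤ τ

/-- The positive roots that correspond to the left inversions of `v`. -/
def inversionRoots (v : W) : Set (B →₀ ℝ) := {τ | cs.IsPosRoot τ ∧ cs.geom v⁻¹ τ ≤ 0}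

variable {cs}

theorem IsPosRoot.form_self {τ : B →₀ ℝ} (h : cs.IsPosRoot τ) : M.form τ τ = 2 := by
  obtain ⟨⟨g, i, rfl⟩, -⟩ := h
  exact cs.form_geom_root g i

theorem IsPosRoot.ne_zero {τ : B →₀ ℝ} (h : cs.IsPosRoot τ) : τ ≠ 0 := by
  obtain ⟨⟨g, i, rfl⟩, -⟩ := h
  exact cs.geom_root_ne_zero g i

theorem IsPosRoot.not_nonpos {τ : B →₀ ℝ} (h : cs.IsPosRoot τ) : ¬ τ ≤ 0 := fun h' =>
  h.ne_zero (le_antisymm h' h.2)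

theorem IsPosRoot.geom_or {τ : B →₀ ℝ} (h : cs.IsPosRoot τ) (w : W) :
    cs.IsPosRoot (cs.geom w τ) ∨ cs.geom w τ ≤ 0 := by
  obtain ⟨⟨g, i, rfl⟩, -⟩ := h
  rw [← geom_mul]
  rcases cs.geom_root_nonneg_or_nonpos (w * g) i with h | h
  · exact Or.inl ⟨⟨_, _, rfl⟩, h⟩
  · exact Or.inr h

theorem IsPosRoot.eq_root {τ : B →₀ ℝ} (h : cs.IsPosRoot τ) {s : B}
    (h0 : ∀ i, i ≠ s → τ i = 0) : τ = root s := by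
  have e : τ = τ s • root s := by
    ext i
    by_cases hi : i = s
    · subst hi; simp [root_apply_self]
    · simp [h0 i hi, root_apply_ne (Ne.symm hi)]
  have h1 := h.form_self
  rw [e] at h1
  simp only [map_smul, LinearMap.smul_apply, form_root_self, smul_eq_mul] at h1
  have h2 : 0 ≤ τ s := h.2 s
  have h3 : τ s = 1 := by nlinarith
  rw [e, h3, one_smul]

/-- The reflection changes only the coordinate at `s`, so a positive root with another nonzero
coordinate cannot become negative; a positive root without one is the simple root, by its norm. -/
theorem IsPosRoot.geom_simple {τ : B →₀ ℝ} (h : cs.IsPosRoot τ) {s : B} (hs : τ ≠ root s) :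
    cs.IsPosRoot (cs.geom (cs.simple s) τ) := by
  refine (h.geom_or (cs.simple s)).resolve_right fun hn => hs (h.eq_root fun i hi => ?_)
  have h1 := hn i
  rw [cs.geom_simple_apply_ne (Ne.symm hi)] at h1
  exact le_antisymm h1 (h.2 i)

variable (cs)

theorem isPosRoot_root (s : B) : cs.IsPosRoot (root s) := ⟨⟨1, s, by simp⟩, root_nonneg s⟩

theorem root_mem_inversionRoots {v : W} {s : B} :
    root s ∈ cs.inversionRoots v ↔ cs.IsLeftDescent v s := by
  rw [isLeftDescent_iff_geom]
  exact ⟨fun h => h.2, fun h => ⟨cs.isPosRoot_root s, h⟩⟩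

theorem inversionRoots_one : cs.inversionRoots 1 = ∅ := by
  ext τ
  simp only [inversionRoots, Set.mem_ofPred_eq, inv_one, Set.mem_empty_iff_false, iff_false]
  rintro ⟨h, h'⟩
  rw [geom_one] at h'
  exact h.not_nonpos h'

theorem geom_mem_inversionRoots_mul {v : W} {s : B} (h : ¬ cs.IsLeftDescent v s) {β : B →₀ ℝ}
    (hβ : β ∈ cs.inversionRoots v) :
    cs.geom (cs.simple s) β ∈ cs.inversionRoots (cs.simple s * v) := by
  refine ⟨hβ.1.geom_simple ?_, ?_⟩
  · rintro rfl
    exact h (cs.root_mem_inversionRoots.1 hβ)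
  · rw [mul_inv_rev, inv_simple, geom_mul, geom_simple_geom_simple]
    exact hβ.2

theorem geom_mem_inversionRoots {v : W} {s : B} {β : B →₀ ℝ}
    (hβ : β ∈ cs.inversionRoots (cs.simple s * v)) (hne : β ≠ root s) :
    cs.geom (cs.simple s) β ∈ cs.inversionRoots v := by
  refine ⟨hβ.1.geom_simple hne, ?_⟩
  have := hβ.2
  rwa [mul_inv_rev, inv_simple, geom_mul] at this

theorem neg_geom_root_mem {v : W} {i : B} (h : cs.IsRightDescent v i) :
    -cs.geom v (root i) ∈ cs.inversionRoots v := by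
  rw [isRightDescent_iff_geom] at h
  refine ⟨⟨⟨v * cs.simple i, i, ?_⟩, neg_nonneg.2 h⟩, ?_⟩
  · rw [geom_mul, geom_simple_root, map_neg]
  · rw [map_neg, geom_inv_geom]; exact neg_nonpos.2 (root_nonneg i)

/-- Apply the letters of the word one at a time: the letter at which the positive root turns
negative has that root as its current simple root. No reducedness is needed, so this yields the
exchange condition as well as the presence of reflections in the root order. -/
theorem conj_mem_leftInvSeq {ω : List B} {g : W} {j : B} (h0 : 0 ≤ cs.geom g (root j))
    (h : cs.geom (cs.wordProd ω)⁻¹ (cs.geom g (root j)) ≤ 0) :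
    g * cs.simple j * g⁻¹ ∈ cs.leftInvSeq ω := by
  induction ω generalizing g with
  | nil =>
    rw [wordProd_nil, inv_one, geom_one] at h
    exact absurd (le_antisymm h h0) (cs.geom_root_ne_zero g j)
  | cons b ω ih =>
    rw [leftInvSeq, List.mem_cons]
    by_cases e : cs.geom g (root j) = root b
    · left
      rw [cs.mul_simple_eq_simple_mul (Or.inl e), mul_inv_cancel_right]
    · right
      have hp : cs.IsPosRoot (cs.geom g (root j)) := ⟨⟨_, _, rfl⟩, h0⟩
      have h1 := (hp.geom_simple e).2
      rw [wordProd_cons, mul_inv_rev, inv_simple, geom_mul, ← geom_mul _ _ g] at h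
      rw [← geom_mul] at h1
      rw [List.mem_map]
      refine ⟨_, ih h1 h, ?_⟩
      simp only [MulAut.conj_apply, mul_inv_rev, inv_simple]
      simp [mul_assoc]

theorem exists_eraseIdx {ω : List B} {s : B} (h : cs.IsLeftDescent (cs.wordProd ω) s) :
    ∃ j < ω.length, cs.simple s * cs.wordProd ω = cs.wordProd (ω.eraseIdx j) := by
  rw [isLeftDescent_iff_geom] at h
  have := cs.conj_mem_leftInvSeq (g := 1) (j := s) (ω := ω) (by simpa using root_nonneg s)
    (by simpa using h)
  simp only [one_mul, inv_one, mul_one] at this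
  obtain ⟨j, hj, e⟩ := List.getElem_of_mem this
  rw [length_leftInvSeq] at hj
  refine ⟨j, hj, ?_⟩
  rw [← cs.getD_leftInvSeq_mul_wordProd, ← e, List.getD_eq_getElem]

/-- `v` acts trivially on the coordinates outside `c`. -/
def IsSupportedIn (c : List B) (v : W) : Prop := ∀ i, i ∉ c → ∀ x, cs.geom v x i = x i

theorem isSupportedIn_wordProd {c ω : List B} (h : ∀ i ∈ ω, i ∈ c) :
    cs.IsSupportedIn c (cs.wordProd ω) := by
  intro i hi x
  induction ω with
  | nil => simp
  | cons b ω ih =>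
    rw [wordProd_cons, geom_mul, cs.geom_simple_apply_ne, ih fun j hj => h j (by simp [hj])]
    rintro rfl
    exact hi (h _ (by simp))

variable {cs}

theorem IsSupportedIn.inv {c : List B} {v : W} (h : cs.IsSupportedIn c v) :
    cs.IsSupportedIn c v⁻¹ := by
  intro i hi x
  rw [← h i hi (cs.geom v⁻¹ x), geom_geom_inv]

/-- `x` lies in the span of the simple roots in `c`. -/
def VecSupportedIn (c : List B) (x : B →₀ ℝ) : Prop := ∀ i, i ∉ c → x i = 0

theorem IsSupportedIn.vec_iff {c : List B} {v : W} (h : cs.IsSupportedIn c v) {x : B →₀ ℝ} :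
    VecSupportedIn c (cs.geom v x) ↔ VecSupportedIn c x := by
  unfold VecSupportedIn
  exact forall₂_congr fun i hi => by rw [h i hi]

theorem vecSupportedIn_root {c : List B} {i : B} (h : i ∈ c) : VecSupportedIn c (root i) := by
  intro j hj
  exact root_apply_ne (by rintro rfl; exact hj h)

/-- Coordinates outside `c` are fixed by `v⁻¹`, so for an inversion they are both nonnegative and
nonpositive. -/
theorem IsSupportedIn.vec_of_mem {c : List B} {v : W} (h : cs.IsSupportedIn c v) {β : B →₀ ℝ}
    (hβ : β ∈ cs.inversionRoots v) : VecSupportedIn c β := by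
  intro i hi
  have h1 := hβ.2 i
  rw [h.inv i hi] at h1
  exact le_antisymm h1 (hβ.1.2 i)

theorem IsSupportedIn.mem_of_isRightDescent {c : List B} {v : W} (h : cs.IsSupportedIn c v) {i : B}
    (hi : cs.IsRightDescent v i) : i ∈ c := by
  by_contra hc
  have h1 := cs.isRightDescent_iff_geom.1 hi i
  rw [h i hc, root_apply_self] at h1
  norm_num at h1

theorem IsSupportedIn.mem_of_isLeftDescent {c : List B} {v : W} (h : cs.IsSupportedIn c v) {i : B}
    (hi : cs.IsLeftDescent v i) : i ∈ c :=
  h.inv.mem_of_isRightDescent (cs.isRightDescent_inv_iff.2 hi)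

variable (cs)

theorem exists_isReduced_subset (ω : List B) : ∃ ω', cs.IsReduced ω' ∧
    cs.wordProd ω' = cs.wordProd ω ∧ ∀ i ∈ ω', i ∈ ω := by
  induction ω with
  | nil => exact ⟨[], by simp [IsReduced], rfl, by simp⟩
  | cons b ω ih =>
    obtain ⟨ω', h1, h2, h3⟩ := ih
    by_cases hb : cs.IsLeftDescent (cs.wordProd ω') b
    · obtain ⟨j, hj, e⟩ := cs.exists_eraseIdx hb
      refine ⟨ω'.eraseIdx j, ?_, ?_, fun i hi => ?_⟩
      · have h4 := cs.isLeftDescent_iff.1 hb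
        rw [h1.eq, e] at h4
        rw [IsReduced, List.length_eraseIdx_of_lt hj]
        omega
      · rw [← e, wordProd_cons, h2]
      · exact List.mem_cons_of_mem _ (h3 i (List.mem_of_mem_eraseIdx hi))
    · refine ⟨b :: ω', cs.isReduced_cons.2 ⟨h1, hb⟩, by rw [wordProd_cons, wordProd_cons, h2], ?_⟩
      intro i hi
      rw [List.mem_cons] at hi ⊢
      exact hi.imp_right (h3 i)

theorem wordProd_mem_parabolic {J : Set B} {ω : List B} (h : ∀ i ∈ ω, i ∈ J) :
    cs.wordProd ω ∈ cs.parabolic J := by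
  induction ω with
  | nil => exact one_mem _
  | cons b ω ih =>
    rw [wordProd_cons]
    exact mul_mem (Subgroup.subset_closure ⟨b, h b (by simp), rfl⟩) (ih fun i hi => h i (by simp [hi]))

theorem exists_isReduced_of_mem_parabolic {J : Set B} {v : W} (h : v ∈ cs.parabolic J) :
    ∃ ω, cs.IsReduced ω ∧ cs.wordProd ω = v ∧ ∀ i ∈ ω, i ∈ J := by
  have : ∃ ω, cs.wordProd ω = v ∧ ∀ i ∈ ω, i ∈ J := by
    induction h using Subgroup.closure_induction with
    | mem x hx =>
      obtain ⟨i, hi, rfl⟩ := hx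
      exact ⟨[i], by simp, by simpa using hi⟩
    | one => exact ⟨[], by simp, by simp⟩
    | mul x y _ _ hx hy =>
      obtain ⟨ω, rfl, h1⟩ := hx
      obtain ⟨ω', rfl, h2⟩ := hy
      exact ⟨ω ++ ω', wordProd_append _ _ _, fun i hi => (List.mem_append.1 hi).elim (h1 i) (h2 i)⟩
    | inv x _ hx =>
      obtain ⟨ω, rfl, h1⟩ := hx
      exact ⟨ω.reverse, wordProd_reverse _ _, fun i hi => h1 i (List.mem_reverse.1 hi)⟩
  obtain ⟨ω, rfl, h1⟩ := this
  obtain ⟨ω', h2, h3, h4⟩ := cs.exists_isReduced_subset ω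
  exact ⟨ω', h2, h3, fun i hi => h1 i (h4 i hi)⟩

theorem isSupportedIn_of_mem_parabolic {c : List B} {v : W} (h : v ∈ cs.parabolic {i | i ∈ c}) :
    cs.IsSupportedIn c v := by
  obtain ⟨ω, -, rfl, h1⟩ := cs.exists_isReduced_of_mem_parabolic h
  exact cs.isSupportedIn_wordProd h1

section Longest

variable [Finite W]

theorem longest_mem (J : Set B) : cs.longest J ∈ cs.parabolic J :=
  (Classical.choose_spec (cs.exists_longest J)).1

theorem length_le_longest {J : Set B} {u : W} (h : u ∈ cs.parabolic J) :
    cs.length u ≤ cs.length (cs.longest J) :=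
  (Classical.choose_spec (cs.exists_longest J)).2 u h

theorem isLeftDescent_longest {J : Set B} {i : B} (hi : i ∈ J) :
    cs.IsLeftDescent (cs.longest J) i := by
  have h := cs.length_le_longest (mul_mem (Subgroup.subset_closure ⟨i, hi, rfl⟩) (cs.longest_mem J))
  have := cs.length_simple_mul_ne (cs.longest J) i
  exact lt_of_le_of_ne h this

theorem geom_longest_inv_nonpos {c : List B} {τ : B →₀ ℝ} (h : 0 ≤ τ) (hc : VecSupportedIn c τ) :
    cs.geom (cs.longest {i | i ∈ c})⁻¹ τ ≤ 0 := by
  have := map_nonneg_of_forall_root (-(cs.geom (cs.longest {i | i ∈ c})⁻¹).toLinearMap) h ?_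
  · simpa using this
  · intro i hi
    have hic : i ∈ c := by
      by_contra h'
      exact hi (hc i h')
    simpa using cs.isLeftDescent_iff_geom.1 (cs.isLeftDescent_longest (J := {i | i ∈ c}) hic)

end Longest

end CoxeterSystem

/-! ### Letters occurring in an element of the monoid, and reversal. -/

namespace CoxeterMatrix

variable {B : Type*} (M : CoxeterMatrix B)

open Classical in
/-- The value is `1` if the generator `i` does not occur in an element of the positive Artin monoid,
and `0` if it does. -/
def artinAvoid (i : B) : M.ArtinMonoid →* ℕ :=
  M.artinLift (fun j => if j = i then 0 else 1) <| by
    intro a b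
    by_cases hab : a = b
    · rw [hab]
    -- A braid word of length at least two ends with both of its letters, so the last two decide
    -- whether the product vanishes.
    rcases hm : M a b with _ | _ | m
    · simp [CoxeterSystem.braidWord, M.symmetric b a, hm, CoxeterSystem.alternatingWord]
    · exact absurd hm (M.off_diagonal a b hab)
    · simp only [CoxeterSystem.braidWord, M.symmetric b a, hm, CoxeterSystem.alternatingWord,
        List.concat_eq_append, List.map_append, List.prod_append]
      by_cases ha : a = i <;> by_cases hb : b = i <;> simp [ha, hb]
      have : ∀ (x y : B) (k : ℕ), ¬ x = i → ¬ y = i →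
          ((CoxeterSystem.alternatingWord x y k).map fun j => if j = i then 0 else 1).prod = 1 := by
        intro x y k hx hy
        induction k generalizing x y with
        | zero => simp [CoxeterSystem.alternatingWord]
        | succ k ih => simp [CoxeterSystem.alternatingWord, ih y x hy hx, hy]
      rw [this a b m ha hb, this b a m hb ha]

theorem artinAvoid_artinProd {i : B} {ω : List B} :
    M.artinAvoid i (M.artinProd ω) = 1 ↔ i ∉ ω := by
  classical
  rw [artinAvoid, artinLift_artinProd]
  induction ω with
  | nil => simp
  | cons j ω ih =>
    by_cases h : j = i
    · simp [h]
    · simp [h, ih, Ne.symm h]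

theorem artinAvoid_mul {i : B} {a b : M.ArtinMonoid} :
    M.artinAvoid i (a * b) = 1 ↔ M.artinAvoid i a = 1 ∧ M.artinAvoid i b = 1 := by
  rw [map_mul]
  exact ⟨fun h => ⟨Nat.eq_one_of_mul_eq_one_right h, Nat.eq_one_of_mul_eq_one_left h⟩,
    fun h => by rw [h.1, h.2]⟩

theorem artinAvoid_of {i j : B} :
    M.artinAvoid i (PresentedMonoid.of M.BraidRel j) = 1 ↔ i ≠ j := by
  have := M.artinAvoid_artinProd (i := i) (ω := [j])
  rw [artinProd_cons, artinProd_nil, mul_one] at this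
  simpa using this

theorem eq_one_of_artinLength {b : M.ArtinMonoid} (h : M.artinLength b = 1) : b = 1 := by
  obtain ⟨ω, rfl⟩ := M.artinProd_surjective b
  rw [artinLength_artinProd, ofAdd_eq_one, List.length_eq_zero_iff] at h
  rw [h, artinProd_nil]

theorem eq_one_of_mul_eq_one {a b : M.ArtinMonoid} (h : a * b = 1) : a = 1 ∧ b = 1 := by
  have := congrArg M.artinLength h
  rw [map_mul, map_one] at this
  have h1 : (M.artinLength a).toAdd + (M.artinLength b).toAdd = 0 := congrArg Multiplicative.toAdd this
  constructor <;> apply M.eq_one_of_artinLength <;> apply Multiplicative.toAdd.injective <;>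
    simp only [toAdd_one] <;> omega

theorem of_mul_ne_one {i : B} {b : M.ArtinMonoid} : PresentedMonoid.of M.BraidRel i * b ≠ 1 := by
  intro h
  have := M.length_eq_of_artinProd_eq (ω := [i]) (ω' := [])
    (by simpa [artinProd_cons, artinProd_nil] using (M.eq_one_of_mul_eq_one h).1)
  simp at this

/-- Reversal of words, as a homomorphism to the opposite monoid. -/
def artinRev : M.ArtinMonoid →* M.ArtinMonoidᵐᵒᵖ :=
  M.artinLift (fun i => MulOpposite.op (PresentedMonoid.of M.BraidRel i)) <| by
    have key : ∀ ω : List B,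
        (ω.map fun i => MulOpposite.op (PresentedMonoid.of M.BraidRel i)).prod =
          MulOpposite.op (M.artinProd ω.reverse) := by
      intro ω
      induction ω with
      | nil => simp [artinProd_nil]
      | cons i ω ih =>
        rw [List.map_cons, List.prod_cons, ih, List.reverse_cons, artinProd_append, artinProd_cons,
          artinProd_nil, mul_one, MulOpposite.op_mul]
    intro i j
    rw [key, key, CoxeterSystem.braidWord, CoxeterSystem.braidWord,
      CoxeterSystem.reverse_alternatingWord, CoxeterSystem.reverse_alternatingWord,
      M.symmetric j i]
    have := M.artinProd_braidWord i j
    unfold CoxeterSystem.braidWord at this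
    rw [M.symmetric j i] at this
    split_ifs
    · rw [this]
    · rw [this]

theorem artinRev_artinProd (ω : List B) :
    M.artinRev (M.artinProd ω) = MulOpposite.op (M.artinProd ω.reverse) := by
  rw [artinRev, artinLift_artinProd]
  induction ω with
  | nil => simp [artinProd_nil]
  | cons i ω ih =>
    rw [List.map_cons, List.prod_cons, ih, List.reverse_cons, artinProd_append, artinProd_cons,
      artinProd_nil, mul_one, MulOpposite.op_mul]

theorem artinRev_artinRev (b : M.ArtinMonoid) : (M.artinRev (M.artinRev b).unop).unop = b := by
  obtain ⟨ω, rfl⟩ := M.artinProd_surjective b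
  simp [artinRev_artinProd]

end CoxeterMatrix

/-! ### Number and uniqueness of Garside factors. -/

namespace CoxeterSystem

open CoxeterMatrix

variable {B : Type*} {M : CoxeterMatrix B} {W : Type*} [Group W] (cs : CoxeterSystem M W)

theorem artinRev_toArtin (u : W) :
    M.artinRev (cs.toArtin u) = MulOpposite.op (cs.toArtin u⁻¹) := by
  obtain ⟨ω, h1, rfl⟩ := cs.exists_isReduced u
  rw [cs.toArtin_wordProd h1, artinRev_artinProd, ← wordProd_reverse,
    cs.toArtin_wordProd h1.reverse]

theorem head_one : cs.head (1 : M.ArtinMonoid) = 1 := by rw [head, map_one, one_smul]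

theorem rest_one : cs.rest (1 : M.ArtinMonoid) = 1 := by rw [rest, map_one, one_smul]

theorem head_toArtin (u : W) : cs.head (cs.toArtin u) = u := by
  have := cs.head_toArtin_mul u 1
  rw [mul_one, head_one] at this
  have h1 := (cs.maxPrefix_isPrefix u 1).length_le
  rw [length_one, Nat.le_zero, length_eq_zero_iff] at h1
  rw [this, h1, mul_one]

theorem rest_toArtin (u : W) : cs.rest (cs.toArtin u) = 1 := by
  have := cs.toArtin_head_mul_rest (cs.toArtin u)
  rw [head_toArtin] at this
  exact cs.toArtin_mul_left_cancel (by rw [this, mul_one])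

theorem of_dvd_toArtin {i : B} {u : W} :
    PresentedMonoid.of M.BraidRel i ∣ cs.toArtin u ↔ cs.IsLeftDescent u i := by
  rw [of_dvd_iff cs, head_toArtin]

/-- `b` is a product of `k` simple elements. -/
def IsSimpleProd (k : ℕ) (b : M.ArtinMonoid) : Prop :=
  ∃ l : List W, l.length = k ∧ b = (l.map cs.toArtin).prod

variable {cs}

theorem IsSimpleProd.toArtin_mul {k : ℕ} {b : M.ArtinMonoid} (h : cs.IsSimpleProd k b) (u : W) :
    cs.IsSimpleProd (k + 1) (cs.toArtin u * b) := by
  obtain ⟨l, rfl, rfl⟩ := h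
  exact ⟨u :: l, rfl, by simp⟩

/-- Multiplying by `u` on the left pushes just one simple element into the remainder, which takes
the place of the factor lost by induction. -/
theorem IsSimpleProd.rest {k : ℕ} {b : M.ArtinMonoid} (h : cs.IsSimpleProd (k + 1) b) :
    cs.IsSimpleProd k (cs.rest b) := by
  induction k generalizing b with
  | zero =>
    obtain ⟨l, hl, rfl⟩ := h
    obtain ⟨u, rfl⟩ := List.length_eq_one_iff.1 hl
    refine ⟨[], rfl, ?_⟩
    simp [rest_toArtin]
  | succ k ih =>
    obtain ⟨l, hl, rfl⟩ := h
    obtain _ | ⟨u, l⟩ := l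
    · simp at hl
    rw [List.map_cons, List.prod_cons, rest_toArtin_mul]
    exact (ih ⟨l, by simpa using hl, rfl⟩).toArtin_mul _

theorem IsSimpleProd.of_right {k : ℕ} {a b : M.ArtinMonoid} (h : cs.IsSimpleProd k (a * b)) :
    cs.IsSimpleProd k b := by
  induction a using artin_induction with
  | one => rwa [one_mul] at h
  | mul i a ih =>
    apply ih
    rw [mul_assoc] at h
    cases k with
    | zero =>
      obtain ⟨l, hl, e⟩ := h
      rw [List.length_eq_zero_iff] at hl
      subst hl
      exact absurd e M.of_mul_ne_one
    | succ k =>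
      rw [← cs.toArtin_simple] at h
      rw [cs.eq_toArtin_mul_rest (cs.simple i) (a * b)]
      exact h.rest.toArtin_mul _

theorem IsSimpleProd.rev {k : ℕ} {b : M.ArtinMonoid} (h : cs.IsSimpleProd k b) :
    cs.IsSimpleProd k (M.artinRev b).unop := by
  obtain ⟨l, hl, rfl⟩ := h
  refine ⟨l.reverse.map (·⁻¹), by simpa using hl, ?_⟩
  clear hl
  induction l with
  | nil => simp
  | cons u l ih =>
    rw [List.map_cons, List.prod_cons, map_mul, MulOpposite.unop_mul, ih, artinRev_toArtin]
    simp

/-- Reversal turns left divisors into right divisors. Applied to a power of the fundamental element,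
this bounds the number of Garside factors in the `m`-weak order. -/
theorem IsSimpleProd.of_dvd {k : ℕ} {a b : M.ArtinMonoid} (h : cs.IsSimpleProd k b) (hd : a ∣ b) :
    cs.IsSimpleProd k a := by
  obtain ⟨x, rfl⟩ := hd
  have := h.rev
  rw [map_mul, MulOpposite.unop_mul] at this
  have h2 := this.of_right.rev
  rwa [artinRev_artinRev] at h2

variable (cs)

theorem rest_iterate_eq_one [Finite W] {m : ℕ} {w : M.ArtinMonoid} (hw : w ∈ cs.mWeak m) :
    cs.rest^[m] w = 1 := by
  have h : cs.IsSimpleProd m w := by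
    refine IsSimpleProd.of_dvd ?_ hw
    exact ⟨List.replicate m (cs.longest Set.univ), by simp, by simp [fundamental]⟩
  clear hw
  induction m generalizing w with
  | zero =>
    obtain ⟨l, hl, e⟩ := h
    rw [List.length_eq_zero_iff] at hl
    subst hl
    exact e
  | succ m ih => exact ih h.rest

theorem of_commute {i j : B} (h : M i j = 2) :
    PresentedMonoid.of M.BraidRel i * PresentedMonoid.of M.BraidRel j =
      PresentedMonoid.of M.BraidRel j * PresentedMonoid.of M.BraidRel i := by
  have := M.artinProd_braidWord i j
  simp only [braidWord, h, M.symmetric j i, alternatingWord, List.concat_eq_append, List.nil_append,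
    List.cons_append, artinProd_cons, artinProd_nil, mul_one] at this
  exact this

/-- If both letters divide, so does their braid element, which is `i j` here; cancel `i`. -/
theorem of_dvd_of_of_dvd_mul (cs : CoxeterSystem M W) {i j : B} (h : M i j = 2)
    {b : M.ArtinMonoid} : PresentedMonoid.of M.BraidRel j ∣ PresentedMonoid.of M.BraidRel i * b ↔
      PresentedMonoid.of M.BraidRel j ∣ b := by
  constructor
  · intro hj
    have hij : i ≠ j := by
      rintro rfl
      simp at h
    obtain ⟨v, hv, hl, -⟩ := cs.exists_eq_braidWord_mul hij
      ((of_dvd_iff cs).1 (dvd_mul_right (PresentedMonoid.of M.BraidRel i) b)) ((of_dvd_iff cs).1 hj)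
    have hp : cs.IsPrefix (cs.wordProd (braidWord M i j))
        (cs.head (PresentedMonoid.of M.BraidRel i * b)) := by
      rw [hv]; apply isPrefix_mul
      rw [← hv, hl, (cs.isReduced_braidWord hij).eq, length_alternatingWord]
    rw [← toArtin_dvd_iff, cs.toArtin_wordProd (cs.isReduced_braidWord hij)] at hp
    simp only [braidWord, h, alternatingWord, List.concat_eq_append, List.nil_append,
      List.cons_append, artinProd_cons, artinProd_nil, mul_one] at hp
    obtain ⟨x, hx⟩ := hp
    rw [mul_assoc] at hx
    exact ⟨x, cs.of_mul_left_cancel hx⟩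
  · rintro ⟨x, rfl⟩
    rw [← mul_assoc, of_commute h, mul_assoc]
    exact dvd_mul_right _ _

section Finite

variable [Finite W]

/-- Here `x` makes all simple roots negative and the inverse of the longest element makes them
nonnegative again, so the product has no right descent. -/
theorem eq_longest_of_forall_isRightDescent {x : W} (h : ∀ i, cs.IsRightDescent x i) :
    x = cs.longest Set.univ := by
  have : (cs.longest Set.univ)⁻¹ * x = 1 := by
    by_contra hne
    obtain ⟨i, hi⟩ := cs.exists_rightDescent_of_ne_one hne
    refine absurd hi (cs.not_isRightDescent_iff_geom.2 ?_)
    have h1 : 0 ≤ -cs.geom x (root i) := neg_nonneg.2 (cs.isRightDescent_iff_geom.1 (h i))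
    have := map_nonneg_of_forall_root (-(cs.geom (cs.longest Set.univ)⁻¹).toLinearMap) h1
      fun j _ => by
        simpa using cs.isLeftDescent_iff_geom.1 (cs.isLeftDescent_longest (Set.mem_univ j))
    rw [geom_mul]
    simpa using this
  rw [inv_mul_eq_one] at this
  exact this.symm

theorem isPrefix_longest (u : W) : cs.IsPrefix u (cs.longest Set.univ) := by
  obtain ⟨x, hx, hmax⟩ := Set.exists_max_image {x | cs.IsPrefix u x} cs.length (Set.toFinite _)
    ⟨u, cs.isPrefix_refl u⟩
  rw [← cs.eq_longest_of_forall_isRightDescent (x := x)]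
  · exact hx
  · intro i
    by_contra hi
    have h1 := hmax (x * cs.simple i) (IsPrefix.trans hx (cs.isPrefix_mul_simple hi))
    rw [cs.not_isRightDescent_iff.1 hi] at h1
    omega

theorem toArtin_dvd_fundamental (u : W) : cs.toArtin u ∣ cs.fundamental := by
  rw [fundamental, toArtin_dvd_iff, head_toArtin]
  exact cs.isPrefix_longest u

theorem exists_eq_toArtin {d : M.ArtinMonoid} (h : d ∣ cs.fundamental) : ∃ u, d = cs.toArtin u := by
  obtain ⟨x, hx⟩ := h
  obtain ⟨ω, rfl⟩ := M.artinProd_surjective d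
  obtain ⟨ω', rfl⟩ := M.artinProd_surjective x
  rw [← artinProd_append] at hx
  have : ω ++ ω' ∈ cs.reducedWords (cs.longest Set.univ) := by
    rw [← artinWords_toArtin]; exact hx.symm
  have h1 := this.1.take ω.length
  rw [List.take_left] at h1
  exact ⟨cs.wordProd ω, (cs.toArtin_wordProd h1).symm⟩

theorem isGarsideFactorization_head (w : M.ArtinMonoid) :
    cs.IsGarsideFactorization w fun k => cs.head (cs.rest^[k] w) := by
  refine ⟨fun k => cs.rest^[k] w, rfl, fun k => ⟨?_, cs.toArtin_dvd_fundamental _, ?_⟩⟩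
  · dsimp only
    rw [Function.iterate_succ_apply', toArtin_head_mul_rest]
  · intro d hd hd'
    obtain ⟨u, rfl⟩ := cs.exists_eq_toArtin hd'
    rw [toArtin_dvd_iff] at hd
    rwa [toArtin_dvd_iff, head_toArtin]

theorem IsGarsideFactorization.eq {w : M.ArtinMonoid} {v : ℕ → W}
    (h : cs.IsGarsideFactorization w v) (k : ℕ) : v k = cs.head (cs.rest^[k] w) := by
  obtain ⟨r, rfl, hr⟩ := h
  have key : ∀ k, v k = cs.head (r k) := by
    intro k
    have h1 := (hr k).2.2 (cs.toArtin (cs.head (r k)))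
      (cs.toArtin_dvd_iff.2 (cs.isPrefix_refl _)) (cs.toArtin_dvd_fundamental _)
    have h2 : cs.toArtin (v k) ∣ r k := ⟨_, (hr k).1⟩
    rw [toArtin_dvd_iff] at h1 h2
    rw [head_toArtin] at h1
    exact h2.antisymm h1
  have hrk : ∀ k, r k = cs.rest^[k] (r 0) := by
    intro k
    induction k with
    | zero => rfl
    | succ k ih =>
      rw [Function.iterate_succ_apply', ← ih]
      apply cs.toArtin_mul_left_cancel (u := v k)
      rw [← (hr k).1, key, toArtin_head_mul_rest]
  rw [key, hrk]

end Finite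

end CoxeterSystem

/-! ### The skew-symmetric form of a Coxeter word. -/

namespace CoxeterMatrix

variable {B : Type*} (M : CoxeterMatrix B)

/-- The part of the linear form `M.form (root s)` that comes from the letters of `c`. -/
def nbr : List B → B → (B →₀ ℝ) →ₗ[ℝ] ℝ
  | [], _ => 0
  | i :: c, s => M.gram s i • Finsupp.lapply i + nbr c s

/-- The skew-symmetric form of Reading and Speyer attached to the word `c` of a Coxeter element. -/
def omega : List B → (B →₀ ℝ) →ₗ[ℝ] (B →₀ ℝ) →ₗ[ℝ] ℝ
  | [] => 0
  | s :: c => omega c + (M.nbr c s).smulRight (Finsupp.lapply s) -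
      (Finsupp.lapply s : (B →₀ ℝ) →ₗ[ℝ] ℝ).smulRight (M.nbr c s)

theorem nbr_cons (i : B) (c : List B) (s : B) (x : B →₀ ℝ) :
    M.nbr (i :: c) s x = M.gram s i * x i + M.nbr c s x := by
  simp [nbr]

theorem nbr_nil (s : B) (x : B →₀ ℝ) : M.nbr [] s x = 0 := by simp [nbr]

theorem omega_nil (x y : B →₀ ℝ) : M.omega [] x y = 0 := by simp [omega]

theorem omega_cons (s : B) (c : List B) (x y : B →₀ ℝ) :
    M.omega (s :: c) x y = M.omega c x y + M.nbr c s x * y s - x s * M.nbr c s y := by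
  simp [omega]

theorem nbr_append_singleton (c : List B) (i s : B) (x : B →₀ ℝ) :
    M.nbr (c ++ [i]) s x = M.nbr c s x + M.gram s i * x i := by
  induction c with
  | nil => simp [nbr_cons, nbr_nil]
  | cons a c ih => rw [List.cons_append, nbr_cons, ih, nbr_cons]; ring

theorem omega_append_singleton (c : List B) (s : B) (x y : B →₀ ℝ) :
    M.omega (c ++ [s]) x y = M.omega c x y - M.nbr c s x * y s + x s * M.nbr c s y := by
  induction c with
  | nil => simp [omega_cons, omega_nil, nbr_nil]
  | cons a c ih =>
    rw [List.cons_append, omega_cons, ih, omega_cons, nbr_append_singleton, nbr_append_singleton,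
      nbr_cons, nbr_cons, M.gram_comm s a]
    ring

theorem omega_neg_symm (c : List B) (x y : B →₀ ℝ) : M.omega c x y = -M.omega c y x := by
  induction c with
  | nil => simp [omega_nil]
  | cons s c ih => rw [omega_cons, ih, omega_cons]; ring

theorem omega_self (c : List B) (x : B →₀ ℝ) : M.omega c x x = 0 := by
  have := M.omega_neg_symm c x x
  linarith

variable {M}

theorem nbr_congr {c : List B} {s : B} {x x' : B →₀ ℝ} (h : ∀ i ∈ c, x i = x' i) :
    M.nbr c s x = M.nbr c s x' := by
  induction c with
  | nil => simp [nbr_nil]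
  | cons a c ih =>
    rw [nbr_cons, nbr_cons, h a (by simp), ih fun i hi => h i (by simp [hi])]

theorem omega_congr {c : List B} {x x' y y' : B →₀ ℝ} (h : ∀ i ∈ c, x i = x' i)
    (h' : ∀ i ∈ c, y i = y' i) : M.omega c x y = M.omega c x' y' := by
  induction c with
  | nil => simp [omega_nil]
  | cons a c ih =>
    have h1 : ∀ i ∈ c, x i = x' i := fun i hi => h i (by simp [hi])
    have h2 : ∀ i ∈ c, y i = y' i := fun i hi => h' i (by simp [hi])
    rw [omega_cons, omega_cons, ih h1 h2, nbr_congr h1, nbr_congr h2, h a (by simp), h' a (by simp)]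

theorem nbr_eq_zero {c : List B} {s : B} {x : B →₀ ℝ} (h : ∀ i ∈ c, x i = 0) : M.nbr c s x = 0 := by
  rw [nbr_congr (x' := 0) (by simpa using h), map_zero]

theorem nbr_nonpos {c : List B} {s : B} (hs : s ∉ c) {x : B →₀ ℝ} (h : ∀ i ∈ c, 0 ≤ x i) :
    M.nbr c s x ≤ 0 := by
  induction c with
  | nil => simp [nbr_nil]
  | cons a c ih =>
    rw [nbr_cons]
    have h1 := ih (fun h => hs (by simp [h])) fun i hi => h i (by simp [hi])
    have h2 := mul_nonpos_of_nonpos_of_nonneg (M.gram_nonpos (i := s) (j := a)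
      (by rintro rfl; exact hs (by simp))) (h a (by simp))
    linarith

end CoxeterMatrix

/-! ### The skew form on roots: rotation and signs. -/

namespace CoxeterSystem

open CoxeterMatrix

variable {B : Type*} {M : CoxeterMatrix B} {W : Type*} [Group W] (cs : CoxeterSystem M W)

theorem form_root_eq_nbr {c : List B} (hc : c.Nodup) {x : B →₀ ℝ} (hx : VecSupportedIn c x)
    (s : B) : M.form (root s) x = M.nbr c s x := by
  induction c generalizing x with
  | nil =>
    have : x = 0 := by ext i; exact hx i (by simp)
    simp [this]
  | cons a c ih =>
    rw [List.nodup_cons] at hc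
    have h1 : VecSupportedIn c (x - x a • root a) := by
      intro i hi
      by_cases hia : i = a
      · subst hia; simp [root_apply_self]
      · simp [root_apply_ne (Ne.symm hia), hx i (by simp [hia, hi])]
    have := ih hc.2 h1
    have h2 : M.nbr c s (x - x a • root a) = M.nbr c s x := by
      refine nbr_congr fun i hi => ?_
      have : a ≠ i := by rintro rfl; exact hc.1 hi
      simp [root_apply_ne this]
    rw [h2, map_sub, map_smul, form_root_root, smul_eq_mul] at this
    rw [nbr_cons, ← this]; ring

theorem form_root_eq {s : B} {c : List B} (hc : (s :: c).Nodup) {x : B →₀ ℝ}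
    (hx : VecSupportedIn (s :: c) x) : M.form (root s) x = 2 * x s + M.nbr c s x := by
  rw [form_root_eq_nbr hc hx, nbr_cons, gram_self]

theorem omega_root_left {s : B} {c : List B} (hs : s ∉ c) (x : B →₀ ℝ) :
    M.omega (s :: c) (root s) x = -M.nbr c s x := by
  have h0 : ∀ i ∈ c, (root s : B →₀ ℝ) i = 0 := fun i hi =>
    root_apply_ne (by rintro rfl; exact hs hi)
  rw [omega_cons, nbr_eq_zero h0, root_apply_self,
    omega_congr (x' := 0) (y' := x) (by simpa using h0) fun i hi => rfl]
  simp

theorem omega_root_right {s : B} {c : List B} (hs : s ∉ c) (x : B →₀ ℝ) :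
    M.omega (c ++ [s]) x (root s) = -M.nbr c s x := by
  have h0 : ∀ i ∈ c, (root s : B →₀ ℝ) i = 0 := fun i hi =>
    root_apply_ne (by rintro rfl; exact hs hi)
  rw [omega_append_singleton, nbr_eq_zero h0, root_apply_self,
    omega_congr (x' := x) (y' := 0) (fun i hi => rfl) (by simpa using h0)]
  simp

theorem omega_cons_of_supported {s : B} {c : List B} (hs : s ∉ c) {x y : B →₀ ℝ}
    (hx : VecSupportedIn c x) (hy : VecSupportedIn c y) : M.omega (s :: c) x y = M.omega c x y := by
  rw [omega_cons, hx s hs, hy s hs]; ring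

theorem omega_append_of_supported {s : B} {c : List B} {x y : B →₀ ℝ}
    (hx : x s = 0) (hy : y s = 0) : M.omega (c ++ [s]) x y = M.omega (s :: c) x y := by
  rw [omega_append_singleton, omega_cons, hx, hy]; ring

/-- The reflection replaces the coordinate `x s` by `-x s - M.nbr c s x` and keeps the others.
Moving `s` to the end flips the sign of the mixed terms, and the two products of `nbr` cancel. -/
theorem omega_rotate {s : B} {c : List B} (hc : (s :: c).Nodup) {x y : B →₀ ℝ}
    (hx : VecSupportedIn (s :: c) x) (hy : VecSupportedIn (s :: c) y) :
    M.omega (c ++ [s]) (cs.geom (cs.simple s) x) (cs.geom (cs.simple s) y) =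
      M.omega (s :: c) x y := by
  have hs := (List.nodup_cons.1 hc).1
  have e : ∀ z : B →₀ ℝ, ∀ i ∈ c, cs.geom (cs.simple s) z i = z i := fun z i hi =>
    cs.geom_simple_apply_ne (by rintro rfl; exact hs hi) z
  rw [omega_append_singleton, omega_cons, omega_congr (e x) (e y), nbr_congr (e x), nbr_congr (e y)]
  simp only [geom_simple, Finsupp.coe_sub, Finsupp.coe_smul, Pi.sub_apply, Pi.smul_apply,
    root_apply_self, smul_eq_mul, form_root_eq hc hx, form_root_eq hc hy]
  ring

variable {cs}

theorem VecSupportedIn.cons {s : B} {c : List B} {x : B →₀ ℝ} (h : VecSupportedIn c x) :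
    VecSupportedIn (s :: c) x := fun i hi => h i fun h => hi (by simp [h])

theorem vecSupportedIn_rotate {s : B} {c : List B} {x : B →₀ ℝ} :
    VecSupportedIn (c ++ [s]) x ↔ VecSupportedIn (s :: c) x := by
  unfold VecSupportedIn
  refine forall_congr' fun i => ?_
  simp [or_comm]

theorem vecSupportedIn_geom_simple {s : B} {c : List B} {x : B →₀ ℝ} :
    VecSupportedIn (s :: c) (cs.geom (cs.simple s) x) ↔ VecSupportedIn (s :: c) x := by
  have : cs.IsSupportedIn (s :: c) (cs.simple s) := by
    have := cs.isSupportedIn_wordProd (c := s :: c) (ω := [s]) (by simp)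
    simpa using this
  exact this.vec_iff

theorem IsPosRoot.omega_root_left_nonneg {s : B} {c : List B} (hs : s ∉ c) {x : B →₀ ℝ}
    (hx : cs.IsPosRoot x) : 0 ≤ M.omega (s :: c) (root s) x := by
  rw [omega_root_left hs]
  have := nbr_nonpos (M := M) hs fun i _ => hx.2 i
  linarith

theorem IsPosRoot.omega_root_right_nonneg {s : B} {c : List B} (hs : s ∉ c) {x : B →₀ ℝ}
    (hx : cs.IsPosRoot x) : 0 ≤ M.omega (c ++ [s]) x (root s) := by
  rw [omega_root_right hs]
  have := nbr_nonpos (M := M) hs fun i _ => hx.2 i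
  linarith

/-- A positive root whose pairing with an initial simple root vanishes has no such coordinate. -/
theorem IsPosRoot.eq_zero_of_omega_eq_zero {s : B} {c : List B} (hc : (s :: c).Nodup) {x : B →₀ ℝ}
    (hx : cs.IsPosRoot x) (hne : x ≠ root s) (hsupp : VecSupportedIn (s :: c) x)
    (h : M.nbr c s x = 0) : x s = 0 ∧ M.form (root s) x = 0 := by
  have h1 := (hx.geom_simple hne).2 s
  rw [cs.geom_simple, form_root_eq hc hsupp, h] at h1
  simp only [Finsupp.coe_zero, Pi.zero_apply, Finsupp.coe_sub, Finsupp.coe_smul, Pi.sub_apply,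
    Pi.smul_apply, root_apply_self, smul_eq_mul] at h1
  have h2 : 0 ≤ x s := hx.2 s
  have h3 : x s = 0 := by linarith
  exact ⟨h3, by rw [form_root_eq hc hsupp, h, h3]; ring⟩

/-- If the pairing vanishes, reflecting in `s` would negate the nonnegative coordinate at `s` while
keeping the root positive; so that coordinate is zero and the root is orthogonal to `s`. -/
theorem IsPosRoot.omega_root_left_pos {s : B} {c : List B} (hc : (s :: c).Nodup) {x : B →₀ ℝ}
    (hx : cs.IsPosRoot x) (hne : x ≠ root s) (hsupp : VecSupportedIn (s :: c) x) :
    M.form (root s) x = 0 ∨ 0 < M.omega (s :: c) (root s) x := by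
  rcases (hx.omega_root_left_nonneg (List.nodup_cons.1 hc).1).eq_or_lt with h | h
  · left
    rw [omega_root_left (List.nodup_cons.1 hc).1] at h
    exact (hx.eq_zero_of_omega_eq_zero hc hne hsupp (by linarith)).2
  · exact Or.inr h

theorem IsPosRoot.omega_root_right_pos {s : B} {c : List B} (hc : (s :: c).Nodup) {x : B →₀ ℝ}
    (hx : cs.IsPosRoot x) (hne : x ≠ root s) (hsupp : VecSupportedIn (s :: c) x) :
    M.form (root s) x = 0 ∨ 0 < M.omega (c ++ [s]) x (root s) := by
  have := hx.omega_root_left_pos hc hne hsupp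
  rwa [omega_root_left (List.nodup_cons.1 hc).1, ← omega_root_right (List.nodup_cons.1 hc).1] at this

/-! ### Sorting words in the Coxeter group. -/

variable (cs)

/-- `ω` is the `c`-sorting word of `v`, and `v` is `c`-sortable. -/
inductive IsSorting : List B → W → List B → Prop
  | nil : IsSorting [] 1 []
  | take {s : B} {c : List B} {v : W} {ω : List B} : ¬ cs.IsLeftDescent v s →
      IsSorting (c ++ [s]) v ω → IsSorting (s :: c) (cs.simple s * v) (s :: ω)
  | skip {s : B} {c : List B} {v : W} {ω : List B} : ¬ cs.IsLeftDescent v s →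
      IsSorting c v ω → IsSorting (s :: c) v ω

variable {cs}

theorem IsSorting.wordProd_eq {c ω : List B} {v : W} (h : cs.IsSorting c v ω) :
    cs.wordProd ω = v := by
  induction h with
  | nil => simp
  | take _ _ ih => rw [wordProd_cons, ih]
  | skip _ _ ih => exact ih

theorem IsSorting.isReduced {c ω : List B} {v : W} (h : cs.IsSorting c v ω) : cs.IsReduced ω := by
  induction h with
  | nil => simp [IsReduced]
  | take hs h ih => exact cs.isReduced_cons.2 ⟨ih, by rwa [h.wordProd_eq]⟩
  | skip _ _ ih => exact ih

theorem IsSorting.subset {c ω : List B} {v : W} (h : cs.IsSorting c v ω) : ∀ i ∈ ω, i ∈ c := by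
  induction h with
  | nil => simp
  | take hs h ih =>
    intro i hi
    rcases List.mem_cons.1 hi with rfl | hi
    · simp
    · have := ih i hi
      simp only [List.mem_append, List.mem_singleton] at this
      simp only [List.mem_cons]; tauto
  | skip _ _ ih => exact fun i hi => List.mem_cons_of_mem _ (ih i hi)

theorem IsSorting.isSupportedIn {c ω : List B} {v : W} (h : cs.IsSorting c v ω) :
    cs.IsSupportedIn c v := by
  rw [← h.wordProd_eq]; exact cs.isSupportedIn_wordProd h.subset

theorem IsSorting.cons {c ω : List B} {v : W} (h : cs.IsSorting c v ω) {s : B} (hs : s ∉ c) :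
    cs.IsSorting (s :: c) v ω :=
  .skip (fun hd => hs (h.isSupportedIn.mem_of_isLeftDescent hd)) h

/-- A letter outside the support of `v` is never a left descent of any remaining factor, so it is
skipped wherever it stands. -/
theorem IsSorting.insert {x y ω : List B} {v : W} {s : B} (h : cs.IsSorting (x ++ y) v ω)
    (hs : s ∉ x ++ y) : cs.IsSorting (x ++ s :: y) v ω := by
  generalize hc : x ++ y = c at h
  induction h generalizing x y with
  | nil =>
    rw [List.append_eq_nil_iff] at hc
    obtain ⟨rfl, rfl⟩ := hc
    exact IsSorting.nil.cons (by simp)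
  | @take a c v ω ha h ih =>
    obtain _ | ⟨b, x⟩ := x
    · rw [List.nil_append] at hc hs ⊢
      subst hc
      exact (IsSorting.take ha h).cons hs
    · rw [List.cons_append] at hc
      obtain ⟨rfl, rfl⟩ := List.cons.inj hc
      refine .take ha ?_
      have := ih (x := x) (y := y ++ [b]) ?_ (by simp)
      · simpa using this
      · simp only [List.mem_append, List.mem_cons, List.cons_append, List.not_mem_nil] at hs ⊢
        tauto
  | @skip a c v ω ha h ih =>
    obtain _ | ⟨b, x⟩ := x
    · rw [List.nil_append] at hc hs ⊢
      subst hc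
      exact (IsSorting.skip ha h).cons hs
    · rw [List.cons_append] at hc
      obtain ⟨rfl, rfl⟩ := List.cons.inj hc
      exact .skip ha (ih (x := x) (y := y) (fun h => hs (by simp at h ⊢; tauto)) rfl)

theorem IsSorting.remove {x y ω : List B} {v : W} {s : B} (h : cs.IsSorting (x ++ s :: y) v ω)
    (hs : s ∉ ω) : cs.IsSorting (x ++ y) v ω := by
  generalize hc : x ++ s :: y = c at h
  induction h generalizing x y with
  | nil => simp at hc
  | @take a c v ω ha h ih =>
    obtain _ | ⟨b, x⟩ := x
    · rw [List.nil_append] at hc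
      obtain ⟨rfl, rfl⟩ := List.cons.inj hc
      simp at hs
    · rw [List.cons_append] at hc
      obtain ⟨rfl, rfl⟩ := List.cons.inj hc
      refine .take ha ?_
      have := ih (x := x) (y := y ++ [b]) (fun h => hs (by simp [h])) (by simp)
      simpa using this
  | @skip a c v ω ha h ih =>
    obtain _ | ⟨b, x⟩ := x
    · rw [List.nil_append] at hc
      obtain ⟨rfl, rfl⟩ := List.cons.inj hc
      exact h
    · rw [List.cons_append] at hc
      obtain ⟨rfl, rfl⟩ := List.cons.inj hc
      exact .skip ha (ih hs rfl)

variable (cs)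

/-- The pairs of a proper prefix of a word and the letter that follows it. -/
def letterSeq : List B → List (W × B)
  | [] => []
  | b :: ω => (1, b) :: (letterSeq ω).map fun p => (cs.simple b * p.1, p.2)

theorem leftInvSeq_eq (ω : List B) :
    cs.leftInvSeq ω = (cs.letterSeq ω).map fun p => p.1 * cs.simple p.2 * p.1⁻¹ := by
  induction ω with
  | nil => rfl
  | cons b ω ih =>
    rw [leftInvSeq, letterSeq, ih]
    simp [mul_assoc]

theorem geom_mem_of_mem_letterSeq {ω : List B} (h : cs.IsReduced ω) {p : W × B}
    (hp : p ∈ cs.letterSeq ω) :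
    cs.geom p.1 (root p.2) ∈ cs.inversionRoots (cs.wordProd ω) := by
  induction ω generalizing p with
  | nil => simp [letterSeq] at hp
  | cons b ω ih =>
    have h' := cs.isReduced_cons.1 h
    rw [letterSeq, List.mem_cons, List.mem_map] at hp
    rcases hp with rfl | ⟨q, hq, rfl⟩
    · rw [geom_one, root_mem_inversionRoots, isLeftDescent_iff_not_isLeftDescent_mul, wordProd_cons,
        simple_mul_simple_cancel_left]
      exact h'.2
    · rw [geom_mul, wordProd_cons]
      exact cs.geom_mem_inversionRoots_mul h'.2 (ih h'.1 hq)

variable {cs}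

/-- The root of an initial letter precedes all others by the dichotomy for initial simple roots;
rotation invariance carries the claim over from the rest of the word. This translates the root order
into a sign condition on the form. -/
theorem IsSorting.pairwise {c ω : List B} {v : W} (hc : c.Nodup) (h : cs.IsSorting c v ω) :
    (cs.letterSeq ω).Pairwise fun p q =>
      M.form (cs.geom p.1 (root p.2)) (cs.geom q.1 (root q.2)) = 0 ∨
        0 < M.omega c (cs.geom p.1 (root p.2)) (cs.geom q.1 (root q.2)) := by
  induction h with
  | nil => simp [letterSeq]
  | @take s c v ω hs h ih =>
    have hT := IsSorting.take hs h
    have hmem := fun p => cs.geom_mem_of_mem_letterSeq h.isReduced (p := p)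
    rw [h.wordProd_eq] at hmem
    rw [letterSeq, List.pairwise_cons, List.pairwise_map]
    constructor
    · intro p hp
      rw [List.mem_map] at hp
      obtain ⟨q, hq, rfl⟩ := hp
      have h1 := cs.geom_mem_inversionRoots_mul hs (hmem q hq)
      rw [geom_one, geom_mul]
      refine h1.1.omega_root_left_pos hc ?_ (hT.isSupportedIn.vec_of_mem h1)
      intro e
      have e2 := congrArg (cs.geom (cs.simple s)) e
      rw [geom_simple_geom_simple, geom_simple_root] at e2
      have h2 := (hmem q hq).1.2 s
      rw [e2] at h2
      simp [root_apply_self] at h2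
      norm_num at h2
    · have hc' : (c ++ [s]).Nodup := by
        rw [← List.concat_eq_append]
        exact (List.nodup_concat _ _).2 ⟨(List.nodup_cons.1 hc).1, (List.nodup_cons.1 hc).2⟩
      refine (ih hc').imp_of_mem fun {p q} hp hq hpq => ?_
      rw [geom_mul, geom_mul, form_geom]
      refine hpq.imp_right fun hpq => ?_
      have hv : ∀ r ∈ cs.letterSeq ω,
          VecSupportedIn (s :: c) (cs.geom (cs.simple s) (cs.geom r.1 (root r.2))) := fun r hr =>
        hT.isSupportedIn.vec_of_mem (cs.geom_mem_inversionRoots_mul hs (hmem r hr))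
      rw [← cs.omega_rotate hc (hv p hp) (hv q hq), geom_simple_geom_simple,
        geom_simple_geom_simple]
      exact hpq
  | @skip s c v ω hs h ih =>
    rw [List.nodup_cons] at hc
    have hmem := fun p => cs.geom_mem_of_mem_letterSeq h.isReduced (p := p)
    rw [h.wordProd_eq] at hmem
    refine (ih hc.2).imp_of_mem fun {p q} hp hq hpq => ?_
    rwa [omega_cons_of_supported hc.1 (h.isSupportedIn.vec_of_mem (hmem p hp))
      (h.isSupportedIn.vec_of_mem (hmem q hq))]

end CoxeterSystem

/-! ### Removing and adding inversions of sortable elements. -/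

namespace CoxeterSystem

open CoxeterMatrix

variable {B : Type*} {M : CoxeterMatrix B} {W : Type*} [Group W] (cs : CoxeterSystem M W)

theorem nodup_rotate {s : B} {c : List B} (hc : (s :: c).Nodup) : (c ++ [s]).Nodup := by
  rw [← List.concat_eq_append]
  exact (List.nodup_concat _ _).2 ⟨(List.nodup_cons.1 hc).1, (List.nodup_cons.1 hc).2⟩

/-- The first letter is itself an inversion. Once it is orthogonal to `s`, reflecting in it does not
affect orthogonality, so the hypothesis passes to the tail. -/
theorem gram_eq_zero_of_form_eq_zero {s : B} {ω : List B} (hω : cs.IsReduced ω)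
    (h : ∀ β ∈ cs.inversionRoots (cs.wordProd ω), M.form (root s) β = 0) :
    ∀ b ∈ ω, M.gram s b = 0 := by
  induction ω with
  | nil => simp
  | cons b ω ih =>
    have h' := cs.isReduced_cons.1 hω
    rw [wordProd_cons] at h
    have hb : M.gram s b = 0 := by
      rw [← form_root_root]
      refine h _ (cs.root_mem_inversionRoots.2 ?_)
      rw [isLeftDescent_iff_not_isLeftDescent_mul, simple_mul_simple_cancel_left]
      exact h'.2
    intro i hi
    rcases List.mem_cons.1 hi with rfl | hi
    · exact hb
    · refine ih h'.1 (fun β hβ => ?_) i hi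
      have h1 := h _ (cs.geom_mem_inversionRoots_mul h'.2 hβ)
      rwa [geom_simple, map_sub, map_smul, form_root_root, hb, smul_zero, sub_zero] at h1

theorem geom_wordProd_root_eq {s : B} {ω : List B} (h : ∀ b ∈ ω, M.gram s b = 0) :
    cs.geom (cs.wordProd ω) (root s) = root s := by
  induction ω with
  | nil => simp
  | cons b ω ih =>
    rw [wordProd_cons, geom_mul, ih fun i hi => h i (by simp [hi]), geom_simple, form_root_root,
      gram_comm, h b (by simp), zero_smul, sub_zero]

variable {cs} in
theorem not_isLeftDescent_mul_simple {y : W} {s i : B} (hs : ¬ cs.IsLeftDescent y s)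
    (hi : cs.IsRightDescent y i) : ¬ cs.IsLeftDescent (y * cs.simple i) s := by
  intro h
  have h1 := cs.not_isLeftDescent_iff.1 hs
  have h2 := cs.isRightDescent_iff.1 hi
  have h3 := cs.isLeftDescent_iff.1 h
  have h4 := cs.length_mul_simple (cs.simple s * y) i
  rw [← mul_assoc] at h3
  omega

/-- If right multiplication by `j` creates the left descent `s`, then `y` maps the simple root
`j` to the simple root `s`. -/
theorem eq_root_of_isLeftDescent_mul_simple {y : W} {s j : B} (hs : ¬ cs.IsLeftDescent y s)
    (h : cs.IsLeftDescent (y * cs.simple j) s) : cs.geom y (root j) = root s := by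
  rw [not_isLeftDescent_iff_geom] at hs
  rw [isLeftDescent_iff_geom, mul_inv_rev, inv_simple, geom_mul] at h
  have hp : cs.IsPosRoot (cs.geom y⁻¹ (root s)) := ⟨⟨_, _, rfl⟩, hs⟩
  by_cases e : cs.geom y⁻¹ (root s) = root j
  · rw [← e, geom_geom_inv]
  · exact absurd h (hp.geom_simple e).not_nonpos

variable {cs}

theorem geom_ne_root_of_nonneg {s : B} {β : B →₀ ℝ} (h : 0 ≤ β) :
    cs.geom (cs.simple s) β ≠ root s := by
  intro e
  have e2 := congrArg (cs.geom (cs.simple s)) e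
  rw [geom_simple_geom_simple, geom_simple_root] at e2
  have h2 := h s
  rw [e2] at h2
  simp only [Finsupp.coe_zero, Pi.zero_apply, Finsupp.coe_neg, Pi.neg_apply, root_apply_self] at h2
  norm_num at h2

theorem isLeftDescent_simple_mul {s : B} {v : W} (h : ¬ cs.IsLeftDescent v s) :
    cs.IsLeftDescent (cs.simple s * v) s := by
  rw [isLeftDescent_iff_not_isLeftDescent_mul, simple_mul_simple_cancel_left]
  exact h

/-- An inversion that is last for the skew form belongs to a lower cover, and removing it preserves
sortability. The recursion transports this inversion until it is the simple root of the letter being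
taken. -/
theorem IsSorting.exists_remove_inversion {c ω : List B} {v : W} (hc : c.Nodup)
    (h : cs.IsSorting c v ω) {τ : B →₀ ℝ} (hτ : τ ∈ cs.inversionRoots v)
    (hmax : ∀ β ∈ cs.inversionRoots v, M.omega c τ β ≤ 0) :
    ∃ i ω', cs.geom v (root i) = -τ ∧ cs.IsSorting c (v * cs.simple i) ω' := by
  induction h generalizing τ with
  | nil => rw [inversionRoots_one] at hτ; exact hτ.elim
  | @take s c y ω hs h ih =>
    have hT := IsSorting.take hs h
    by_cases e : τ = root s
    · subst e
      -- Being both first and last, the root of `s` is orthogonal to every inversion of `y`. Hence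
      -- `s` commutes with all letters of `y` and can be taken out.
      have h0 : ∀ β ∈ cs.inversionRoots (cs.wordProd ω), M.form (root s) β = 0 := by
        rw [h.wordProd_eq]
        intro β hβ
        have h1 := cs.geom_mem_inversionRoots_mul hs hβ
        rcases h1.1.omega_root_left_pos hc (geom_ne_root_of_nonneg hβ.1.2)
          (hT.isSupportedIn.vec_of_mem h1) with h2 | h2
        · rw [geom_simple, map_sub, map_smul, form_root_self, smul_eq_mul] at h2
          linarith
        · exact absurd h2 (not_lt.2 (hmax _ h1))
      have h1 := cs.gram_eq_zero_of_form_eq_zero h.isReduced h0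
      have h2 := cs.geom_wordProd_root_eq h1
      rw [h.wordProd_eq] at h2
      refine ⟨s, ω, by rw [geom_mul, h2, geom_simple_root], ?_⟩
      rw [mul_assoc, cs.mul_simple_eq_simple_mul (Or.inl h2), simple_mul_simple_cancel_left]
      have h3 := h.remove (x := c) (y := []) (s := s) fun hm => by
        have := h1 s hm
        rw [gram_self] at this
        norm_num at this
      rw [List.append_nil] at h3
      exact h3.cons (List.nodup_cons.1 hc).1
    · have hτ' := cs.geom_mem_inversionRoots hτ e
      obtain ⟨i, ω', h1, h2⟩ := ih (nodup_rotate hc) hτ' fun β hβ => by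
        have h3 := cs.geom_mem_inversionRoots_mul hs hβ
        have h4 := hmax _ h3
        rwa [← cs.omega_rotate hc (hT.isSupportedIn.vec_of_mem hτ)
          (hT.isSupportedIn.vec_of_mem h3), geom_simple_geom_simple] at h4
      refine ⟨i, s :: ω', by rw [geom_mul, h1, map_neg, geom_simple_geom_simple], ?_⟩
      rw [mul_assoc]
      refine .take (not_isLeftDescent_mul_simple hs ?_) h2
      rw [isRightDescent_iff_geom, h1]
      exact neg_nonpos.2 hτ'.1.2
  | @skip s c y ω hs h ih =>
    obtain ⟨hsc, hc⟩ := List.nodup_cons.1 hc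
    obtain ⟨i, ω', h1, h2⟩ := ih hc hτ fun β hβ => by
      have := hmax β hβ
      rwa [omega_cons_of_supported hsc (h.isSupportedIn.vec_of_mem hτ)
        (h.isSupportedIn.vec_of_mem hβ)] at this
    exact ⟨i, ω', h1, h2.cons hsc⟩

variable (cs) in
-- The difference is a nonnegative combination of inversions: each new letter `b` contributes
-- `-M.gram b s` times its own root. Testing against a functional avoids naming the coefficients.
theorem map_geom_root_sub_nonneg (f : (B →₀ ℝ) →ₗ[ℝ] ℝ) {s : B} {ω : List B} (hs : s ∉ ω)
    (hω : cs.IsReduced ω) (h : ∀ β ∈ cs.inversionRoots (cs.wordProd ω), 0 ≤ f β) :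
    0 ≤ f (cs.geom (cs.wordProd ω) (root s) - root s) := by
  induction ω generalizing f with
  | nil => simp
  | cons b ω ih =>
    have h' := cs.isReduced_cons.1 hω
    rw [wordProd_cons] at h ⊢
    have h1 := ih (f ∘ₗ (cs.geom (cs.simple b)).toLinearMap) (fun h => hs (by simp [h])) h'.1
      fun β hβ => h _ (cs.geom_mem_inversionRoots_mul h'.2 hβ)
    have h2 := h _ (cs.root_mem_inversionRoots.2 (isLeftDescent_simple_mul h'.2))
    have h3 : M.gram b s ≤ 0 := M.gram_nonpos (by rintro rfl; exact hs (by simp))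
    simp only [LinearMap.coe_comp, LinearEquiv.coe_coe, Function.comp_apply, map_sub] at h1
    rw [cs.geom_simple b (root s), form_root_root, map_sub, map_smul, smul_eq_mul] at h1
    rw [geom_mul, map_sub]
    nlinarith

/-- Otherwise the preceding lemma, applied to the pairing with the moved root `τ`, forces `ω(root s,
τ) = 0`. A positive root other than `root s` with this property has no `s`-coordinate, but that of
`τ` is `1`. -/
theorem exists_omega_neg {s : B} {c ω : List B} (hc : (s :: c).Nodup) (hω : cs.IsReduced ω)
    (hsub : ∀ i ∈ ω, i ∈ c) (hne : cs.geom (cs.wordProd ω) (root s) ≠ root s) :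
    ∃ β ∈ cs.inversionRoots (cs.wordProd ω),
      M.omega (s :: c) β (cs.geom (cs.wordProd ω) (root s)) < 0 := by
  by_contra! hcon
  have hs := (List.nodup_cons.1 hc).1
  set τ := cs.geom (cs.wordProd ω) (root s) with hτ
  have h1 : τ s = 1 := by
    rw [hτ, cs.isSupportedIn_wordProd hsub s hs, root_apply_self]
  have hp : cs.IsPosRoot τ := by
    refine ⟨⟨_, _, rfl⟩, (cs.geom_root_nonneg_or_nonpos _ _).resolve_right fun h => ?_⟩
    have := h s
    rw [← hτ, h1] at this
    norm_num at this
  have h2 := cs.map_geom_root_sub_nonneg ((M.omega (s :: c)).flip τ)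
    (fun h => hs (hsub s h)) hω (by simpa using hcon)
  rw [LinearMap.flip_apply, ← hτ, map_sub, LinearMap.sub_apply, omega_self, omega_root_left hs] at h2
  have h3 := nbr_nonpos (M := M) hs fun i _ => hp.2 i
  have h4 : VecSupportedIn (s :: c) τ :=
    (cs.isSupportedIn_wordProd fun i hi => List.mem_cons_of_mem _ (hsub i hi)).vec_iff.2
      (vecSupportedIn_root (by simp))
  have := (hp.eq_zero_of_omega_eq_zero hc hne h4 (by linarith)).1
  rw [h1] at this
  norm_num at this

/-- The roots of the cover reflections of a `c`-sortable element, and the roots that can be added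
to its inversions, occur in a common list on which the skew-symmetric form is `-M.form`. -/
theorem IsSorting.exists_cover_list {c ω : List B} {v : W} (hc : c.Nodup)
    (h : cs.IsSorting c v ω) : ∃ C : List (B →₀ ℝ),
      C.Pairwise (fun x y => M.omega c x y = -M.form x y) ∧ (∀ x ∈ C, VecSupportedIn c x) ∧
      (∀ j, 0 ≤ cs.geom v (root j) → VecSupportedIn c (cs.geom v (root j)) →
        (∀ β ∈ cs.inversionRoots v, 0 ≤ M.omega c β (cs.geom v (root j))) →
        cs.geom v (root j) ∈ C ∧ ∃ ω', cs.IsSorting c (v * cs.simple j) ω') ∧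
      ∀ i, cs.IsRightDescent v i → cs.geom v (root i) ∈ C := by
  induction h with
  | nil =>
    refine ⟨[], by simp, by simp, fun j _ h => ?_, fun i hi => ?_⟩
    · refine absurd ?_ (cs.geom_root_ne_zero 1 j)
      ext i
      exact h i (by simp)
    · simp [IsRightDescent] at hi
  | @take s c y ω hs h ih =>
    obtain ⟨hsc, hc0⟩ := List.nodup_cons.1 hc
    obtain ⟨C, hC1, hC2, hC3, hC4⟩ := ih (nodup_rotate hc)
    have hT := IsSorting.take hs h
    refine ⟨C.map (cs.geom (cs.simple s)), ?_, ?_, ?_, ?_⟩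
    · rw [List.pairwise_map]
      refine hC1.imp_of_mem fun {x z} hx hz hxz => ?_
      have hx' := vecSupportedIn_geom_simple (cs := cs).2 (vecSupportedIn_rotate.1 (hC2 x hx))
      have hz' := vecSupportedIn_geom_simple (cs := cs).2 (vecSupportedIn_rotate.1 (hC2 z hz))
      rw [← cs.omega_rotate hc hx' hz', geom_simple_geom_simple, geom_simple_geom_simple, form_geom]
      exact hxz
    · intro x hx
      obtain ⟨z, hz, rfl⟩ := List.mem_map.1 hx
      exact vecSupportedIn_geom_simple.2 (vecSupportedIn_rotate.1 (hC2 z hz))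
    · intro j hj hsupp hpos
      have hyj : cs.geom y (root j) = cs.geom (cs.simple s) (cs.geom (cs.simple s * y) (root j)) := by
        rw [geom_mul, geom_simple_geom_simple]
      have hp : cs.IsPosRoot (cs.geom (cs.simple s * y) (root j)) := ⟨⟨_, _, rfl⟩, hj⟩
      have hne : cs.geom (cs.simple s * y) (root j) ≠ root s := by
        intro e
        rw [e, geom_simple_root] at hyj
        have h1 : cs.IsRightDescent y j := by
          rw [isRightDescent_iff_geom, hyj]
          exact neg_nonpos.2 (root_nonneg s)
        have h2 := cs.neg_geom_root_mem h1
        rw [hyj, neg_neg] at h2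
        exact hs (cs.root_mem_inversionRoots.1 h2)
      have hp' := hp.geom_simple hne
      have hsupp' := vecSupportedIn_geom_simple (cs := cs).2 hsupp
      rw [← hyj] at hp' hsupp'
      obtain ⟨h1, ω', h2⟩ := hC3 j hp'.2 (vecSupportedIn_rotate.2 hsupp') fun β hβ => by
        have h3 := cs.geom_mem_inversionRoots_mul hs hβ
        have h4 := hpos _ h3
        rwa [← cs.omega_rotate hc (hT.isSupportedIn.vec_of_mem h3) hsupp, geom_simple_geom_simple,
          ← hyj] at h4
      refine ⟨List.mem_map.2 ⟨_, h1, (geom_mul _ _ _ _).symm⟩, s :: ω', ?_⟩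
      rw [mul_assoc]
      refine .take (fun hd => ?_) h2
      have h3 := cs.eq_root_of_isLeftDescent_mul_simple hs hd
      have h4 := hj s
      rw [geom_mul, h3, geom_simple_root] at h4
      simp only [Finsupp.coe_zero, Pi.zero_apply, Finsupp.coe_neg, Pi.neg_apply,
        root_apply_self] at h4
      norm_num at h4
    · intro i hi
      rw [geom_mul]
      refine List.mem_map_of_mem ?_
      by_cases hyi : cs.IsRightDescent y i
      · exact hC4 i hyi
      -- A right descent of `s y` that `y` lacks comes from the root of `s`. It is addable to `y`,
      -- since `s` is final in the rotated word, so it is already in the list of `y`.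
      · have h1 : cs.geom y (root i) = root s := by
          by_contra hne
          have hp : cs.IsPosRoot (cs.geom y (root i)) :=
            ⟨⟨_, _, rfl⟩, cs.not_isRightDescent_iff_geom.1 hyi⟩
          rw [isRightDescent_iff_geom, geom_mul] at hi
          exact (hp.geom_simple hne).not_nonpos hi
        refine (hC3 i (cs.not_isRightDescent_iff_geom.1 hyi) ?_ fun β hβ => ?_).1
        · rw [h1]; exact vecSupportedIn_root (by simp)
        · rw [h1]; exact hβ.1.omega_root_right_nonneg hsc
  | @skip s c v ω hs h ih =>
    obtain ⟨hsc, hc0⟩ := List.nodup_cons.1 hc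
    obtain ⟨C, hC1, hC2, hC3, hC4⟩ := ih hc0
    -- On vectors supported in `c`, pairing with the initial root of `s` is exactly the negative of
    -- the symmetric form, so this root may head the list.
    refine ⟨root s :: C, ?_, ?_, ?_, fun i hi => List.mem_cons_of_mem _ (hC4 i hi)⟩
    · rw [List.pairwise_cons]
      refine ⟨fun y hy => ?_, hC1.imp_of_mem fun {x y} hx hy hxy => ?_⟩
      · rw [omega_root_left hsc, form_root_eq_nbr hc0 (hC2 y hy)]
      · rw [omega_cons_of_supported hsc (hC2 x hx) (hC2 y hy), hxy]
    · intro x hx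
      rcases List.mem_cons.1 hx with rfl | hx
      · exact vecSupportedIn_root (by simp)
      · exact (hC2 x hx).cons
    · intro j hj hsupp hpos
      by_cases hjs : VecSupportedIn c (cs.geom v (root j))
      · obtain ⟨h1, ω', h2⟩ := hC3 j hj hjs fun β hβ => by
          have := hpos β hβ
          rwa [omega_cons_of_supported hsc (h.isSupportedIn.vec_of_mem hβ) hjs] at this
        exact ⟨List.mem_cons_of_mem _ h1, ω', h2.cons hsc⟩
      -- Since `v` changes only coordinates in `c`, a root that leaves the span of `c` must come
      -- from the letter `s`. If it is moved by `v`, `exists_omega_neg` shows that it is not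
      -- addable.
      · have hj' : j = s := by
          by_contra hne
          refine hjs fun i hi => ?_
          by_cases his : i = s
          · subst his
            rw [h.isSupportedIn i hi, root_apply_ne hne]
          · exact hsupp i (by simp [his, hi])
        subst hj'
        by_cases e : cs.geom v (root j) = root j
        · refine ⟨by simp [e], j :: ω, ?_⟩
          rw [cs.mul_simple_eq_simple_mul (Or.inl e)]
          refine .take hs ?_
          have := IsSorting.insert (x := c) (y := []) (s := j) (by simpa using h) (by simpa using hsc)
          exact this
        · exfalso
          obtain ⟨β, hβ, h1⟩ := exists_omega_neg hc h.isReduced h.subset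
            (by rwa [h.wordProd_eq])
          rw [h.wordProd_eq] at hβ h1
          exact absurd h1 (not_lt.2 (hpos β hβ))

/-- Both roots lie in the cover list, so the skew form between them is determined by the symmetric
one up to their unknown order. In one order the coordinate vanishes outright; in the other it equals
`-M.gram i j ≥ 0`, although a descent makes it nonpositive. -/
theorem IsSorting.apply_eq_zero {s : B} {c ω : List B} {v : W} (hc : (s :: c).Nodup)
    (h : cs.IsSorting (c ++ [s]) v ω) {i j : B} (hi : cs.geom v (root i) = -root s)
    (hj : cs.IsRightDescent v j) (hij : j ≠ i) : cs.geom v (root j) s = 0 := by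
  obtain ⟨hsc, hc0⟩ := List.nodup_cons.1 hc
  obtain ⟨C, hC1, hC2, -, hC4⟩ := h.exists_cover_list (nodup_rotate hc)
  have hi' : cs.IsRightDescent v i := by
    rw [isRightDescent_iff_geom, hi]; exact neg_nonpos.2 (root_nonneg s)
  have hne : cs.geom v (root i) ≠ cs.geom v (root j) := by
    intro e
    have e2 := DFunLike.congr_fun ((cs.geom v).injective e) i
    rw [root_apply_self, root_apply_ne hij] at e2
    norm_num at e2
  set x := cs.geom v (root j) with hx
  have hxs : x s ≤ 0 := cs.isRightDescent_iff_geom.1 hj s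
  have hform : M.form (root s) x = -M.gram i j := by
    have := cs.form_geom v (root i) (root j)
    rw [hi, form_root_root, map_neg, LinearMap.neg_apply, ← hx] at this
    linarith
  have hgram := M.gram_nonpos (Ne.symm hij)
  have hsupp := vecSupportedIn_rotate.1 (hC2 x (hC4 j hj))
  have hf := form_root_eq (M := M) hc hsupp
  have hr := omega_root_right (M := M) hsc x
  have hl := M.omega_neg_symm (c ++ [s]) (root s) x
  have key : M.omega (c ++ [s]) (cs.geom v (root i)) x = -M.form (cs.geom v (root i)) x ∨
      M.omega (c ++ [s]) x (cs.geom v (root i)) = -M.form x (cs.geom v (root i)) := by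
    have : Std.Symm fun x y => M.omega (c ++ [s]) x y = -M.form x y ∨
      M.omega (c ++ [s]) y x = -M.form y x := ⟨fun _ _ => Or.symm⟩
    exact (hC1.imp fun {a b} hab => (Or.inl hab : _ ∨ M.omega (c ++ [s]) b a = -M.form b a)).forall
      (hC4 i hi') (hC4 j hj) hne
  rw [hi] at key
  rw [M.form_comm x] at key
  simp only [map_neg, LinearMap.neg_apply] at key
  rcases key with key | key <;> linarith

/-! ### Longest elements are sortable. -/

section Longest

variable [Finite W]

variable (cs) in
-- The form needed for the induction: `u` is the part of the longest element already read, `x` what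
-- is left, and `c` what has become of `c₁`. The map `u` carries the form of `c` to that of `c₁`,
-- and inversions of `u` precede those of `x`.
theorem exists_isSorting_of_mul_eq_longest {c₁ : List B} (n : ℕ) {c : List B} {u x : W}
    (hn : cs.length x + c.length ≤ n) (hc : c.Nodup) (hsub : ∀ i ∈ c, i ∈ c₁)
    (hu : cs.IsSupportedIn c₁ u) (hx : x ∈ cs.parabolic {i | i ∈ c})
    (hux : u * x = cs.longest {i | i ∈ c₁})
    (hpos : ∀ β ∈ cs.inversionRoots x, 0 ≤ cs.geom u β)
    (hω : ∀ y z, VecSupportedIn c y → VecSupportedIn c z →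
      M.omega c₁ (cs.geom u y) (cs.geom u z) = M.omega c y z)
    (hpair : ∀ β ∈ cs.inversionRoots u, ∀ γ ∈ cs.inversionRoots x,
      M.form β (cs.geom u γ) = 0 ∨ 0 < M.omega c₁ β (cs.geom u γ)) :
    ∃ ω, cs.IsSorting c x ω := by
  induction n generalizing c u x with
  | zero =>
    have h0 : c = [] := List.eq_nil_of_length_eq_zero (by omega)
    have h1 : x = 1 := cs.length_eq_zero_iff.1 (by omega)
    subst h0 h1
    exact ⟨[], .nil⟩
  | succ n ih =>
    obtain _ | ⟨s, c⟩ := c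
    · obtain ⟨ω, -, rfl, h1⟩ := cs.exists_isReduced_of_mem_parabolic hx
      obtain rfl : ω = [] := List.eq_nil_iff_forall_not_mem.2 fun i hi => by simpa using h1 i hi
      exact ⟨[], by simpa using IsSorting.nil (cs := cs)⟩
    obtain ⟨hsc, hc0⟩ := List.nodup_cons.1 hc
    have hsupp := cs.isSupportedIn_of_mem_parabolic hx
    have hsc₁ : s ∈ c₁ := hsub s (by simp)
    by_cases hsx : cs.IsLeftDescent x s
    · obtain ⟨y, rfl⟩ : ∃ y, x = cs.simple s * y :=
        ⟨cs.simple s * x, by rw [simple_mul_simple_cancel_left]⟩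
      have hsy : ¬ cs.IsLeftDescent y s := by
        rw [isLeftDescent_iff_not_isLeftDescent_mul, simple_mul_simple_cancel_left] at hsx
        exact hsx
      have hl := cs.not_isLeftDescent_iff.1 hsy
      have hmem : {i | i ∈ c ++ [s]} = {i | i ∈ s :: c} := by ext i; simp [or_comm]
      suffices h : ∃ ω, cs.IsSorting (c ++ [s]) y ω from
        h.imp' (fun ω => s :: ω) fun ω h => .take hsy h
      refine ih (u := u * cs.simple s) ?_ (nodup_rotate hc) ?_ ?_ ?_ ?_ ?_ ?_ ?_
      · rw [List.length_append, List.length_singleton]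
        rw [hl, List.length_cons] at hn
        omega
      · intro i hi
        refine hsub i ?_
        simpa [or_comm] using hi
      · intro i hi z
        rw [geom_mul, hu i hi, cs.geom_simple_apply_ne]
        rintro rfl; exact hi hsc₁
      · rw [hmem]
        have h1 := mul_mem (Subgroup.subset_closure ⟨s, by simp, rfl⟩ :
          cs.simple s ∈ cs.parabolic {i | i ∈ s :: c}) hx
        rwa [simple_mul_simple_cancel_left] at h1
      · rw [mul_assoc, hux]
      · intro β hβ
        rw [geom_mul]
        exact hpos _ (cs.geom_mem_inversionRoots_mul hsy hβ)
      · intro y z hy hz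
        have hy' := vecSupportedIn_geom_simple (cs := cs).2 (vecSupportedIn_rotate.1 hy)
        have hz' := vecSupportedIn_geom_simple (cs := cs).2 (vecSupportedIn_rotate.1 hz)
        rw [geom_mul, geom_mul, hω _ _ hy' hz', ← cs.omega_rotate hc hy' hz',
          geom_simple_geom_simple, geom_simple_geom_simple]
      · intro β hβ γ hγ
        have hγ' := cs.geom_mem_inversionRoots_mul hsy hγ
        rw [geom_mul]
        by_cases hβu : β ∈ cs.inversionRoots u
        · exact hpair β hβu _ hγ'
        · have h1 : cs.IsPosRoot (cs.geom u⁻¹ β) :=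
            (hβ.1.geom_or u⁻¹).resolve_right fun h => hβu ⟨hβ.1, h⟩
          have h2 : cs.geom u⁻¹ β = root s := by
            by_contra hne
            have h3 := hβ.2
            rw [mul_inv_rev, inv_simple, geom_mul] at h3
            exact (h1.geom_simple hne).not_nonpos h3
          have h3 : β = cs.geom u (root s) := by rw [← h2, geom_geom_inv]
          have h4 := hsupp.vec_of_mem hγ'
          rw [h3, form_geom, hω _ _ (vecSupportedIn_root (by simp)) h4]
          exact hγ'.1.omega_root_left_pos hc (geom_ne_root_of_nonneg hγ.1.2) h4
    -- When `s` is not a descent of `x`, its root has already been read in `u`. It must then both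
    -- follow and precede the inversions of `x`, so it is orthogonal to all of them and `s` does not
    -- occur in `x`.
    · have hneg : cs.IsRightDescent u s := by
        by_contra hcon
        rw [not_isRightDescent_iff_geom] at hcon
        have h1 := cs.geom_longest_inv_nonpos hcon (hu.vec_iff.2 (vecSupportedIn_root hsc₁))
        rw [← hux, mul_inv_rev, geom_mul, geom_inv_geom] at h1
        exact hsx (cs.isLeftDescent_iff_geom.2 h1)
      have h1 : ∀ β ∈ cs.inversionRoots x, M.form (root s) β = 0 := by
        intro β hβ
        rcases hpair _ (cs.neg_geom_root_mem hneg) β hβ with h | h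
        · rw [map_neg, LinearMap.neg_apply, form_geom] at h
          linarith
        · rw [map_neg, LinearMap.neg_apply, hω _ _ (vecSupportedIn_root (by simp))
            (hsupp.vec_of_mem hβ)] at h
          have := hβ.1.omega_root_left_nonneg hsc
          linarith
      obtain ⟨ω, h2, rfl, h3⟩ := cs.exists_isReduced_of_mem_parabolic hx
      have h4 := cs.gram_eq_zero_of_form_eq_zero h2 h1
      suffices h : ∃ ω', cs.IsSorting c (cs.wordProd ω) ω' from h.imp fun ω' h => .skip hsx h
      refine ih (u := u) ?_ hc0 ?_ hu ?_ hux hpos ?_ hpair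
      · rw [List.length_cons] at hn; omega
      · exact fun i hi => hsub i (by simp [hi])
      · refine cs.wordProd_mem_parabolic fun i hi => ?_
        have h5 := h3 i hi
        simp only [Set.mem_ofPred_eq, List.mem_cons] at h5 ⊢
        refine h5.resolve_left ?_
        rintro rfl
        have := h4 i hi
        rw [gram_self] at this
        norm_num at this
      · intro y z hy hz
        rw [hω y z hy.cons hz.cons, omega_cons_of_supported hsc hy hz]

variable (cs) in
theorem exists_isSorting_longest {c : List B} (hc : c.Nodup) :
    ∃ ω, cs.IsSorting c (cs.longest {i | i ∈ c}) ω := by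
  refine cs.exists_isSorting_of_mul_eq_longest (c₁ := c) (u := 1) _ le_rfl hc (fun i hi => hi) ?_
    (cs.longest_mem _) (one_mul _) ?_ ?_ ?_
  · intro i _ x; rw [geom_one]
  · intro β hβ; rw [geom_one]; exact hβ.1.2
  · intro y z _ _; rw [geom_one, geom_one]
  · intro β hβ; rw [inversionRoots_one] at hβ; exact hβ.elim

end Longest

end CoxeterSystem

/-! ### Recursive sortability in the monoid, and commuting letters. -/

namespace CoxeterMatrix

variable {B : Type*} (M : CoxeterMatrix B)

theorem eq_two_of_gram_eq_zero {i j : B} (h : M.gram i j = 0) : M i j = 2 := by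
  have hij : i ≠ j := by rintro rfl; rw [gram_self] at h; norm_num at h
  have h1 : M i j ≠ 1 := M.off_diagonal i j hij
  have hcos : Real.cos (Real.pi / M i j) = 0 := by
    rw [gram] at h; linarith
  by_contra h2
  rcases Nat.lt_or_ge (M i j) 2 with h3 | h3
  · have : M i j = 0 := by omega
    rw [this] at hcos
    norm_num at hcos
  · have h4 : (3 : ℝ) ≤ M i j := by exact_mod_cast (by omega : 3 ≤ M i j)
    have h5 : 0 < Real.pi / M i j := by positivity
    have h6 : Real.pi / M i j < Real.pi / 2 := by
      apply div_lt_div_of_pos_left Real.pi_pos <;> linarith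
    exact absurd hcos (Real.cos_pos_of_mem_Ioo ⟨by linarith, h6⟩).ne.symm

/-- `ω` is the `c`-sorting word of `w`, and `w` is `c`-sortable. -/
inductive IsArtinSorting : List B → M.ArtinMonoid → List B → Prop
  | nil : IsArtinSorting [] 1 []
  | take {s : B} {c : List B} {w : M.ArtinMonoid} {ω : List B} :
      IsArtinSorting (c ++ [s]) w ω →
      IsArtinSorting (s :: c) (PresentedMonoid.of M.BraidRel s * w) (s :: ω)
  | skip {s : B} {c : List B} {w : M.ArtinMonoid} {ω : List B} :
      ¬ PresentedMonoid.of M.BraidRel s ∣ w →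
      IsArtinSorting c w ω → IsArtinSorting (s :: c) w ω

/-- Sortability, in the recursive description by initial letters. -/
def IsArtinSortable (c : List B) (w : M.ArtinMonoid) : Prop := ∃ ω, M.IsArtinSorting c w ω

variable {M}

theorem IsArtinSorting.artinProd_eq {c ω : List B} {w : M.ArtinMonoid}
    (h : M.IsArtinSorting c w ω) : M.artinProd ω = w := by
  induction h with
  | nil => exact artinProd_nil M
  | take _ ih => rw [artinProd_cons, ih]
  | skip _ _ ih => exact ih

theorem IsArtinSorting.subset {c ω : List B} {w : M.ArtinMonoid} (h : M.IsArtinSorting c w ω) :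
    ∀ i ∈ ω, i ∈ c := by
  induction h with
  | nil => simp
  | take h ih =>
    intro i hi
    rcases List.mem_cons.1 hi with rfl | hi
    · simp
    · have := ih i hi
      simp only [List.mem_append, List.mem_singleton] at this
      simp only [List.mem_cons]; tauto
  | skip _ _ ih => exact fun i hi => List.mem_cons_of_mem _ (ih i hi)

theorem IsArtinSortable.artinAvoid_eq_one {c : List B} {w : M.ArtinMonoid}
    (h : M.IsArtinSortable c w) {i : B} (hi : i ∉ c) : M.artinAvoid i w = 1 := by
  obtain ⟨ω, h⟩ := h
  rw [← h.artinProd_eq, artinAvoid_artinProd]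
  exact fun h' => hi (h.subset i h')

theorem isArtinSortable_nil {w : M.ArtinMonoid} : M.IsArtinSortable [] w ↔ w = 1 := by
  constructor
  · rintro ⟨ω, h⟩
    cases h
    rfl
  · rintro rfl
    exact ⟨[], .nil⟩

theorem artinAvoid_ne_one_of_dvd {i : B} {w : M.ArtinMonoid}
    (h : PresentedMonoid.of M.BraidRel i ∣ w) : M.artinAvoid i w ≠ 1 := by
  obtain ⟨w', rfl⟩ := h
  rw [Ne, artinAvoid_mul, artinAvoid_of]
  simp

end CoxeterMatrix

namespace CoxeterSystem

open CoxeterMatrix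

variable {B : Type*} {M : CoxeterMatrix B} {W : Type*} [Group W] (cs : CoxeterSystem M W)

theorem IsSorting.isArtinSorting {c ω : List B} {v : W} (h : cs.IsSorting c v ω) :
    M.IsArtinSorting c (cs.toArtin v) ω := by
  induction h with
  | nil => rw [toArtin_one]; exact .nil
  | take hs _ ih => rw [cs.toArtin_simple_mul hs]; exact .take ih
  | skip hs _ ih => exact .skip (by rwa [of_dvd_toArtin]) ih

theorem isSorting_iff_isArtinSorting {c ω : List B} {v : W} :
    cs.IsSorting c v ω ↔ M.IsArtinSorting c (cs.toArtin v) ω := by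
  refine ⟨IsSorting.isArtinSorting cs, fun h => ?_⟩
  generalize hw : cs.toArtin v = w at h
  induction h generalizing v with
  | nil =>
    obtain rfl : v = 1 := cs.toArtin_injective (by rw [hw, toArtin_one])
    exact .nil
  | @take s c w ω _ ih =>
    have hd : cs.IsLeftDescent v s := cs.of_dvd_toArtin.1 (hw ▸ dvd_mul_right _ _)
    obtain ⟨y, rfl⟩ : ∃ y, v = cs.simple s * y :=
      ⟨cs.simple s * v, by rw [simple_mul_simple_cancel_left]⟩
    rw [isLeftDescent_iff_not_isLeftDescent_mul, simple_mul_simple_cancel_left] at hd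
    rw [cs.toArtin_simple_mul hd] at hw
    exact .take hd (ih (of_mul_left_cancel cs hw))
  | skip hs _ ih => exact .skip (by rwa [← hw, of_dvd_toArtin] at hs) (ih hw)

theorem isArtinSortable_cons {s : B} {c : List B} {w : M.ArtinMonoid}
    (h : ¬ PresentedMonoid.of M.BraidRel s ∣ w) :
    M.IsArtinSortable (s :: c) w ↔ M.IsArtinSortable c w := by
  constructor
  · rintro ⟨ω, hω⟩
    cases hω with
    | take _ => exact absurd (dvd_mul_right _ _) h
    | skip _ h' => exact ⟨_, h'⟩
  · rintro ⟨ω, hω⟩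
    exact ⟨ω, .skip h hω⟩

theorem isArtinSortable_cons_of_mul (cs : CoxeterSystem M W) {s : B} {c : List B}
    {w : M.ArtinMonoid} :
    M.IsArtinSortable (s :: c) (PresentedMonoid.of M.BraidRel s * w) ↔
      M.IsArtinSortable (c ++ [s]) w := by
  constructor
  · rintro ⟨ω, hω⟩
    generalize e : PresentedMonoid.of M.BraidRel s * w = w' at hω
    cases hω with
    | take h' =>
      rw [of_mul_left_cancel cs e]
      exact ⟨_, h'⟩
    | skip h _ => exact absurd (e ▸ dvd_mul_right _ _) h
  · rintro ⟨ω, hω⟩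
    exact ⟨_, .take hω⟩

/-- Taking or skipping one of two commuting letters does not affect whether the other divides. Taken
letters rotate to the end and meet there again, hence the arbitrary prefix `x` and the induction on
total size. -/
theorem IsArtinSortable.swap (cs : CoxeterSystem M W) {a b : B} (hab : M a b = 2) (n : ℕ)
    {x y ω : List B} {w : M.ArtinMonoid} (hn : ω.length + x.length + y.length ≤ n)
    (h : M.IsArtinSorting (x ++ a :: b :: y) w ω) : M.IsArtinSortable (x ++ b :: a :: y) w := by
  have hba : M b a = 2 := by rw [M.symmetric, hab]
  induction n generalizing x y w ω with
  | zero =>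
    obtain rfl : ω = [] := List.eq_nil_of_length_eq_zero (by omega)
    obtain rfl : x = [] := List.eq_nil_of_length_eq_zero (by omega)
    cases h with | skip h1 h => cases h with | skip h2 h => exact ⟨[], .skip h2 (.skip h1 h)⟩
  | succ n ih =>
    obtain _ | ⟨p, x⟩ := x
    · cases h with
      | @take _ _ w ω h =>
        cases h with
        | @take _ _ w ω h =>
          obtain ⟨ω', h'⟩ := ih (x := y) (y := []) (w := w) (ω := ω)
            (by simp only [List.length_cons, List.length_nil] at hn ⊢; omega) (by simpa using h)
          rw [← mul_assoc, of_commute hab, mul_assoc]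
          exact ⟨_, .take (.take (by simpa using h'))⟩
        | skip h1 h =>
          exact ⟨_, .skip (by rwa [of_dvd_of_of_dvd_mul cs hab]) (.take h)⟩
      | skip h1 h =>
        cases h with
        | take h =>
          rw [of_dvd_of_of_dvd_mul cs hba] at h1
          exact ⟨_, .take (.skip h1 h)⟩
        | skip h2 h => exact ⟨_, .skip h2 (.skip h1 h)⟩
    · cases h with
      | @take _ _ w ω h =>
        obtain ⟨ω', h'⟩ := ih (x := x) (y := y ++ [p]) (w := w) (ω := ω)
          (by simp at hn ⊢; omega) (by simpa using h)
        exact ⟨_, .take (by simpa using h')⟩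
      | skip hp h =>
        obtain ⟨ω', h'⟩ := ih (x := x) (y := y) (by simp at hn; omega) h
        exact ⟨_, .skip hp h'⟩

theorem isArtinSortable_swap_iff (cs : CoxeterSystem M W) {a b : B} (hab : M a b = 2)
    {x y : List B} {w : M.ArtinMonoid} :
    M.IsArtinSortable (x ++ a :: b :: y) w ↔ M.IsArtinSortable (x ++ b :: a :: y) w :=
  ⟨fun ⟨_, h⟩ => IsArtinSortable.swap cs hab _ le_rfl h,
    fun ⟨_, h⟩ => IsArtinSortable.swap cs (by rw [M.symmetric, hab]) _ le_rfl h⟩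

theorem isArtinSortable_move_iff (cs : CoxeterSystem M W) {i : B} {x y : List B}
    (h : ∀ j ∈ x, M j i = 2) {w : M.ArtinMonoid} :
    M.IsArtinSortable (x ++ i :: y) w ↔ M.IsArtinSortable (i :: x ++ y) w := by
  induction x using List.reverseRecOn generalizing y with
  | nil => rfl
  | append_singleton x j ih =>
    rw [List.append_assoc, List.singleton_append, isArtinSortable_swap_iff cs (h j (by simp)),
      ih fun k hk => h k (by simp [hk])]
    simp

end CoxeterSystem

/-! ### Restriction words in terms of the skew form. -/

namespace CoxeterSystem

open CoxeterMatrix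

variable {B : Type*} {M : CoxeterMatrix B} {W : Type*} [Group W] (cs : CoxeterSystem M W)

theorem eq_of_simple_eq (cs : CoxeterSystem M W) {i j : B} (h : cs.simple i = cs.simple j) :
    i = j := by
  by_contra hij
  have h1 := cs.geom_simple_root i
  rw [h, geom_simple, form_root_root] at h1
  have h2 := DFunLike.congr_fun h1 i
  simp only [Finsupp.coe_sub, Finsupp.coe_smul, Pi.sub_apply, Pi.smul_apply, Finsupp.coe_neg,
    Pi.neg_apply, root_apply_self, root_apply_ne (Ne.symm hij), smul_eq_mul] at h2
  norm_num at h2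

/-- A reflection determines its root up to a scalar, the norm leaves only the sign, and the given
signs are opposite. -/
theorem geom_root_eq_neg_of_conj_eq {g h : W} {i j : B}
    (e : g * cs.simple i * g⁻¹ = h * cs.simple j * h⁻¹) (hg : 0 ≤ cs.geom g (root i))
    (hh : cs.geom h (root j) ≤ 0) : cs.geom h (root j) = -cs.geom g (root i) := by
  have h1 := cs.geom_conj_simple g i (cs.geom g (root i))
  rw [e, geom_conj_simple, form_geom_root] at h1
  set x := cs.geom g (root i) with hx
  set y := cs.geom h (root j) with hy
  have hxx : M.form x x = 2 := cs.form_geom_root g i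
  have hyy : M.form y y = 2 := cs.form_geom_root h j
  set a := M.form y x with ha
  have h2 : (2 : ℝ) • x = a • y := sub_right_injective h1.symm
  have h3 : a * a = 4 := by
    have := congrArg (M.form y) h2
    rw [map_smul, map_smul, hyy, ← ha, smul_eq_mul, smul_eq_mul] at this
    have h4 := congrArg (M.form x) h2
    rw [map_smul, map_smul, hxx, M.form_comm, ← ha, smul_eq_mul, smul_eq_mul] at h4
    linarith
  rcases mul_self_eq_mul_self_iff.1 (show a * a = 2 * 2 by rw [h3]; norm_num) with h4 | h4
  · rw [h4] at h2
    have h5 : x = y := smul_right_injective _ (by norm_num : (2 : ℝ) ≠ 0) h2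
    rw [h5] at hg
    exact absurd (le_antisymm hh hg) (cs.geom_root_ne_zero h j)
  · rw [h4, neg_smul, ← smul_neg] at h2
    rw [smul_right_injective _ (by norm_num : (2 : ℝ) ≠ 0) h2, neg_neg]

/-- The letters of `d` are the right descents of `v`, in an order compatible with the
skew-symmetric form of `c`. -/
structure IsRestrictionWord (c : List B) (v : W) (d : List B) : Prop where
  nodup : d.Nodup
  mem_iff : ∀ i, i ∈ d ↔ cs.IsRightDescent v i
  pairwise : d.Pairwise fun i j =>
    M.gram i j = 0 ∨ 0 < M.omega c (cs.geom v (root i)) (cs.geom v (root j))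

section Restriction

variable [Finite W]

/-- Filter the reflection sequence by the cover reflections of `v`. None is missing, because the
longest element inverts every positive root supported in `c`. -/
theorem exists_sublist_leftInvSeq {c ω : List B}
    (hω : cs.IsSorting c (cs.longest {i | i ∈ c}) ω) {v : W} (hv : v ∈ cs.parabolic {i | i ∈ c}) :
    ∃ d : List B, d.Nodup ∧ (∀ i, i ∈ d ↔ cs.IsRightDescent v i) ∧
      (d.map fun i => v * cs.simple i * v⁻¹).Sublist (cs.leftInvSeq ω) := by
  classical
  set f : B → W := fun i => v * cs.simple i * v⁻¹ with hf
  have hfi : Function.Injective f := fun i j h => by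
    apply cs.eq_of_simple_eq
    simpa [hf] using h
  set L := (cs.leftInvSeq ω).filter fun t => ∃ i, cs.IsRightDescent v i ∧ f i = t with hL
  have hmem : ∀ t ∈ L, ∃ i, cs.IsRightDescent v i ∧ f i = t := fun t ht => by
    simpa using (List.mem_filter.1 ht).2
  have hsub : L.Sublist (cs.leftInvSeq ω) := List.filter_sublist
  obtain ⟨d, hd, hd'⟩ : ∃ d : List B, d.map f = L ∧ ∀ i ∈ d, cs.IsRightDescent v i := by
    clear_value L
    clear hsub hL
    induction L with
    | nil => exact ⟨[], rfl, by simp⟩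
    | cons t L ih =>
      obtain ⟨d, h1, h2⟩ := ih fun t ht => hmem t (by simp [ht])
      obtain ⟨i, h3, h4⟩ := hmem t (by simp)
      exact ⟨i :: d, by simp [h1, h4], by simpa using ⟨h3, h2⟩⟩
  refine ⟨d, ?_, fun i => ⟨hd' i, fun hi => ?_⟩, hd ▸ hsub⟩
  · refine List.Nodup.of_map f ?_
    rw [hd]
    exact hsub.nodup hω.isReduced.nodup_leftInvSeq
  · rw [← List.mem_map_of_injective hfi, hd, hL, List.mem_filter]
    refine ⟨?_, by simpa using ⟨i, hi, rfl⟩⟩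
    have hn := cs.neg_geom_root_mem hi
    have hs := (cs.isSupportedIn_of_mem_parabolic hv).vec_of_mem hn
    have h1 := cs.geom_longest_inv_nonpos hn.1.2 hs
    have e : v * cs.simple i * v⁻¹ = (v * cs.simple i) * cs.simple i * (v * cs.simple i)⁻¹ := by
      simp [mul_assoc]
    have e2 : cs.geom (v * cs.simple i) (root i) = -cs.geom v (root i) := by
      rw [geom_mul, geom_simple_root, map_neg]
    change v * cs.simple i * v⁻¹ ∈ _
    rw [e]
    apply conj_mem_leftInvSeq
    · rw [e2]; exact hn.1.2
    · rw [e2, hω.wordProd_eq]; exact h1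

theorem isRestrictionWord_of_sublist {c ω d : List B} (hc : c.Nodup)
    (hω : cs.IsSorting c (cs.longest {i | i ∈ c}) ω) {v : W}
    (hd : d.Nodup) (hmem : ∀ i, i ∈ d ↔ cs.IsRightDescent v i)
    (hsub : (d.map fun i => v * cs.simple i * v⁻¹).Sublist (cs.leftInvSeq ω)) :
    cs.IsRestrictionWord c v d := by
  refine ⟨hd, hmem, ?_⟩
  rw [leftInvSeq_eq, List.sublist_map_iff] at hsub
  obtain ⟨l, hl, e⟩ := hsub
  have h1 := (hω.pairwise hc).sublist hl
  have hpos : ∀ p ∈ l, 0 ≤ cs.geom p.1 (root p.2) := fun p hp =>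
    (cs.geom_mem_of_mem_letterSeq hω.isReduced (hl.subset hp)).1.2
  have h2 : (l.map fun p => p.1 * cs.simple p.2 * p.1⁻¹).Pairwise fun t t' =>
      ∀ i j, cs.IsRightDescent v i → cs.IsRightDescent v j → v * cs.simple i * v⁻¹ = t →
        v * cs.simple j * v⁻¹ = t' →
        M.gram i j = 0 ∨ 0 < M.omega c (cs.geom v (root i)) (cs.geom v (root j)) := by
    rw [List.pairwise_map]
    refine h1.imp_of_mem fun {p q} hp hq hpq i j hi hj hip hjq => ?_
    have ei := cs.geom_root_eq_neg_of_conj_eq hip.symm (hpos p hp) (cs.isRightDescent_iff_geom.1 hi)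
    have ej := cs.geom_root_eq_neg_of_conj_eq hjq.symm (hpos q hq) (cs.isRightDescent_iff_geom.1 hj)
    rw [← form_root_root, ← cs.form_geom v, ei, ej]
    simpa using hpq
  rw [← e, List.pairwise_map] at h2
  exact h2.imp_of_mem fun {i j} hi hj h => h i j ((hmem i).1 hi) ((hmem j).1 hj) rfl rfl

theorem exists_isRestrictionWord {c : List B} (hc : c.Nodup) {v : W}
    (hv : v ∈ cs.parabolic {i | i ∈ c}) : ∃ d, cs.IsRestrictionWord c v d := by
  obtain ⟨ω, hω⟩ := cs.exists_isSorting_longest hc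
  obtain ⟨d, h1, h2, h3⟩ := cs.exists_sublist_leftInvSeq hω hv
  exact ⟨d, cs.isRestrictionWord_of_sublist hc hω h1 h2 h3⟩

end Restriction

theorem head_mem_parabolic {c : List B} {w : M.ArtinMonoid}
    (h : ∀ i, i ∉ c → M.artinAvoid i w = 1) : cs.head w ∈ cs.parabolic {i | i ∈ c} := by
  obtain ⟨ω, h1, h2⟩ := cs.exists_isReduced (cs.head w)
  rw [h2]
  refine cs.wordProd_mem_parabolic fun i hi => ?_
  by_contra hc
  have h3 := h i hc
  rw [← cs.toArtin_head_mul_rest w, artinAvoid_mul, h2, cs.toArtin_wordProd h1,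
    artinAvoid_artinProd] at h3
  exact h3.1 hi

variable {cs}

theorem IsRestrictionWord.omega_eq {s : B} {c d : List B} {v : W} (hs : s ∉ c)
    (hv : cs.IsSupportedIn c v) (h : cs.IsRestrictionWord (s :: c) v d) :
    cs.IsRestrictionWord c v d := by
  refine ⟨h.nodup, h.mem_iff, h.pairwise.imp_of_mem fun {i j} hi hj hij => ?_⟩
  have hi' := hv.vec_iff.2 (vecSupportedIn_root (hv.mem_of_isRightDescent ((h.mem_iff i).1 hi)))
  have hj' := hv.vec_iff.2 (vecSupportedIn_root (hv.mem_of_isRightDescent ((h.mem_iff j).1 hj)))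
  rwa [omega_cons_of_supported hs hi' hj'] at hij

/-- Reflecting in `s` changes the sign of no root except plus or minus the root of `s`. -/
theorem isRightDescent_of_simple_mul {s i : B} {y : W} (hs : ¬ cs.IsLeftDescent y s) :
    cs.IsRightDescent y i ↔ cs.IsRightDescent (cs.simple s * y) i ∧
      cs.geom (cs.simple s * y) (root i) ≠ -root s := by
  constructor
  · intro hi
    have h1 := cs.neg_geom_root_mem hi
    constructor
    · rw [isRightDescent_iff_geom, geom_mul]
      have h2 := (cs.geom_mem_inversionRoots_mul hs h1).1.2
      rwa [map_neg, neg_nonneg] at h2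
    · rw [geom_mul]
      intro e
      refine geom_ne_root_of_nonneg (cs := cs) (s := s) h1.1.2 ?_
      rw [map_neg, e, neg_neg]
  · rintro ⟨hi, hne⟩
    by_contra hcon
    rw [not_isRightDescent_iff_geom] at hcon
    have hp : cs.IsPosRoot (cs.geom y (root i)) := ⟨⟨_, _, rfl⟩, hcon⟩
    rw [geom_mul] at hne
    have h1 : cs.geom y (root i) ≠ root s := fun e => hne (by rw [e, geom_simple_root])
    rw [isRightDescent_iff_geom, geom_mul] at hi
    exact (hp.geom_simple h1).not_nonpos hi

theorem IsRestrictionWord.of_simple_mul {s : B} {c d d' : List B} {y : W} (hc : (s :: c).Nodup)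
    (hv : cs.IsSupportedIn (s :: c) (cs.simple s * y)) (hs : ¬ cs.IsLeftDescent y s)
    (h : cs.IsRestrictionWord (s :: c) (cs.simple s * y) d) (hsub : d'.Sublist d)
    (hd' : ∀ i, i ∈ d' ↔ i ∈ d ∧ cs.geom (cs.simple s * y) (root i) ≠ -root s) :
    cs.IsRestrictionWord (c ++ [s]) y d' := by
  refine ⟨hsub.nodup h.nodup, fun i => ?_, ?_⟩
  · rw [hd', h.mem_iff, isRightDescent_of_simple_mul hs]
  · refine (h.pairwise.sublist hsub).imp_of_mem fun {i j} hi hj hij => ?_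
    have key : ∀ k ∈ d', VecSupportedIn (s :: c) (cs.geom (cs.simple s * y) (root k)) :=
      fun k hk => hv.vec_iff.2 (vecSupportedIn_root
        (hv.mem_of_isRightDescent ((h.mem_iff k).1 ((hd' k).1 hk).1)))
    rw [← cs.omega_rotate hc (key i hi) (key j hj), geom_mul, geom_mul, geom_simple_geom_simple,
      geom_simple_geom_simple] at hij
    exact hij

/-- The letter of `d` that corresponds to an initial letter of `c` can be moved to the front. -/
theorem IsRestrictionWord.exists_split {s i : B} {c d : List B} {v : W} (hs : s ∉ c)
    (h : cs.IsRestrictionWord (s :: c) v d) (hi : cs.geom v (root i) = -root s) :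
    ∃ d₁ d₂, d = d₁ ++ i :: d₂ ∧ ∀ j ∈ d₁, M j i = 2 := by
  have hid : i ∈ d := by
    rw [h.mem_iff, isRightDescent_iff_geom, hi]; exact neg_nonpos.2 (root_nonneg s)
  obtain ⟨d₁, d₂, rfl⟩ := List.append_of_mem hid
  refine ⟨d₁, d₂, rfl, fun j hj => eq_two_of_gram_eq_zero M ?_⟩
  -- The root of an initial letter cannot strictly follow any positive root, so letters in front of
  -- `i` are orthogonal to it.
  refine ((List.pairwise_append.1 h.pairwise).2.2 j hj i (by simp)).resolve_right fun hlt => ?_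
  have h1 := cs.neg_geom_root_mem ((h.mem_iff j).1 (by simp [hj]))
  have h2 := h1.1.omega_root_left_nonneg hs
  rw [hi, omega_neg_symm] at hlt
  simp only [map_neg, LinearMap.neg_apply] at hlt h2
  linarith

/-- By `IsSorting.apply_eq_zero` the other cover roots have no `s`-coordinate, so moving `s` does
not change their pairings. The letter `i` goes last because `s` is now final. -/
theorem IsRestrictionWord.rotate {s i : B} {c d₁ d₂ ω : List B} {v : W} (hc : (s :: c).Nodup)
    (h : cs.IsRestrictionWord (s :: c) v (d₁ ++ i :: d₂)) (hi : cs.geom v (root i) = -root s)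
    (hω : cs.IsSorting (c ++ [s]) v ω) :
    cs.IsRestrictionWord (c ++ [s]) v (d₁ ++ d₂ ++ [i]) := by
  have hnd : (i :: (d₁ ++ d₂)).Nodup := List.nodup_middle.1 h.nodup
  have hmem : ∀ j, j ∈ d₁ ++ d₂ ++ [i] ↔ j ∈ d₁ ++ i :: d₂ := fun j => by
    simp only [List.mem_append, List.mem_cons, List.not_mem_nil]; tauto
  have hrd : ∀ j ∈ d₁ ++ d₂, cs.IsRightDescent v j ∧ j ≠ i := fun j hj => by
    refine ⟨(h.mem_iff j).1 ((hmem j).1 (by simp only [List.mem_append] at hj ⊢; tauto)), ?_⟩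
    rintro rfl
    exact (List.nodup_cons.1 hnd).1 hj
  have hsupp := hω.isSupportedIn
  refine ⟨nodup_rotate hnd, fun j => by rw [hmem, h.mem_iff], ?_⟩
  rw [List.pairwise_append]
  refine ⟨?_, by simp, ?_⟩
  · have h1 : (d₁ ++ d₂).Sublist (d₁ ++ i :: d₂) :=
      List.Sublist.append_left (List.sublist_cons_self _ _) _
    refine (h.pairwise.sublist h1).imp_of_mem fun {j k} hj hk hjk => ?_
    rwa [omega_append_of_supported (hω.apply_eq_zero hc hi (hrd j hj).1 (hrd j hj).2)
      (hω.apply_eq_zero hc hi (hrd k hk).1 (hrd k hk).2)]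
  · intro j hj k hk
    obtain rfl := List.mem_singleton.1 hk
    have h1 := cs.neg_geom_root_mem (hrd j hj).1
    have hne : -cs.geom v (root j) ≠ root s := by
      intro e
      rw [neg_eq_iff_eq_neg, ← hi] at e
      have e2 := DFunLike.congr_fun ((cs.geom v).injective e) j
      rw [root_apply_self, root_apply_ne (Ne.symm (hrd j hj).2)] at e2
      norm_num at e2
    have h2 := h1.1.omega_root_right_pos hc hne (vecSupportedIn_rotate.1 (hsupp.vec_of_mem h1))
    rw [← form_root_root, ← cs.form_geom v, hi, M.form_comm]
    simpa using h2

end CoxeterSystem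

/-! ### Peeling off the first Garside factor. -/

namespace CoxeterSystem

open CoxeterMatrix

variable {B : Type*} {M : CoxeterMatrix B} {W : Type*} [Group W] (cs : CoxeterSystem M W)

theorem toArtin_mul_simple {u : W} {i : B} (h : ¬ cs.IsRightDescent u i) :
    cs.toArtin (u * cs.simple i) = cs.toArtin u * PresentedMonoid.of M.BraidRel i := by
  rw [← cs.toArtin_simple, cs.toArtin_mul]
  rw [length_simple]
  exact cs.not_isRightDescent_iff.1 h

theorem toArtin_inv_mul {u v : W} {i : B} (h : ¬ cs.IsRightDescent u i)
    (hp : cs.IsPrefix (u * cs.simple i) v) :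
    cs.toArtin (u⁻¹ * v) =
      PresentedMonoid.of M.BraidRel i * cs.toArtin ((u * cs.simple i)⁻¹ * v) := by
  apply cs.toArtin_mul_left_cancel (u := u)
  rw [← ((cs.isPrefix_mul_simple h).trans hp).toArtin, hp.toArtin, cs.toArtin_mul_simple h,
    mul_assoc]

theorem isSupportedIn_of_isArtinSortable {c : List B} {v : W}
    (h : M.IsArtinSortable c (cs.toArtin v)) : cs.IsSupportedIn c v := by
  obtain ⟨ω, h⟩ := h
  exact (cs.isSorting_iff_isArtinSorting.2 h).isSupportedIn

theorem artinAvoid_eq_one_of_head {c d : List B} {w : M.ArtinMonoid}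
    (hd : cs.IsRestrictionWord c (cs.head w) d)
    (h : M.IsArtinSortable c (cs.toArtin (cs.head w)) ∧ M.IsArtinSortable d (cs.rest w)) (i : B)
    (hi : i ∉ c) : M.artinAvoid i w = 1 := by
  rw [← cs.toArtin_head_mul_rest w, artinAvoid_mul]
  refine ⟨h.1.artinAvoid_eq_one hi, h.2.artinAvoid_eq_one fun hid => hi ?_⟩
  exact (cs.isSupportedIn_of_isArtinSortable h.1).mem_of_isRightDescent ((hd.mem_iff i).1 hid)

theorem toAdd_artinLength_of_mul (s : B) (w : M.ArtinMonoid) :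
    (M.artinLength (PresentedMonoid.of M.BraidRel s * w)).toAdd = (M.artinLength w).toAdd + 1 := by
  have := M.artinLength_artinProd [s]
  rw [artinProd_cons, artinProd_nil, mul_one] at this
  rw [map_mul, this, toAdd_mul, add_comm]
  rfl

theorem isArtinSortable_nil_iff_head_rest {d : List B} {w : M.ArtinMonoid}
    (hd : cs.IsRestrictionWord [] (cs.head w) d) : M.IsArtinSortable [] w ↔
      M.IsArtinSortable [] (cs.toArtin (cs.head w)) ∧ M.IsArtinSortable d (cs.rest w) := by
  by_cases hav : ∀ i, i ∉ [] → M.artinAvoid i w = 1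
  · have hw : w = 1 := by
      obtain ⟨ω, rfl⟩ := M.artinProd_surjective w
      obtain rfl : ω = [] := List.eq_nil_iff_forall_not_mem.2 fun i =>
        M.artinAvoid_artinProd.1 (hav i (by simp))
      exact M.artinProd_nil
    subst hw
    obtain rfl : d = [] := List.eq_nil_iff_forall_not_mem.2 fun i hi => by
      have := (hd.mem_iff i).1 hi
      rw [head_one] at this
      simp [IsRightDescent] at this
    rw [head_one, rest_one, toArtin_one, isArtinSortable_nil]
    simp
  · exact iff_of_false (fun h => hav fun i hi => h.artinAvoid_eq_one hi)
      fun h => hav (cs.artinAvoid_eq_one_of_head hd h)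

/-- Otherwise the head could be lengthened by `i` and would not be the greatest simple left divisor.
-/
theorem not_dvd_rest {i : B} {w : M.ArtinMonoid} (hi : ¬ cs.IsRightDescent (cs.head w) i) :
    ¬ PresentedMonoid.of M.BraidRel i ∣ cs.rest w := by
  rintro ⟨r, hr⟩
  have h1 : cs.toArtin (cs.head w * cs.simple i) ∣ w := by
    refine ⟨r, ?_⟩
    rw [cs.toArtin_mul_simple hi, mul_assoc, ← hr, toArtin_head_mul_rest]
  have h2 := (cs.toArtin_dvd_iff.1 h1).length_le
  rw [cs.not_isRightDescent_iff.1 hi] at h2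
  omega

/-- For a final letter `s` the root of `s` is the last inversion of `v`. Removing it gives a
sortable lower cover `s v` without the descent `s`; this is a prefix of `y`, and `y ≠ v` leaves no
room for a proper one. -/
theorem exists_isSorting_of_dvd [Finite W] {s : B} {c ω : List B} {y v : W} (hc : (s :: c).Nodup)
    (hy : cs.IsPrefix y v) (hyv : y ≠ v) (hsv : cs.IsLeftDescent v s)
    (hmax : ∀ x, cs.IsPrefix x v → ¬ cs.IsLeftDescent x s → cs.IsPrefix x y)
    (h : cs.IsSorting (c ++ [s]) v ω) :
    cs.simple s * y = v ∧ ∃ ω', cs.IsSorting (c ++ [s]) y ω' := by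
  obtain ⟨i, ω', h1, h2⟩ := h.exists_remove_inversion (nodup_rotate hc)
    (cs.root_mem_inversionRoots.2 hsv) fun β hβ => by
      rw [omega_neg_symm]
      have := hβ.1.omega_root_right_nonneg (List.nodup_cons.1 hc).1
      linarith
  have hi : cs.IsRightDescent v i := by
    rw [isRightDescent_iff_geom, h1]; exact neg_nonpos.2 (root_nonneg s)
  have h3 := cs.mul_simple_eq_simple_mul (Or.inr h1)
  have h4 : ¬ cs.IsLeftDescent (v * cs.simple i) s := by
    rw [h3]; exact cs.isLeftDescent_iff_not_isLeftDescent_mul.1 hsv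
  have h5 := hmax _ (cs.mul_simple_isPrefix hi) h4
  have h6 : v * cs.simple i = y := by
    refine h5.eq_of_length_le ?_
    have h7 := cs.isRightDescent_iff.1 hi
    have h8 : cs.length y ≠ cs.length v := fun e => hyv (hy.eq_of_length_le e.ge)
    have := hy.length_le
    omega
  rw [← h6]
  exact ⟨by rw [h3, simple_mul_simple_cancel_left], ω', h2⟩

theorem exists_isSorting_mul_simple {s i : B} {c ω : List B} {y : W} (hc : (s :: c).Nodup)
    (h : cs.IsSorting (c ++ [s]) y ω) (hi : cs.geom y (root i) = root s) :
    ∃ ω', cs.IsSorting (c ++ [s]) (y * cs.simple i) ω' := by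
  obtain ⟨C, -, -, hC, -⟩ := h.exists_cover_list (nodup_rotate hc)
  refine (hC i ?_ ?_ fun β hβ => ?_).2
  · rw [hi]; exact root_nonneg s
  · rw [hi]; exact vecSupportedIn_root (by simp)
  · rw [hi]; exact hβ.1.omega_root_right_nonneg (List.nodup_cons.1 hc).1

/-- An element is `c`-sortable if and only if its first Garside factor is, and the remaining
factor is sortable for the restriction of `c`. -/
theorem isArtinSortable_iff_head_rest [Finite W] (n : ℕ) {c d : List B} {w : M.ArtinMonoid}
    (hn : (M.artinLength w).toAdd + c.length ≤ n) (hc : c.Nodup)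
    (hd : cs.IsRestrictionWord c (cs.head w) d) : M.IsArtinSortable c w ↔
      M.IsArtinSortable c (cs.toArtin (cs.head w)) ∧ M.IsArtinSortable d (cs.rest w) := by
  induction n generalizing c d w with
  | zero =>
    obtain rfl : c = [] := List.eq_nil_of_length_eq_zero (by omega)
    exact cs.isArtinSortable_nil_iff_head_rest hd
  | succ n ih =>
    obtain _ | ⟨s, c⟩ := c
    · exact cs.isArtinSortable_nil_iff_head_rest hd
    obtain ⟨hsc, hc0⟩ := List.nodup_cons.1 hc
    rw [List.length_cons] at hn
    by_cases hsw : PresentedMonoid.of M.BraidRel s ∣ w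
    swap
    · have hsh : ¬ PresentedMonoid.of M.BraidRel s ∣ cs.toArtin (cs.head w) := by
        rwa [of_dvd_toArtin, ← of_dvd_iff]
      rw [isArtinSortable_cons hsw, isArtinSortable_cons hsh]
      by_cases hsupp : cs.IsSupportedIn c (cs.head w)
      · exact ih (by omega) hc0 (hd.omega_eq hsc hsupp)
      · refine iff_of_false (fun h => hsupp ?_)
          fun h => hsupp (cs.isSupportedIn_of_isArtinSortable h.1)
        exact cs.isSupportedIn_of_mem_parabolic
          (cs.head_mem_parabolic fun i hi => h.artinAvoid_eq_one hi)
    by_cases hav : ∀ i, i ∉ s :: c → M.artinAvoid i w = 1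
    swap
    · exact iff_of_false (fun h => hav fun i hi => h.artinAvoid_eq_one hi)
        fun h => hav (cs.artinAvoid_eq_one_of_head hd h)
    have hsupp := cs.isSupportedIn_of_mem_parabolic (cs.head_mem_parabolic hav)
    obtain ⟨w, rfl⟩ := hsw
    have hn' : (M.artinLength w).toAdd + (c ++ [s]).length ≤ n := by
      rw [toAdd_artinLength_of_mul] at hn
      rw [List.length_append, List.length_singleton]
      omega
    have hav' : ∀ i, i ∉ c ++ [s] → M.artinAvoid i w = 1 := fun i hi =>
      (M.artinAvoid_mul.1 (hav i (by simpa [or_comm] using hi))).2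
    have ehead := cs.head_toArtin_mul (cs.simple s) w
    have erest := cs.rest_toArtin_mul (cs.simple s) w
    have hlen := cs.length_mul_maxPrefix (cs.simple s) (cs.head w)
    have hy := cs.maxPrefix_isPrefix (cs.simple s) (cs.head w)
    have hmax : ∀ x, cs.IsPrefix x (cs.head w) → ¬ cs.IsLeftDescent x s →
        cs.IsPrefix x (cs.maxPrefix (cs.simple s) (cs.head w)) := fun x hx hxs =>
      cs.isPrefix_maxPrefix hx (by rw [length_simple, cs.not_isLeftDescent_iff.1 hxs, add_comm])
    rw [toArtin_simple] at ehead erest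
    rw [length_simple, add_comm, ← cs.not_isLeftDescent_iff] at hlen
    set y := cs.maxPrefix (cs.simple s) (cs.head w)
    rw [ehead] at hd hsupp
    rw [ehead, erest, cs.toArtin_simple_mul hlen, isArtinSortable_cons_of_mul cs,
      isArtinSortable_cons_of_mul cs]
    -- The question is whether `s` can be put in front of the entire head of `w`. If so, the
    -- remainder is unchanged; if not, a part of that head passes into the remainder.
    by_cases hyv : y = cs.head w
    · rw [hyv, inv_mul_cancel, toArtin_one, one_mul]
      rw [hyv] at hd hsupp hlen
      by_cases hi : ∃ i, cs.geom (cs.simple s * cs.head w) (root i) = -root s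
      · obtain ⟨i, hi⟩ := hi
        obtain ⟨d₁, d₂, rfl, hcomm⟩ := hd.exists_split hsc hi
        have hnd := List.nodup_cons.1 (List.nodup_middle.1 hd.nodup)
        -- The descent `i` came from `s` and is not a descent of the head of `w`. It therefore
        -- cannot divide the remainder, and it is skipped at the front of the restricted word.
        rw [isArtinSortable_move_iff cs hcomm, List.cons_append, isArtinSortable_cons
          (cs.not_dvd_rest fun h => ((isRightDescent_of_simple_mul hlen).1 h).2 hi)]
        refine ih hn' (nodup_rotate hc) (hd.of_simple_mul hc hsupp hlen
          (List.Sublist.append_left (List.sublist_cons_self _ _) _) fun j => ?_)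
        constructor
        · intro hj
          refine ⟨by simp only [List.mem_append, List.mem_cons] at hj ⊢; tauto, fun e => ?_⟩
          rw [← hi] at e
          have e2 := DFunLike.congr_fun ((cs.geom _).injective e) i
          have hij : j ≠ i := by rintro rfl; exact hnd.1 hj
          rw [root_apply_self, root_apply_ne hij] at e2
          norm_num at e2
        · rintro ⟨hj, hne⟩
          have hij : j ≠ i := by rintro rfl; exact hne hi
          simp only [List.mem_append, List.mem_cons] at hj ⊢
          tauto
      · exact ih hn' (nodup_rotate hc) (hd.of_simple_mul hc hsupp hlen (List.Sublist.refl _)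
          fun j => ⟨fun hj => ⟨hj, fun e => hi ⟨j, e⟩⟩, fun hj => hj.1⟩)
    · obtain ⟨i, hiy, hpre⟩ := cs.exists_mul_simple_isPrefix hy hyv
      have hlt := cs.not_isRightDescent_iff.1 hiy
      -- By maximality of `y`, the next letter creates the left descent `s`; this yields `y s_i = s
      -- y`.
      have hld : cs.IsLeftDescent (y * cs.simple i) s := by
        by_contra hcon
        have := (hmax _ hpre hcon).length_le
        omega
      have hyi := cs.eq_root_of_isLeftDescent_mul_simple hlen hld
      have hvi : cs.geom (cs.simple s * y) (root i) = -root s := by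
        rw [geom_mul, hyi, geom_simple_root]
      have hyv' := cs.mul_simple_eq_simple_mul (Or.inl hyi)
      obtain ⟨d₁, d₂, rfl, hcomm⟩ := hd.exists_split hsc hvi
      have hr := cs.toArtin_inv_mul hiy hpre
      rw [hyv'] at hr hpre hld
      rw [hr, mul_assoc, isArtinSortable_move_iff cs hcomm, List.cons_append,
        isArtinSortable_cons_of_mul cs]
      -- Once `s y` is the whole head and sortable, the induction hypothesis reduces sortability of
      -- `w` to that of its remainder for the rotated restriction.
      have key : ∀ ω, cs.simple s * y = cs.head w → cs.IsSorting (c ++ [s]) (cs.simple s * y) ω →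
          (M.IsArtinSortable (c ++ [s]) w ↔
            M.IsArtinSortable (d₁ ++ d₂ ++ [i]) (cs.toArtin ((cs.simple s * y)⁻¹ * cs.head w) *
              cs.rest w)) := by
        intro ω e hω
        have h1 := ih hn' (nodup_rotate hc) (e ▸ hd.rotate hc hvi hω)
        rw [← e, inv_mul_cancel, toArtin_one, one_mul]
        rw [← e] at h1
        rw [h1]
        exact and_iff_right ⟨ω, hω.isArtinSorting⟩
      constructor
      · intro h
        obtain ⟨d', hd'⟩ := cs.exists_isRestrictionWord (nodup_rotate hc)
          (cs.head_mem_parabolic hav')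
        obtain ⟨⟨ω, hω⟩, -⟩ := (ih hn' (nodup_rotate hc) hd').1 h
        rw [← isSorting_iff_isArtinSorting] at hω
        obtain ⟨e, ω', h1⟩ := cs.exists_isSorting_of_dvd hc hy hyv
          (cs.isPrefix_simple_iff.1 ((cs.isPrefix_simple_iff.2 hld).trans hpre)) hmax hω
        exact ⟨⟨ω', h1.isArtinSorting⟩, (key ω e (e ▸ hω)).1 h⟩
      · rintro ⟨⟨ω, hω⟩, h⟩
        rw [← isSorting_iff_isArtinSorting] at hω
        obtain ⟨ω', h1⟩ := cs.exists_isSorting_mul_simple hc hω hyi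
        rw [hyv'] at h1
        refine (key ω' ?_ h1).2 h
        -- If `s y` were a proper prefix of the head, the remainder would begin with a letter that
        -- is not a descent of `s y`, hence not in the restricted word.
        by_contra hne
        obtain ⟨j, hj, hj'⟩ := cs.exists_mul_simple_isPrefix hpre hne
        rw [cs.toArtin_inv_mul hj hj', mul_assoc] at h
        refine artinAvoid_ne_one_of_dvd (dvd_mul_right _ _) (h.artinAvoid_eq_one (i := j) ?_)
        rw [← hd.mem_iff] at hj
        simp only [List.mem_append, List.mem_cons, List.not_mem_nil] at hj ⊢
        tauto

end CoxeterSystem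

/-! ### Sorting with a word that is only rotated. -/

namespace CoxeterMatrix

variable {B : Type*} (M : CoxeterMatrix B)

/-- A variant of `IsArtinSorting` in which the word `c` is only rotated: a letter that is skipped
must not be used later. -/
inductive IsCyclicSorting : List B → M.ArtinMonoid → List B → Prop
  | nil {c : List B} : IsCyclicSorting c 1 []
  | take {s : B} {c : List B} {w : M.ArtinMonoid} {ω : List B} :
      IsCyclicSorting (c ++ [s]) w ω →
      IsCyclicSorting (s :: c) (PresentedMonoid.of M.BraidRel s * w) (s :: ω)
  | skip {s : B} {c : List B} {w : M.ArtinMonoid} {ω : List B} :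
      s ∉ ω → IsCyclicSorting (c ++ [s]) w ω → IsCyclicSorting (s :: c) w ω

variable {M}

theorem IsCyclicSorting.artinProd_eq {c ω : List B} {w : M.ArtinMonoid}
    (h : M.IsCyclicSorting c w ω) : M.artinProd ω = w := by
  induction h with
  | nil => exact artinProd_nil M
  | take _ ih => rw [artinProd_cons, ih]
  | skip _ _ ih => exact ih

theorem IsCyclicSorting.insert {x y ω : List B} {w : M.ArtinMonoid} {s : B}
    (h : M.IsCyclicSorting (x ++ y) w ω) (hs : s ∉ ω) : M.IsCyclicSorting (x ++ s :: y) w ω := by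
  -- An inserted letter at the very front is skipped and goes to the end, so the induction may
  -- assume that a letter of the old word precedes it, unless that word is empty.
  suffices key : ∀ {x y : List B}, M.IsCyclicSorting (x ++ y) w ω → (x = [] → y = []) →
      M.IsCyclicSorting (x ++ s :: y) w ω by
    obtain _ | ⟨a, x⟩ := x
    · exact .skip hs (key (x := y) (y := []) (by simpa using h) fun _ => rfl)
    · exact key h (by simp)
  clear h
  intro x y h hxy
  generalize hc : x ++ y = c at h
  induction h generalizing x y with
  | nil => exact .nil
  | @take a c w ω h ih =>
    obtain _ | ⟨b, x⟩ := x
    · simp [hxy rfl] at hc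
    · rw [List.cons_append] at hc
      obtain ⟨rfl, rfl⟩ := List.cons.inj hc
      refine .take ?_
      have hs' : s ∉ ω := fun h => hs (by simp [h])
      obtain _ | ⟨d, x⟩ := x
      · change M.IsCyclicSorting (s :: (y ++ [b])) w ω
        refine .skip hs' ?_
        have := ih hs' (x := y ++ [b]) (y := []) (by simp) (by simp)
        simpa using this
      · have := ih hs' (x := d :: x) (y := y ++ [b]) (by simp) (by simp)
        simpa using this
  | @skip a c w ω ha h ih =>
    obtain _ | ⟨b, x⟩ := x
    · simp [hxy rfl] at hc
    · rw [List.cons_append] at hc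
      obtain ⟨rfl, rfl⟩ := List.cons.inj hc
      refine .skip ha ?_
      obtain _ | ⟨d, x⟩ := x
      · change M.IsCyclicSorting (s :: (y ++ [b])) w ω
        refine .skip hs ?_
        have := ih hs (x := y ++ [b]) (y := []) (by simp) (by simp)
        simpa using this
      · have := ih hs (x := d :: x) (y := y ++ [b]) (by simp) (by simp)
        simpa using this

theorem IsArtinSorting.remove {x y ω : List B} {w : M.ArtinMonoid} {s : B}
    (h : M.IsArtinSorting (x ++ s :: y) w ω) (hs : s ∉ ω) : M.IsArtinSorting (x ++ y) w ω := by
  generalize hc : x ++ s :: y = c at h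
  induction h generalizing x y with
  | nil => simp at hc
  | @take a c w ω h ih =>
    obtain _ | ⟨b, x⟩ := x
    · rw [List.nil_append] at hc
      obtain ⟨rfl, rfl⟩ := List.cons.inj hc
      simp at hs
    · rw [List.cons_append] at hc
      obtain ⟨rfl, rfl⟩ := List.cons.inj hc
      refine .take ?_
      have := ih (x := x) (y := y ++ [b]) (fun h => hs (by simp [h])) (by simp)
      simpa using this
  | @skip a c w ω ha h ih =>
    obtain _ | ⟨b, x⟩ := x
    · rw [List.nil_append] at hc
      obtain ⟨rfl, rfl⟩ := List.cons.inj hc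
      exact h
    · rw [List.cons_append] at hc
      obtain ⟨rfl, rfl⟩ := List.cons.inj hc
      exact .skip ha (ih hs rfl)

theorem isArtinSorting_one (c : List B) : M.IsArtinSorting c 1 [] := by
  induction c with
  | nil => exact .nil
  | cons s c ih => exact .skip (fun ⟨_, h⟩ => of_mul_ne_one M h.symm) ih

theorem isCyclicSorting_iff {c ω : List B} (hc : c.Nodup) {w : M.ArtinMonoid} :
    M.IsCyclicSorting c w ω ↔ M.IsArtinSorting c w ω := by
  constructor
  · intro h
    clear hc
    induction h with
    | nil => exact isArtinSorting_one _
    | take _ ih => exact .take ih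
    | @skip s c w ω hs h ih =>
      refine .skip (fun hd => artinAvoid_ne_one_of_dvd hd ?_) ?_
      · rwa [← h.artinProd_eq, artinAvoid_artinProd]
      · simpa using ih.remove (x := c) (y := []) hs
  · intro h
    induction h with
    | nil => exact .nil
    | take _ ih => exact .take (ih (CoxeterSystem.nodup_rotate hc))
    | @skip s c w ω hd h ih =>
      obtain ⟨hsc, hc0⟩ := List.nodup_cons.1 hc
      have hs : s ∉ ω := fun hm => hsc (h.subset s hm)
      exact .skip hs (IsCyclicSorting.insert (x := c) (y := []) (by simpa using ih hc0) hs)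

end CoxeterMatrix

/-! ### Greedy search and lexicographically first subwords. -/

namespace CoxeterSystem

open CoxeterMatrix

variable {B : Type*} {M : CoxeterMatrix B} {W : Type*} [Group W]

/-- The increasing list of positions, starting with `t`, that are found by the greedy search for
a word for `w` in the sequence of letters `f`. -/
inductive IsGreedy (M : CoxeterMatrix B) (f : ℕ → B) : ℕ → M.ArtinMonoid → List ℕ → Prop
  | nil {t : ℕ} : IsGreedy M f t 1 []
  | take {t : ℕ} {w : M.ArtinMonoid} {p : List ℕ} : IsGreedy M f (t + 1) w p →
      IsGreedy M f t (PresentedMonoid.of M.BraidRel (f t) * w) (t :: p)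
  | skip {t : ℕ} {w : M.ArtinMonoid} {p : List ℕ} : ¬ PresentedMonoid.of M.BraidRel (f t) ∣ w →
      IsGreedy M f (t + 1) w p → IsGreedy M f t w p

/-- `p` is an increasing list of positions, starting with `t`, of a word for `w`. -/
structure IsSubwordAt (M : CoxeterMatrix B) (f : ℕ → B) (t : ℕ) (w : M.ArtinMonoid)
    (p : List ℕ) : Prop where
  lt : p.Pairwise (· < ·)
  le : ∀ k ∈ p, t ≤ k
  prod : M.artinProd (p.map f) = w

theorem IsSubwordAt.cons {f : ℕ → B} {t : ℕ} {w : M.ArtinMonoid} {p : List ℕ}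
    (h : IsSubwordAt M f (t + 1) w p) :
    IsSubwordAt M f t (PresentedMonoid.of M.BraidRel (f t) * w) (t :: p) := by
  refine ⟨List.pairwise_cons.2 ⟨fun k hk => h.le k hk, h.lt⟩, fun k hk => ?_, ?_⟩
  · rcases List.mem_cons.1 hk with rfl | hk
    · exact le_rfl
    · exact Nat.le_of_succ_le (h.le k hk)
  · rw [List.map_cons, artinProd_cons, h.prod]

theorem IsSubwordAt.succ {f : ℕ → B} {t a : ℕ} {w : M.ArtinMonoid} {p : List ℕ}
    (h : IsSubwordAt M f t w (a :: p)) (ha : t < a) : IsSubwordAt M f (t + 1) w (a :: p) := by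
  refine ⟨h.lt, fun k hk => ?_, h.prod⟩
  rcases List.mem_cons.1 hk with rfl | hk
  · exact ha
  · exact ha.trans ((List.pairwise_cons.1 h.lt).1 k hk)

theorem IsSubwordAt.tail (cs : CoxeterSystem M W) {f : ℕ → B} {t : ℕ} {w : M.ArtinMonoid}
    {p : List ℕ} (h : IsSubwordAt M f t (PresentedMonoid.of M.BraidRel (f t) * w) (t :: p)) :
    IsSubwordAt M f (t + 1) w p := by
  refine ⟨(List.pairwise_cons.1 h.lt).2, fun k hk => (List.pairwise_cons.1 h.lt).1 k hk, ?_⟩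
  have := h.prod
  rw [List.map_cons, artinProd_cons] at this
  exact of_mul_left_cancel cs this

theorem IsGreedy.isSubwordAt {f : ℕ → B} {t : ℕ} {w : M.ArtinMonoid} {p : List ℕ}
    (h : IsGreedy M f t w p) : IsSubwordAt M f t w p := by
  induction h with
  | nil => exact ⟨by simp, by simp, artinProd_nil M⟩
  | take _ ih => exact ih.cons
  | skip _ _ ih => exact ⟨ih.lt, fun k hk => Nat.le_of_succ_le (ih.le k hk), ih.prod⟩

theorem IsGreedy.le (cs : CoxeterSystem M W) {f : ℕ → B} {t : ℕ} {w : M.ArtinMonoid} {p q : List ℕ}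
    (h : IsGreedy M f t w p) (hq : IsSubwordAt M f t w q) : p ≤ q := by
  induction h generalizing q with
  | nil => exact not_lt.1 (List.not_lt_nil q)
  | @take t w p h ih =>
    obtain _ | ⟨a, q⟩ := q
    · exact absurd hq.prod.symm (of_mul_ne_one M)
    · rcases (hq.le a (by simp)).eq_or_lt with rfl | ha
      · exact List.cons_le_cons _ (ih (hq.tail cs))
      · exact le_of_lt (List.cons_lt_cons_iff.2 (Or.inl ha))
  | @skip t w p hd h ih =>
    obtain _ | ⟨a, q⟩ := q
    · exact ih ⟨by simp, by simp, hq.prod⟩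
    · rcases (hq.le a (by simp)).eq_or_lt with rfl | ha
      · refine absurd ?_ hd
        rw [← hq.prod, List.map_cons, artinProd_cons]
        exact dvd_mul_right _ _
      · exact ih (hq.succ ha)

section Periodic

variable {f : ℕ → B} {n : ℕ}

theorem exists_isSubwordAt (hf : ∀ i t, (∃ k, f k = i) → ∃ k, t ≤ k ∧ f k = i)
    {ω : List B} (hω : ∀ i ∈ ω, ∃ k, f k = i) (t : ℕ) :
    ∃ q, IsSubwordAt M f t (M.artinProd ω) q := by
  induction ω generalizing t with
  | nil => exact ⟨[], by simp, by simp, rfl⟩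
  | cons i ω ih =>
    obtain ⟨k, hk, rfl⟩ := hf i t (hω i (by simp))
    obtain ⟨q, hq⟩ := ih (fun j hj => hω j (by simp [hj])) (k + 1)
    refine ⟨k :: q, hq.cons.lt, fun j hj => hk.trans (hq.cons.le j hj), ?_⟩
    rw [hq.cons.prod, artinProd_cons]

theorem IsSubwordAt.isGreedy (cs : CoxeterSystem M W)
    (hf : ∀ i t, (∃ k, f k = i) → ∃ k, t ≤ k ∧ f k = i) {t : ℕ} {w : M.ArtinMonoid} {p : List ℕ}
    (h : IsSubwordAt M f t w p) (hmin : ∀ q, IsSubwordAt M f t w q → p ≤ q) :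
    IsGreedy M f t w p := by
  induction p generalizing t w with
  | nil =>
    rw [← h.prod]
    exact .nil
  | cons a p ih =>
    obtain ⟨m, hm⟩ := Nat.exists_eq_add_of_le (h.le a (by simp))
    induction m generalizing t with
    | zero =>
      obtain rfl : a = t := hm
      have e : PresentedMonoid.of M.BraidRel (f a) * M.artinProd (p.map f) = w := by
        rw [← h.prod, List.map_cons, artinProd_cons]
      subst e
      refine .take (ih (h.tail cs) fun q hq => ?_)
      have := hmin _ hq.cons
      exact not_lt.1 fun h => not_lt.2 this (List.cons_lt_cons_iff.2 (Or.inr ⟨rfl, h⟩))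
    | succ m ihm =>
      refine .skip ?_ (ihm (h.succ (by omega)) (fun q hq => hmin q ⟨hq.lt, fun k hk =>
        Nat.le_of_succ_le (hq.le k hk), hq.prod⟩) (by omega))
      -- If the letter at `t` divided the element, a subword starting at `t` would be
      -- lexicographically earlier. It exists because all words for an element use the same letters,
      -- and these recur forever.
      rintro ⟨w', rfl⟩
      obtain ⟨ω, rfl⟩ := M.artinProd_surjective w'
      obtain ⟨q, hq⟩ := exists_isSubwordAt (M := M) hf (ω := ω) (fun i hi => by
        by_contra hcon
        have h1 := M.artinAvoid_artinProd (i := i) (ω := (a :: p).map f)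
        rw [h.prod, ← artinProd_cons, artinAvoid_artinProd] at h1
        refine h1.2 (fun hmem => ?_) (List.mem_cons_of_mem _ hi)
        obtain ⟨k, -, hk⟩ := List.mem_map.1 hmem
        exact hcon ⟨k, hk⟩) (t + 1)
      refine absurd (hmin _ hq.cons) (not_le.2 (List.cons_lt_cons_iff.2 (Or.inl ?_)))
      omega

theorem range_map_succ (hper : ∀ t, f (t + (n + 1)) = f t) (t : ℕ) : ∃ c : List B,
    (List.range (n + 1)).map (fun k => f (t + k)) = f t :: c ∧
    (List.range (n + 1)).map (fun k => f (t + 1 + k)) = c ++ [f t] := by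
  refine ⟨(List.range n).map fun k => f (t + 1 + k), ?_, ?_⟩
  · rw [List.range_succ_eq_map, List.map_cons, List.map_map, Nat.add_zero]
    congr 1
    exact List.map_congr_left fun k _ => congrArg f (by simp; omega)
  · rw [List.range_succ, List.map_append, List.map_singleton, ← hper t]
    congr 3
    omega

theorem exists_isGreedy_of_isCyclicSorting (hper : ∀ t, f (t + (n + 1)) = f t) {t : ℕ}
    {c ω : List B} {w : M.ArtinMonoid} (hc : c = (List.range (n + 1)).map fun k => f (t + k))
    (h : M.IsCyclicSorting c w ω) :
    ∃ p, IsGreedy M f t w p ∧ p.map f = ω ∧ ∀ k, k + (n + 1) ∈ p → t ≤ k → k ∈ p := by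
  induction h generalizing t with
  | nil => exact ⟨[], .nil, rfl, by simp⟩
  | @take s c w ω h ih =>
    obtain ⟨c', h1, h2⟩ := range_map_succ hper t
    rw [h1] at hc
    obtain ⟨rfl, rfl⟩ := List.cons.inj hc
    obtain ⟨p, hp, rfl, hdec⟩ := ih (t := t + 1) h2.symm
    refine ⟨t :: p, .take hp, rfl, fun k hk htk => ?_⟩
    rw [List.mem_cons] at hk ⊢
    rcases htk.eq_or_lt with rfl | htk
    · exact Or.inl rfl
    · exact Or.inr (hdec k (hk.resolve_left (by omega)) htk)
  | @skip s c w ω hs h ih =>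
    obtain ⟨c', h1, h2⟩ := range_map_succ hper t
    rw [h1] at hc
    obtain ⟨rfl, rfl⟩ := List.cons.inj hc
    obtain ⟨p, hp, rfl, hdec⟩ := ih (t := t + 1) h2.symm
    refine ⟨p, .skip (fun hd => artinAvoid_ne_one_of_dvd hd ?_) hp, rfl, fun k hk htk => ?_⟩
    · rwa [← h.artinProd_eq, artinAvoid_artinProd]
    · rcases htk.eq_or_lt with rfl | htk
      · exact absurd (List.mem_map.2 ⟨_, hk, hper t⟩) hs
      · exact hdec k hk htk

theorem IsGreedy.isCyclicSorting (hper : ∀ t, f (t + (n + 1)) = f t)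
    (hinj : ∀ t k, t < k → f k = f t → ∃ j, k = j + (n + 1) ∧ t ≤ j) {t : ℕ} {w : M.ArtinMonoid}
    {p : List ℕ} (h : IsGreedy M f t w p) (hdec : ∀ k, k + (n + 1) ∈ p → t ≤ k → k ∈ p) :
    M.IsCyclicSorting ((List.range (n + 1)).map fun k => f (t + k)) w (p.map f) := by
  induction h with
  | nil => exact .nil
  | @take t w p h ih =>
    obtain ⟨c, h1, h2⟩ := range_map_succ hper t
    rw [h2] at ih
    rw [h1]
    refine .take (ih fun k hk htk => ?_)
    have := hdec k (by simp [hk]) (by omega)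
    exact (List.mem_cons.1 this).resolve_left (by omega)
  | @skip t w p hd h ih =>
    obtain ⟨c, h1, h2⟩ := range_map_succ hper t
    rw [h2] at ih
    rw [h1]
    refine .skip (fun hm => ?_) (ih fun k hk htk => hdec k hk (by omega))
    obtain ⟨k, hk, e⟩ := List.mem_map.1 hm
    have hle := h.isSubwordAt.le
    -- A skipped letter that is used later would, by the decreasing property, be used one period
    -- earlier again and again without ever reaching `t`.
    induction k using Nat.strong_induction_on with
    | _ k ihk =>
      obtain ⟨j, rfl, hj⟩ := hinj t k (hle k hk) e
      exact ihk j (by omega) (hdec j hk hj) (by rw [← e, hper])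

end Periodic

/-! ### Comparison of positions, greedy search and recursion. -/

section Position

variable {c : List B}

/-- The position `(k, j)` as a natural number. -/
def Position.toNat (x : Position c) : ℕ := (ofLex x).1 * c.length + (ofLex x).2

theorem Position.strictMono_toNat : StrictMono (Position.toNat (c := c)) := by
  intro x y h
  have hx := (ofLex x).2.2
  have hy := (ofLex y).2.2
  rw [Prod.Lex.lt_iff] at h
  unfold Position.toNat
  rcases h with h | ⟨h1, h2⟩
  · have : ((ofLex x).1 + 1) * c.length ≤ (ofLex y).1 * c.length := Nat.mul_le_mul_right _ h
    rw [Nat.add_mul, one_mul] at this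
    omega
  · rw [h1]
    have : ((ofLex x).2 : ℕ) < (ofLex y).2 := h2
    omega

theorem Position.exists_toNat_eq (hc : 0 < c.length) (t : ℕ) : ∃ x : Position c, x.toNat = t :=
  ⟨toLex (t / c.length, ⟨t % c.length, Nat.mod_lt _ hc⟩), by
    simp [Position.toNat, Nat.div_add_mod']⟩

theorem map_lt_map_iff {α β : Type*} [LinearOrder α] [LinearOrder β] {e : α → β}
    (he : StrictMono e) {p q : List α} : p.map e < q.map e ↔ p < q := by
  induction p generalizing q with
  | nil => cases q <;> simp
  | cons a p ih =>
    cases q with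
    | nil => simp
    | cons b q =>
      rw [List.map_cons, List.map_cons, List.cons_lt_cons_iff, List.cons_lt_cons_iff, he.lt_iff_lt,
        he.injective.eq_iff, ih]

/-- The letter of `c c c ⋯` at a position that is given as a natural number. -/
def letterAt (hc : 0 < c.length) (t : ℕ) : B := c.get ⟨t % c.length, Nat.mod_lt _ hc⟩

theorem letterAt_toNat (hc : 0 < c.length) (x : Position c) :
    letterAt hc x.toNat = c.get (ofLex x).2 := by
  simp [letterAt, Position.toNat, Nat.mod_eq_of_lt]

theorem letterAt_add (hc : 0 < c.length) (t : ℕ) :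
    letterAt hc (t + c.length) = letterAt hc t := by
  simp [letterAt]

theorem map_letterAt (hc : 0 < c.length) :
    (List.range c.length).map (fun k => letterAt hc (0 + k)) = c := by
  apply List.ext_getElem
  · simp
  · intro k h1 h2
    simp [letterAt, Nat.mod_eq_of_lt h2]

theorem exists_le_letterAt (hc : 0 < c.length) (i : B) (t : ℕ) (h : ∃ k, letterAt hc k = i) :
    ∃ k, t ≤ k ∧ letterAt hc k = i := by
  obtain ⟨k, rfl⟩ := h
  refine ⟨k + t * c.length, ?_, by simp [letterAt]⟩
  have := Nat.le_mul_of_pos_right t hc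
  omega

theorem exists_add_of_letterAt_eq (hc : 0 < c.length) (hnd : c.Nodup) (t k : ℕ) (htk : t < k)
    (h : letterAt hc k = letterAt hc t) : ∃ j, k = j + c.length ∧ t ≤ j := by
  have h1 : t % c.length = k % c.length := ((hnd.getElem_inj_iff).1 h).symm
  have h2 := Nat.le_of_dvd (by omega) ((Nat.modEq_iff_dvd' htk.le).1 h1)
  exact ⟨k - c.length, by omega, by omega⟩

theorem isSubwordAt_map_toNat (hc : 0 < c.length) {w : M.ArtinMonoid} {p : List (Position c)} :
    IsSubwordAt M (letterAt hc) 0 w (p.map Position.toNat) ↔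
      p.Pairwise (· < ·) ∧ subword c p ∈ artinWords M w := by
  have e : (p.map Position.toNat).map (letterAt hc) = subword c p := by
    rw [List.map_map, subword]
    exact List.map_congr_left fun x _ => letterAt_toNat hc x
  have e2 : (p.map Position.toNat).Pairwise (· < ·) ↔ p.Pairwise (· < ·) := by
    rw [List.pairwise_map]
    simp only [Position.strictMono_toNat.lt_iff_lt]
  constructor
  · rintro ⟨h1, -, h2⟩
    exact ⟨e2.1 h1, by rwa [e] at h2⟩
  · rintro ⟨h1, h2⟩
    exact ⟨e2.2 h1, fun _ _ => Nat.zero_le _, by rwa [e]⟩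

theorem exists_map_toNat_eq (hc : 0 < c.length) (q : List ℕ) :
    ∃ p : List (Position c), p.map Position.toNat = q := by
  induction q with
  | nil => exact ⟨[], rfl⟩
  | cons t q ih =>
    obtain ⟨p, rfl⟩ := ih
    obtain ⟨x, rfl⟩ := Position.exists_toNat_eq hc t
    exact ⟨x :: p, rfl⟩

theorem isFirstSubword_iff_isGreedy (cs : CoxeterSystem M W) (hc : 0 < c.length)
    {w : M.ArtinMonoid} {p : List (Position c)} : IsFirstSubword c (artinWords M w) p ↔
      IsGreedy M (letterAt hc) 0 w (p.map Position.toNat) := by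
  constructor
  · rintro ⟨h1, h2, h3⟩
    refine IsSubwordAt.isGreedy cs (exists_le_letterAt hc) ((isSubwordAt_map_toNat hc).2 ⟨h1, h2⟩)
      fun q hq => ?_
    obtain ⟨q, rfl⟩ := exists_map_toNat_eq hc q
    obtain ⟨h4, h5⟩ := (isSubwordAt_map_toNat hc).1 hq
    rw [← not_lt, map_lt_map_iff Position.strictMono_toNat, not_lt]
    exact h3 q h4 h5
  · intro h
    obtain ⟨h1, h2⟩ := (isSubwordAt_map_toNat hc).1 h.isSubwordAt
    refine ⟨h1, h2, fun q h3 h4 => ?_⟩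
    rw [← not_lt, ← map_lt_map_iff Position.strictMono_toNat, not_lt]
    exact h.le cs ((isSubwordAt_map_toNat hc).2 ⟨h3, h4⟩)

theorem isDecreasing_iff (hc : 0 < c.length) {p : List (Position c)} : IsDecreasing c p ↔
    ∀ k, k + c.length ∈ p.map Position.toNat → 0 ≤ k → k ∈ p.map Position.toNat := by
  have hs : ∀ k j, Position.toNat (toLex (k + 1, j) : Position c) =
      Position.toNat (toLex (k, j) : Position c) + c.length := fun k j => by
    simp [Position.toNat, Nat.add_mul]; omega
  have hinj := (Position.strictMono_toNat (c := c)).injective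
  constructor
  · intro h k hk _
    obtain ⟨x, rfl⟩ := Position.exists_toNat_eq hc k
    have := hs (ofLex x).1 (ofLex x).2
    rw [show (toLex ((ofLex x).1, (ofLex x).2) : Position c) = x from rfl] at this
    rw [← this, List.mem_map_of_injective hinj] at hk
    rw [List.mem_map_of_injective hinj]
    exact h _ _ hk
  · intro h k j hk
    rw [← List.mem_map_of_injective hinj, hs] at hk
    have := h _ hk (Nat.zero_le _)
    rwa [List.mem_map_of_injective hinj] at this

theorem IsFirstSubword.eq {E : Set (List B)} {p q : List (Position c)} (hp : IsFirstSubword c E p)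
    (hq : IsFirstSubword c E q) : p = q :=
  le_antisymm (hp.2.2 q hq.1 hq.2.1) (hq.2.2 p hp.1 hp.2.1)

theorem IsFirstSubword.isArtinSorting (cs : CoxeterSystem M W) (hnd : c.Nodup)
    {w : M.ArtinMonoid} {p : List (Position c)} (hp : IsFirstSubword c (artinWords M w) p)
    (hdec : IsDecreasing c p) : M.IsArtinSorting c w (subword c p) := by
  rcases Nat.eq_zero_or_pos c.length with h0 | hc
  · obtain rfl : p = [] := List.eq_nil_iff_forall_not_mem.2 fun x _ => by
      have := (ofLex x).2.2
      omega
    obtain rfl := List.eq_nil_of_length_eq_zero h0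
    have : w = 1 := hp.2.1.symm.trans (artinProd_nil M)
    subst this
    exact .nil
  · rw [← isCyclicSorting_iff hnd]
    obtain ⟨n, hn⟩ : ∃ n, c.length = n + 1 := ⟨c.length - 1, by omega⟩
    have hg := (isFirstSubword_iff_isGreedy cs hc).1 hp
    rw [isDecreasing_iff hc, hn] at hdec
    have := hg.isCyclicSorting (n := n) (fun t => by rw [← hn]; exact letterAt_add hc t)
      (fun t k htk h => by rw [← hn]; exact exists_add_of_letterAt_eq hc hnd t k htk h) hdec
    rw [← hn, map_letterAt, List.map_map] at this
    rw [subword, ← List.map_congr_left fun x _ => letterAt_toNat hc x]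
    exact this

theorem exists_isFirstSubword (cs : CoxeterSystem M W) (hnd : c.Nodup) {w : M.ArtinMonoid}
    {ω : List B} (h : M.IsArtinSorting c w ω) :
    ∃ p, IsFirstSubword c (artinWords M w) p ∧ IsDecreasing c p ∧ subword c p = ω := by
  rcases Nat.eq_zero_or_pos c.length with h0 | hc
  · obtain rfl := List.eq_nil_of_length_eq_zero h0
    cases h
    exact ⟨[], ⟨by simp, artinProd_nil M, fun q _ _ => not_lt.1 (List.not_lt_nil q)⟩,
      fun k j h => by simp at h, rfl⟩
  · rw [← isCyclicSorting_iff hnd] at h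
    obtain ⟨n, hn⟩ : ∃ n, c.length = n + 1 := ⟨c.length - 1, by omega⟩
    obtain ⟨q, h1, h2, h3⟩ := exists_isGreedy_of_isCyclicSorting (f := letterAt hc) (n := n) (t := 0)
      (fun t => by rw [← hn]; exact letterAt_add hc t) (by rw [← hn, map_letterAt]) h
    obtain ⟨p, rfl⟩ := exists_map_toNat_eq hc q
    refine ⟨p, (isFirstSubword_iff_isGreedy cs hc).2 h1, (isDecreasing_iff hc).2 (by rwa [hn]), ?_⟩
    rw [← h2, List.map_map, subword]
    exact (List.map_congr_left fun x _ => letterAt_toNat hc x).symm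

theorem isSortable_iff (cs : CoxeterSystem M W) (hnd : c.Nodup) {w : M.ArtinMonoid} :
    IsSortable c w ↔ M.IsArtinSortable c w := by
  constructor
  · rintro ⟨p, h1, h2⟩
    exact ⟨_, h1.isArtinSorting cs hnd h2⟩
  · rintro ⟨ω, h⟩
    obtain ⟨p, h1, h2, -⟩ := exists_isFirstSubword cs hnd h
    exact ⟨p, h1, h2⟩

theorem isParabolicSortable_iff (cs : CoxeterSystem M W) (hnd : c.Nodup) {v : W} :
    cs.IsParabolicSortable c v ↔ M.IsArtinSortable c (cs.toArtin v) := by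
  rw [IsParabolicSortable, ← isSortable_iff cs hnd, IsSortable, artinWords_toArtin]
  refine and_iff_right_of_imp fun ⟨p, h1, h2⟩ => ?_
  rw [← h1.2.1.2]
  refine cs.wordProd_mem_parabolic fun i hi => ?_
  obtain ⟨x, -, rfl⟩ := List.mem_map.1 hi
  exact List.get_mem _ _

theorem isRestrictionWord_of_isRestriction [Finite W] (cs : CoxeterSystem M W) (hnd : c.Nodup)
    {v : W} {d : List B} (h : cs.IsRestriction c v d) : cs.IsRestrictionWord c v d := by
  obtain ⟨h1, h2, p, h3, h4⟩ := h
  obtain ⟨ω, hω⟩ := cs.exists_isSorting_longest hnd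
  -- The lexicographically first word of the longest element is unique, so it is the recursive
  -- sorting word, to which the skew form applies.
  obtain ⟨q, h5, -, rfl⟩ := exists_isFirstSubword cs hnd hω.isArtinSorting
  rw [artinWords_toArtin] at h5
  rw [h3.eq h5] at h4
  exact cs.isRestrictionWord_of_sublist hnd hω h1 h2 h4

theorem exists_isRestriction [Finite W] (cs : CoxeterSystem M W) (hnd : c.Nodup)
    {v : W} (hv : v ∈ cs.parabolic {i | i ∈ c}) : ∃ d, cs.IsRestriction c v d := by
  obtain ⟨ω, hω⟩ := cs.exists_isSorting_longest hnd
  obtain ⟨d, h1, h2, h3⟩ := cs.exists_sublist_leftInvSeq hω hv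
  obtain ⟨p, h5, -, rfl⟩ := exists_isFirstSubword cs hnd hω.isArtinSorting
  rw [artinWords_toArtin] at h5
  exact ⟨d, h1, h2, p, h5, h3⟩

end Position

end CoxeterSystem

/-! ### Iterating over the Garside factors. -/

namespace CoxeterSystem

open CoxeterMatrix

variable {B : Type*} {M : CoxeterMatrix B} {W : Type*} [Group W] [Finite W]
  (cs : CoxeterSystem M W)

open Classical in
/-- The successive restrictions of `c` with respect to a sequence of elements. -/
def restrictionSeq (c : List B) (v : ℕ → W) : ℕ → List B
  | 0 => c
  -- The default is never reached for the Garside factors of a sortable element, where every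
  -- restriction exists.
  | k + 1 => if h : ∃ d, cs.IsRestriction (restrictionSeq c v k) (v k) d then h.choose else []

theorem isRestriction_restrictionSeq {c : List B} {v : ℕ → W} {k : ℕ}
    (h : ∃ d, cs.IsRestriction (cs.restrictionSeq c v k) (v k) d) :
    cs.IsRestriction (cs.restrictionSeq c v k) (v k) (cs.restrictionSeq c v (k + 1)) := by
  rw [restrictionSeq, dif_pos h]
  exact h.choose_spec

theorem isArtinSortable_iff_of_isRestriction {c d : List B} {w : M.ArtinMonoid} (hc : c.Nodup)
    (hd : cs.IsRestriction c (cs.head w) d) : M.IsArtinSortable c w ↔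
      M.IsArtinSortable c (cs.toArtin (cs.head w)) ∧ M.IsArtinSortable d (cs.rest w) :=
  cs.isArtinSortable_iff_head_rest _ le_rfl hc (isRestrictionWord_of_isRestriction cs hc hd)

theorem IsArtinSortable.restrictionSeq {c : List B} (hc : c.Nodup) {w : M.ArtinMonoid}
    (h : M.IsArtinSortable c w) {v : ℕ → W} (hv : ∀ k, v k = cs.head (cs.rest^[k] w)) (k : ℕ) :
    (cs.restrictionSeq c v k).Nodup ∧ M.IsArtinSortable (cs.restrictionSeq c v k) (cs.rest^[k] w) ∧
      cs.IsRestriction (cs.restrictionSeq c v k) (v k) (cs.restrictionSeq c v (k + 1)) := by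
  have step : ∀ k, (cs.restrictionSeq c v k).Nodup →
      M.IsArtinSortable (cs.restrictionSeq c v k) (cs.rest^[k] w) →
      cs.IsRestriction (cs.restrictionSeq c v k) (v k) (cs.restrictionSeq c v (k + 1)) := by
    intro k h1 h2
    refine cs.isRestriction_restrictionSeq (exists_isRestriction cs h1 ?_)
    rw [hv]
    exact cs.head_mem_parabolic fun i hi => h2.artinAvoid_eq_one hi
  induction k with
  | zero => exact ⟨hc, h, step 0 hc h⟩
  | succ k ih =>
    obtain ⟨h1, h2, h3⟩ := ih
    have h4 := h3
    rw [hv] at h4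
    have h5 := ((cs.isArtinSortable_iff_of_isRestriction h1 h4).1 h2).2
    rw [← Function.iterate_succ_apply' cs.rest] at h5
    exact ⟨h3.1, h5, step _ h3.1 h5⟩

theorem isFactorwiseSortable_of_isArtinSortable {c : List B} (hc : c.Nodup) {m : ℕ}
    {w : M.ArtinMonoid} (h : M.IsArtinSortable c w) : cs.IsFactorwiseSortable m c w := by
  have key := IsArtinSortable.restrictionSeq cs hc h (fun _ => rfl)
  refine ⟨fun k => cs.head (cs.rest^[k] w), cs.restrictionSeq c _,
    cs.isGarsideFactorization_head w, rfl, fun i _ => (key i).2.2, fun i _ => ?_⟩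
  rw [isParabolicSortable_iff cs (key i).1]
  exact ((cs.isArtinSortable_iff_of_isRestriction (key i).1 (key i).2.2).1 (key i).2.1).1

theorem IsFactorwiseSortable.isArtinSortable {c : List B} (hc : c.Nodup) {m : ℕ}
    {w : M.ArtinMonoid} (hw : w ∈ cs.mWeak m) (h : cs.IsFactorwiseSortable m c w) :
    M.IsArtinSortable c w := by
  obtain ⟨v, C, hv, rfl, hres, hsort⟩ := h
  have hw1 := cs.rest_iterate_eq_one hw
  have hnd : ∀ i, i < m → (C i).Nodup := fun i hi => by
    cases i with
    | zero => exact hc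
    | succ i => exact (hres i hi).1
  have key : ∀ j i, i + j + 1 = m → M.IsArtinSortable (C i) (cs.rest^[i] w) := by
    intro j
    induction j with
    | zero =>
      intro i hi
      have h1 := hsort i (by omega)
      have h2 := h1.1
      rw [isParabolicSortable_iff cs (hnd i (by omega))] at h1
      rw [IsGarsideFactorization.eq cs hv i] at h1 h2
      -- No restriction is prescribed after the last factor. Any one serves, since the remainder is
      -- `1` and sortable for every word.
      obtain ⟨d, hd⟩ := exists_isRestriction cs (hnd i (by omega)) h2
      refine (cs.isArtinSortable_iff_of_isRestriction (hnd i (by omega)) hd).2 ⟨h1, ?_⟩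
      rw [← Function.iterate_succ_apply' cs.rest, show i.succ = m by omega, hw1]
      exact ⟨[], isArtinSorting_one d⟩
    | succ j ih =>
      intro i hi
      have h1 := hsort i (by omega)
      have h2 := hres i (by omega)
      rw [isParabolicSortable_iff cs (hnd i (by omega))] at h1
      rw [IsGarsideFactorization.eq cs hv i] at h1 h2
      refine (cs.isArtinSortable_iff_of_isRestriction (hnd i (by omega)) h2).2 ⟨h1, ?_⟩
      rw [← Function.iterate_succ_apply' cs.rest]
      exact ih (i + 1) (by omega)
  cases m with
  | zero =>
    rw [show w = 1 from hw1]
    exact ⟨[], isArtinSorting_one _⟩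
  | succ m => exact key m 0 (by omega)

end CoxeterSystem

end

theorem mainTheorem10 {B : Type*} {M : CoxeterMatrix B} {W : Type*} [Group W] [Finite W]
    (cs : CoxeterSystem M W) (c : List B) (hc : CoxeterSystem.IsCoxeterWord c)
    (m : ℕ) (w : M.ArtinMonoid) (hw : w ∈ cs.mWeak m) :
    CoxeterSystem.IsSortable c w ↔ cs.IsFactorwiseSortable m c w := by
  rw [CoxeterSystem.isSortable_iff cs hc.1]
  exact ⟨cs.isFactorwiseSortable_of_isArtinSortable hc.1,
    CoxeterSystem.IsFactorwiseSortable.isArtinSortable cs hc.1 hw⟩
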